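/- **Setting.** Let $P=\mathbb R^2/\sim$ be the pillowcase, the quotient of the plane with coordinates $(\gamma,\theta)$ by the group generated by the translations by $2\pi$ in each coordinate and by $-1$; its four corners are the images of the points of $(\pi\mathbb Z)^2$, and $P^*$ is $P$ minus the corners. For $0<\epsilon<1$ let $L_0=L_0^{\epsilon,0}:\mathbb R/2\pi\mathbb Z\to P^*$ be the immersed circle with lift $t\mapsto(\tfrac\pi2+t+\epsilon\sin t,\ \tfrac\pi2+t-\epsilon\sin t)$. Let $z\in H^1(P^*;\mathbb Z/4)$ be the class which takes the value $1$ on each small counterclockwise loop around a corner, represented by a map $\tilde z:P^*\to S^1$ whose class in $H^1(P^*;\mathbb Z)$ reduces to $z$ mod $4$ (such maps exist). Let $\ell_1$ be the line field of constant slope $1$ on $P^*$, and let $\ell_{\rm inst}$ be $\ell_1$ twisted by $\tilde z$ so that $\mu(L,\ell_{\rm inst})\equiv\mu(L,\ell_1)+z(L)$ mod $4$ for loops $L$, where $\mu(L,\ell)$ is the rotation number (in half turns) of the tangent line of $L$ relative to $\ell$. For transverse immersed curves $L_0:R_0\to P^*$, $L_1:R_1\to P^*$ with path connected domains, $C(L_0,L_1)$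 is the $\mathbb F_2$-vector space on the intersection points, i.e. on the pairs $(s,t)\in R_0\times R_1$ with $L_0(s)=L_1(t)$. Its differential is $\partial x=\sum_y\#\mathcal M(x,y)\,y$, where $\mathcal M(x,y)$ is the set of equivalence classes of immersed bigons in $P^*$ (immersed $2$-gons of Maslov index $1$) from $x$ to $y$ with boundary on $L_0,L_1$. The relative grading $gr(x,y)\in\mathbb Z/4$ is the mod $4$ reduction of $$\mathrm{Mas}(\gamma_0,\gamma_1)=1-\mu(L_0,\ell_{\rm inst})_{\gamma_0}-\mu(L_1,\ell_{\rm inst})_{\gamma_1}-\tau(L_0,L_1,\ell_{\rm inst})_y-\tau(L_1,L_0,\ell_{\rm inst})_x$$ for paths $\gamma_0$ from $y$ to $x$ in $R_0$ and $\gamma_1$ from $x$ to $y$ in $R_1$. Here $\mu(L,\ell)_\gamma$ is the degree of the path of tangent lines of $L$ along $\gamma$ in $\mathbb{RP}^1\cong S^1$, in the trivialisation in which $\ell$ is the constant section $1$; the degree of a path $t\mapsto e^{2\pi i f(t)}$, $t\in[0,1]$, is $\lceil f(1)\rceil-\lceil f(0)\rceil$; and $\tau(\ell_0,\ell_1,\ell)$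 is minus the degree of the shortest clockwise rotation from $\ell_0$ to $\ell_1$, relative to $\ell$. Let $p>0$ be odd and $q$ an integer prime to $p$, and let $K=K(p,q)\subset S^3$ be the $2$-bridge knot in Conway's normal form given by a continued fraction expansion of $p/q$. It is decomposed as $(S^3,K)=(Y,T)\cup(D,U)$, where $U$ consists of two nested caps and $T$ is the rational tangle formed by two side by side cups followed by the $4$-strand braid of the expansion. Let $a,b,c,d$ be the four points of $K\cap\partial D$, from left to right, with meridians oriented by an orientation of $K$. Let $R(Y,T)$ and $R(S^2,\{a,b,c,d\})$ be the traceless $SU(2)$ character varieties: conjugacy classes of representations of the fundamental group of the complement sending meridians to traceless elements of $SU(2)$, viewed as the unit quaternions. The point of $P$ with coordinates $(\gamma,\theta)$ is identified with the class in $R(S^2,\{a,b,c,d\})$ of $a\mapsto\mathbf i$, $b\mapsto e^{\gamma\mathbf k}\mathbf i$, $c\mapsto e^{\theta\mathbf k}\mathbf i$, $d\mapsto e^{(\theta-\gamma)\mathbf k}\mathbf i$. Let $L_1:R(Y,T)\to P$ be the restriction map. **Theorem.** (1) $R(Y,T)$ is homeomorphic to $[0,\pi]$ in such a way that $L_1(t)=[(qt,(q-p)t)]$,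 and $L_1$ is an embedding: $L_1$ is a linearly embedded arc of slope $\tfrac{q-p}q$. Moreover it is a restricted immersed arc, i.e. a proper immersed arc which, away from the open $\delta$-neighbourhoods of the corners, is for all small $\delta>0$ an immersed arc with distinct endpoints on the boundary, transverse to the boundary there, and with embedded lifts to the universal cover. (2) There is $\epsilon_0\in(0,1]$ such that for every $0<\epsilon<\epsilon_0$ the curves $L_0=L_0^{\epsilon,0}$ and $L_1$ are transverse and their intersection points are exactly the $p$ distinct points $r_+^\epsilon$ and $x_\ell^+,x_\ell^-$, $1\le\ell\le\tfrac{p-1}2$. These depend continuously on $\epsilon$. As $\epsilon\to0$, the parameter in $[0,\pi]$ along $L_1$ of $r_+^\epsilon$ tends to $0$ and those of $x_\ell^\pm$ tend to $2\pi\ell/p$. The slope of $L_0$ is less than $1$ at $x_\ell^+$ and greater than $1$ at $x_\ell^-$. In particular $C(L_0,L_1)$ has rank $p$. (3) For every such $\epsilon$ and every $\tilde z$ as above, $gr(x,y)$ does not depend on the choice of the paths. Let the absolute $\mathbb Z/4$-grading be normalised by $gr(r_+^\epsilon)=\sigma(K)$ mod $4$, where $\sigma(K)$ is the signature of $K$.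 The grading is determined by $$gr(r_+^\epsilon)=\sigma(K),\qquad gr(x_\ell^+,x_\ell^-)=1,\qquad gr(r_+^\epsilon,x_\ell^\circ)=z(\alpha)\qquad(1\le\ell\le\tfrac{p-1}2),$$ where $x_\ell^\circ=x_\ell^+$ if $|q-p|>|q|$ (slope of absolute value greater than $1$) and $x_\ell^\circ=x_\ell^-$ if $|q-p|<|q|$, and $\alpha$ is any loop which starts at $r_+^\epsilon$, follows $L_0$ to $x_\ell^\circ$ and returns to $r_+^\epsilon$ along $L_1$. (4) All sets $\mathcal M(x,y)$ are finite and $\partial=0$. Hence assigning to a cycle its homology class is an isomorphism of $\mathbb Z/4$-graded vector spaces from $C(L_0,L_1)$ to its homology $H^\natural(Y,T)$. -/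

import Mathlib

open Set Filter Topology
open scoped unitInterval Quaternion ContDiff

namespace TwoBridge

noncomputable section

/-! ## The pillowcase

The plane `ℝ²` with coordinates `(γ, θ)` is identified with `ℂ` through `γ + θ i`. -/

/-- The lattice point `(π m, π n)`. -/
def latticePt (m n : ℤ) : ℂ := ((Real.pi * m : ℝ) : ℂ) + ((Real.pi * n : ℝ) : ℂ) * Complex.I

/-- The lattice `(π ℤ)²`. -/
def Lattice : Set ℂ := {z | ∃ m n : ℤ, z = latticePt m n}

/-- Two points of the plane are related if they differ by the group generated by the translations
by `2π` in the two coordinate directions and by `z ↦ -z`. -/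
def PillowRel (z w : ℂ) : Prop :=
  ∃ m n : ℤ, w = z + latticePt (2 * m) (2 * n) ∨ w = -z + latticePt (2 * m) (2 * n)

theorem latticePt_add (a b c d : ℤ) :
    latticePt a b + latticePt c d = latticePt (a + c) (b + d) := by
  simp only [latticePt]; push_cast; ring

theorem latticePt_neg (a b : ℤ) : -latticePt a b = latticePt (-a) (-b) := by
  simp only [latticePt]; push_cast; ring

theorem pillowRel_equivalence : Equivalence PillowRel := by
  refine ⟨fun z => ⟨0, 0, Or.inl (by simp [latticePt])⟩, ?_, ?_⟩
  · rintro z w ⟨m, n, h | h⟩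
    · refine ⟨-m, -n, Or.inl ?_⟩
      rw [h, show 2 * -m = -(2 * m) by ring, show 2 * -n = -(2 * n) by ring, ← latticePt_neg]
      ring
    · exact ⟨m, n, Or.inr (by rw [h]; ring)⟩
  · rintro x y z ⟨m, n, h | h⟩ ⟨m', n', h' | h'⟩
    · exact ⟨m + m', n + n', Or.inl (by rw [h', h, add_assoc, latticePt_add]; ring_nf)⟩
    · refine ⟨m' - m, n' - n, Or.inr ?_⟩
      rw [h', h, show 2 * (m' - m) = -(2 * m) + 2 * m' by ring,
        show 2 * (n' - n) = -(2 * n) + 2 * n' by ring, ← latticePt_add, ← latticePt_neg]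
      ring
    · exact ⟨m + m', n + n', Or.inr (by rw [h', h, add_assoc, latticePt_add]; ring_nf)⟩
    · refine ⟨m' - m, n' - n, Or.inl ?_⟩
      rw [h', h, show 2 * (m' - m) = -(2 * m) + 2 * m' by ring,
        show 2 * (n' - n) = -(2 * n) + 2 * n' by ring, ← latticePt_add, ← latticePt_neg]
      ring

def pillowSetoid : Setoid ℂ := ⟨PillowRel, pillowRel_equivalence⟩

/-- The pillowcase `P`, with the quotient topology. -/
abbrev Pillowcase : Type := Quotient pillowSetoid

/-- The branched covering `ℝ² → P`. -/
def toP (z : ℂ) : Pillowcase := Quotient.mk pillowSetoid z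

theorem continuous_toP : Continuous toP := continuous_quotient_mk'

/-- The four corners of `P` are the images of the lattice points. -/
def IsCorner (x : Pillowcase) : Prop := ∃ z ∈ Lattice, toP z = x

/-- `P*`, the pillowcase without its corners. -/
abbrev PStar : Type := {x : Pillowcase // ¬ IsCorner x}

theorem not_isCorner_toP {z : ℂ} (hz : z ∉ Lattice) : ¬ IsCorner (toP z) := by
  rintro ⟨w, ⟨a, b, rfl⟩, h⟩
  obtain ⟨m, n, h | h⟩ := (Quotient.exact h : PillowRel _ _)
  · exact hz ⟨_, _, by rw [h, latticePt_add]⟩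
  · exact hz ⟨_, _, by rw [h, latticePt_neg, latticePt_add]⟩

/-! ## Degree, line fields, Maslov index

The deck group of `ℝ² ∖ (πℤ)² → P*` acts on tangent vectors by `±1`, hence trivially on lines, so
the projectivised tangent bundle of `P*` is canonically `P* × ℝP¹`.  The circle `ℝP¹` of lines is
identified with the unit circle, the line spanned by `v = r e^{iα}` being sent to `e^{2iα}`; so
one turn of the circle is a rotation of a line through the angle `π`. -/

theorem exists_circle_lift (α : C(I, Circle)) :
    ∃ f : C(I, ℝ), ∀ t, Circle.exp (2 * Real.pi * f t) = α t := by
  have hx : Circle.exp (Complex.arg (α 0)) = α 0 := Circle.exp_arg _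
  obtain ⟨g, hg, -⟩ := Circle.isCoveringMap_exp.exists_path_lifts α _ hx.symm
  refine ⟨⟨fun t => g t / (2 * Real.pi), by fun_prop⟩, fun t => ?_⟩
  have h := congrFun hg t
  simp only [Function.comp_apply] at h
  rw [← h]
  congr 1
  simp only [ContinuousMap.coe_mk]
  field_simp

/-- The degree of a path `α` in the circle: the signed number of passages of `α` through
`e^{iδ}`, for all small `δ > 0`.  If `α = exp (2πi f)` then for small `δ > 0` this number is
`⌈f 1⌉ - ⌈f 0⌉`. -/
def degree (α : C(I, Circle)) : ℤ :=
  ⌈(exists_circle_lift α).choose 1⌉ - ⌈(exists_circle_lift α).choose 0⌉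

/-- A line field on `P*`. -/
abbrev LineField : Type := C(PStar, Circle)

/-- The point of `ℝP¹`, as a unit complex number, given by the line spanned by `v`. -/
def lineDir (v : {v : ℂ // v ≠ 0}) : Circle :=
  ⟨v.1 ^ 2 / (‖v.1‖ : ℂ) ^ 2, mem_sphere_zero_iff_norm.2 (by
    have h : ‖v.1‖ ≠ 0 := norm_ne_zero_iff.2 v.2
    simp [h])⟩

theorem continuous_lineDir : Continuous lineDir := by
  refine Continuous.subtype_mk (Continuous.div (by fun_prop) (by fun_prop) fun v => ?_) _
  have h : ‖v.1‖ ≠ 0 := norm_ne_zero_iff.2 v.2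
  exact_mod_cast pow_ne_zero 2 h

/-- The line field of constant slope one. -/
def slopeOne : LineField :=
  ContinuousMap.const _ (lineDir ⟨1 + Complex.I, fun h => by simpa using congrArg Complex.re h⟩)

/-- A curve `R → P*` together with its tangent line field along `R`. -/
structure TangentCurve (R : Type) [TopologicalSpace R] where
  map : C(R, PStar)
  line : C(R, Circle)

section Maslov

variable {R R₀ R₁ : Type} [TopologicalSpace R] [TopologicalSpace R₀] [TopologicalSpace R₁]

/-- The Maslov index `μ(L, ℓ)_γ`: the degree of the tangent line along `γ`, measured in the
trivialisation in which `ℓ` is the constant section `1`. -/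
def mu (L : TangentCurve R) (ℓ : LineField) {a b : R} (γ : Path a b) : ℤ :=
  degree ⟨fun t => L.line (γ t) / ℓ (L.map (γ t)), by fun_prop⟩

/-- The triple index `τ(ℓ₀, ℓ₁, ℓ)` of transverse lines: minus the Maslov index, with respect to
`ℓ`, of the shortest clockwise rotation from `ℓ₀` to `ℓ₁`. -/
def tau (ℓ₀ ℓ₁ ℓ : Circle) : ℤ :=
  -degree ⟨fun t : I => ℓ₀ * Circle.exp (-(2 * Real.pi *
      Int.fract (Complex.arg ((ℓ₀ / ℓ₁ : Circle) : ℂ) / (2 * Real.pi)) * (t : ℝ))) / ℓ,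
    by fun_prop⟩

/-- The intersection points of two curves, as pairs of points of the domains. -/
abbrev IntPt (L₀ : TangentCurve R₀) (L₁ : TangentCurve R₁) : Type :=
  {x : R₀ × R₁ // L₀.map x.1 = L₁.map x.2}

def Transverse (L₀ : TangentCurve R₀) (L₁ : TangentCurve R₁) : Prop :=
  ∀ x : IntPt L₀ L₁, L₀.line x.1.1 ≠ L₁.line x.1.2

variable {L₀ : TangentCurve R₀} {L₁ : TangentCurve R₁}

/-- `Mas_ℓ (γ₀, γ₁) = 1 - ∑ₖ (μ(Lₖ, ℓ)_{γₖ} + τ(Lₖ, Lₖ₋₁, ℓ)_{pₖ})` for the intersection points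
`p₁ = x`, `p₀ = p₂ = y`, where `γₖ` is a path in `Rₖ` from `pₖ` to `pₖ₊₁`. -/
def mas (ℓ : LineField) (x y : IntPt L₀ L₁)
    (γ₀ : Path y.1.1 x.1.1) (γ₁ : Path x.1.2 y.1.2) : ℤ :=
  1 - ((mu L₀ ℓ γ₀ + tau (L₀.line y.1.1) (L₁.line y.1.2) (ℓ (L₀.map y.1.1)))
      + (mu L₁ ℓ γ₁ + tau (L₁.line x.1.2) (L₀.line x.1.1) (ℓ (L₀.map x.1.1))))

/-! ## The class `z`, the instanton line field, the relative grading -/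

/-- A map `P* → S¹`, i.e. an integral class in `H¹(P*; ℤ) = [P*, S¹]`, whose reduction mod `4`
assigns `1` to each small loop circling a corner counterclockwise.  (In `ℝ²` such a loop is a
half circle around a lattice point.)  The reduction in `H¹(P*; ℤ/4)` is the class `z`. -/
def LiftsZ (zt : C(PStar, Circle)) : Prop :=
  ∀ m n : ℤ, ∀ᶠ r : ℝ in 𝓝[>] 0, ∀ α : C(I, PStar),
    (∀ t : I, (α t : Pillowcase) =
      toP (latticePt m n + r * Complex.exp (((Real.pi * (t : ℝ) : ℝ) : ℂ) * Complex.I))) →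
    (degree (zt.comp α) : ZMod 4) = 1

/-- The value on a loop of the mod `4` class represented by `zt`. -/
def zEval (zt : C(PStar, Circle)) {a : PStar} (α : Path a a) : ZMod 4 :=
  (degree (zt.comp α.toContinuousMap) : ZMod 4)

/-- The instanton line field: the slope one line field twisted by `zt`, in the sense for which
`μ(L, ℓ_inst) ≡ μ(L, ℓ₁) + z(L)` for loops `L`. -/
def instField (zt : C(PStar, Circle)) : LineField := zt⁻¹ * slopeOne

/-- The relative grading `gr(x, y)`: the mod `4` reduction of `Mas` with respect to the instanton
line field, for some choice of paths. -/
def gr [PathConnectedSpace R₀] [PathConnectedSpace R₁] (zt : C(PStar, Circle))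
    (x y : IntPt L₀ L₁) : ZMod 4 :=
  (mas (instField zt) x y (PathConnectedSpace.somePath _ _)
    (PathConnectedSpace.somePath _ _) : ZMod 4)

/-- The loop in `P*` which starts at `x`, follows `L₀` to `y` and returns to `x` along `L₁`. -/
def loopThrough (x y : IntPt L₀ L₁) (α₀ : Path x.1.1 y.1.1) (α₁ : Path y.1.2 x.1.2) :
    Path (L₀.map x.1.1) (L₀.map x.1.1) :=
  (α₀.map L₀.map.continuous).trans ((α₁.map L₁.map.continuous).cast y.2 x.2)

/-! ## Bigons and the differential -/

variable (L₀ L₁) in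
/-- An immersed bigon (an immersed `2`-gon of Maslov index `1`) from `x` to `y` for the ordered
pair `(L₀, L₁)`. -/
structure Bigon (x y : IntPt L₀ L₁) where
  /-- The closed topological disc and the two smooth embedded arcs forming its boundary. -/
  D : Set ℂ
  disc : Nonempty (D ≃ₜ Metric.closedBall (0 : ℂ) 1)
  β₀ : ℝ → ℂ
  β₁ : ℝ → ℂ
  smooth₀ : ContDiff ℝ ∞ β₀
  smooth₁ : ContDiff ℝ ∞ β₁
  immersed₀ : ∀ t ∈ I, deriv β₀ t ≠ 0
  immersed₁ : ∀ t ∈ I, deriv β₁ t ≠ 0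
  inj₀ : InjOn β₀ I
  inj₁ : InjOn β₁ I
  end₀ : β₀ 1 = β₁ 0
  end₁ : β₁ 1 = β₀ 0
  /-- The two arcs form a simple closed curve, which is the boundary of the disc ... -/
  simple : β₀ '' I ∩ β₁ '' I = {β₀ 0, β₀ 1}
  boundary : frontier D = β₀ '' I ∪ β₁ '' I
  /-- ... traversed clockwise: the disc lies to the right of each arc. -/
  clockwise₀ : ∀ t ∈ Ioo (0 : ℝ) 1, ∀ᶠ s : ℝ in 𝓝[>] 0,
    β₀ t + s * (-Complex.I * deriv β₀ t) ∈ interior D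
  clockwise₁ : ∀ t ∈ Ioo (0 : ℝ) 1, ∀ᶠ s : ℝ in 𝓝[>] 0,
    β₁ t + s * (-Complex.I * deriv β₁ t) ∈ interior D
  /-- The arcs meet transversely at their endpoints. -/
  corner₀ : LinearIndependent ℝ ![deriv β₀ 1, deriv β₁ 0]
  corner₁ : LinearIndependent ℝ ![deriv β₁ 1, deriv β₀ 0]
  γ₀ : Path y.1.1 x.1.1
  γ₁ : Path x.1.2 y.1.2
  /-- The orientation preserving immersion of the disc. -/
  u : D → PStar
  immersion : ∀ w : D, ∃ (V : Set ℂ) (v : ℂ → ℂ), IsOpen V ∧ (w : ℂ) ∈ V ∧ ContDiffOn ℝ ∞ v V ∧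
    (∀ ξ ∈ V, 0 < (fderiv ℝ v ξ).det) ∧ ∀ ξ : D, (ξ : ℂ) ∈ V → (u ξ : Pillowcase) = toP (v ξ)
  bdry₀ : ∀ t : I, ∃ h : β₀ t ∈ D, u ⟨β₀ t, h⟩ = L₀.map (γ₀ t)
  bdry₁ : ∀ t : I, ∃ h : β₁ t ∈ D, u ⟨β₁ t, h⟩ = L₁.map (γ₁ t)
  /-- Maslov index one.  (It does not depend on the line field used to compute it.) -/
  maslov : mas slopeOne x y γ₀ γ₁ = 1

/-- Two bigons are equivalent if they differ by an orientation preserving diffeomorphism of the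
discs. -/
def Bigon.Equiv {x y : IntPt L₀ L₁} (b b' : Bigon L₀ L₁ x y) : Prop :=
  ∃ (V V' : Set ℂ) (ψ φ : ℂ → ℂ), IsOpen V ∧ IsOpen V' ∧ b.D ⊆ V ∧ b'.D ⊆ V' ∧
    ContDiffOn ℝ ∞ ψ V ∧ ContDiffOn ℝ ∞ φ V' ∧ (∀ ξ ∈ b.D, 0 < (fderiv ℝ ψ ξ).det) ∧
    MapsTo φ b'.D b.D ∧ (∀ ξ ∈ b.D, φ (ψ ξ) = ξ) ∧ (∀ ξ ∈ b'.D, ψ (φ ξ) = ξ) ∧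
    ∀ ξ : b.D, ∃ h : ψ ξ ∈ b'.D, b.u ξ = b'.u ⟨ψ ξ, h⟩

variable (L₀ L₁) in
/-- The set `M(x, y)` of equivalence classes of bigons from `x` to `y`. -/
def Moduli (x y : IntPt L₀ L₁) : Type := Quot (Bigon.Equiv (x := x) (y := y))

variable (L₀ L₁) in
/-- `C(L₀, L₁)`: the `𝔽₂` vector space generated by the intersection points. -/
abbrev Cplx : Type := IntPt L₀ L₁ →₀ ZMod 2

variable (L₀ L₁) in
/-- The differential `∂ x = ∑_y #M(x, y) y`. -/
def bdry : Cplx L₀ L₁ →ₗ[ZMod 2] Cplx L₀ L₁ :=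
  Finsupp.linearCombination (ZMod 2) fun x =>
    ∑ᶠ y : IntPt L₀ L₁, Finsupp.single y (Nat.card (Moduli L₀ L₁ x y) : ZMod 2)

variable (L₀ L₁) in
/-- The cycles of `(C(L₀, L₁), ∂)`. -/
def Cyc : Submodule (ZMod 2) (Cplx L₀ L₁) := LinearMap.ker (bdry L₀ L₁)

variable (L₀ L₁) in
/-- The boundaries, as a subspace of the space of cycles. -/
def Bnd : Submodule (ZMod 2) (Cyc L₀ L₁) :=
  (LinearMap.range (bdry L₀ L₁)).comap (Cyc L₀ L₁).subtype

variable (L₀ L₁) in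
/-- The homology of `(C(L₀, L₁), ∂)`: cycles modulo boundaries. -/
abbrev HF : Type := Cyc L₀ L₁ ⧸ Bnd L₀ L₁

/-- The homology class of a cycle. -/
def homologyClass : Cyc L₀ L₁ →ₗ[ZMod 2] HF L₀ L₁ := Submodule.mkQ _

/-- The part of `C(L₀, L₁)` of degree `i`, for a `ℤ/4` valued degree of the generators. -/
def degPart (deg : IntPt L₀ L₁ → ZMod 4) (i : ZMod 4) : Submodule (ZMod 2) (Cplx L₀ L₁) :=
  Finsupp.supported (ZMod 2) (ZMod 2) {x | deg x = i}

/-- The part of the homology of degree `i`: the classes of the cycles of degree `i`. -/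
def degPartHF (deg : IntPt L₀ L₁ → ZMod 4) (i : ZMod 4) : Submodule (ZMod 2) (HF L₀ L₁) :=
  ((degPart deg i).submoduleOf (Cyc L₀ L₁)).map homologyClass

/-- The absolute grading which extends the relative grading and places `r` in degree `s`.  As the
differential lowers the degree by one, `gr(x, y)` is the degree of `x` minus that of `y`. -/
def absGr [PathConnectedSpace R₀] [PathConnectedSpace R₁] (zt : C(PStar, Circle))
    (r : IntPt L₀ L₁) (s : ℤ) (x : IntPt L₀ L₁) : ZMod 4 :=
  (s : ZMod 4) + gr zt x r

end Maslov

/-! ## The circle `L₀^{ε,0}` -/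

/-- The lift `t ↦ (t + ε sin t + π/2, t - ε sin t + π/2)` of `L₀^{ε,0}` to the plane. -/
def zeroLift (ε t : ℝ) : ℂ :=
  ((t + ε * Real.sin t + Real.pi / 2 : ℝ) : ℂ)
    + ((t - ε * Real.sin t + Real.pi / 2 : ℝ) : ℂ) * Complex.I

/-- The velocity `(1 + ε cos t, 1 - ε cos t)` of `zeroLift`. -/
def zeroVel (ε t : ℝ) : ℂ :=
  ((1 + ε * Real.cos t : ℝ) : ℂ) + ((1 - ε * Real.cos t : ℝ) : ℂ) * Complex.I

theorem hasDerivAt_zeroLift (ε t : ℝ) : HasDerivAt (zeroLift ε) (zeroVel ε t) t := by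
  have h1 : HasDerivAt (fun t => t + ε * Real.sin t + Real.pi / 2) (1 + ε * Real.cos t) t :=
    ((hasDerivAt_id t).add ((Real.hasDerivAt_sin t).const_mul ε)).add_const _
  have h2 : HasDerivAt (fun t => t - ε * Real.sin t + Real.pi / 2) (1 - ε * Real.cos t) t :=
    ((hasDerivAt_id t).sub ((Real.hasDerivAt_sin t).const_mul ε)).add_const _
  exact h1.ofReal_comp.add (h2.ofReal_comp.mul_const Complex.I)

theorem zeroVel_ne_zero (ε t : ℝ) : zeroVel ε t ≠ 0 := by
  intro h
  have h1 := congrArg Complex.re h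
  have h2 := congrArg Complex.im h
  simp [zeroVel, -Complex.ofReal_add, -Complex.ofReal_sub, -Complex.ofReal_mul] at h1 h2
  linarith

theorem zeroLift_not_mem {ε : ℝ} (hε : ε ∈ Ioo (0 : ℝ) 1) (t : ℝ) : zeroLift ε t ∉ Lattice := by
  rintro ⟨m, n, h⟩
  have h1 := congrArg Complex.re h
  have h2 := congrArg Complex.im h
  simp only [zeroLift, latticePt, Complex.add_re, Complex.add_im, Complex.mul_re, Complex.mul_im,
    Complex.ofReal_re, Complex.ofReal_im, Complex.I_re, Complex.I_im, mul_zero, mul_one,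
    add_zero, zero_add, sub_zero] at h1 h2
  have hp := Real.pi_gt_three
  have hs1 := Real.sin_le_one t
  have hs2 := Real.neg_one_le_sin t
  have hd : Real.pi * ((m - n : ℤ) : ℝ) = 2 * ε * Real.sin t := by push_cast; linarith
  have hb : |ε * Real.sin t| < 1 := by
    rw [abs_mul, abs_of_pos hε.1]
    nlinarith [abs_le.2 ⟨hs2, hs1⟩, abs_nonneg (Real.sin t), hε.1, hε.2]
  have hmn : m - n = 0 := by
    rw [abs_lt] at hb
    have a1 : ((m - n : ℤ) : ℝ) < 1 := by nlinarith
    have a2 : (-1 : ℝ) < ((m - n : ℤ) : ℝ) := by nlinarith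
    have a1' : m - n < 1 := by exact_mod_cast a1
    have a2' : -1 < m - n := by exact_mod_cast a2
    omega
  have hs : Real.sin t = 0 := by
    rw [hmn] at hd
    have h0 : ε * Real.sin t = 0 := by push_cast at hd; linarith
    exact (mul_eq_zero.1 h0).resolve_left hε.1.ne'
  obtain ⟨k, hk⟩ := Real.sin_eq_zero_iff.1 hs
  rw [hs] at h1
  have h3 : Real.pi * ((2 * k + 1 - 2 * m : ℤ) : ℝ) = 0 := by push_cast; linarith
  have h4 : ((2 * k + 1 - 2 * m : ℤ) : ℝ) = 0 :=
    (mul_eq_zero.1 h3).resolve_left Real.pi_pos.ne'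
  have h5 : 2 * k + 1 - 2 * m = 0 := by exact_mod_cast h4
  omega

theorem continuous_zeroLift (ε : ℝ) : Continuous (zeroLift ε) := by
  unfold zeroLift; fun_prop

theorem continuous_zeroVel (ε : ℝ) : Continuous (zeroVel ε) := by
  unfold zeroVel; fun_prop

/-- The circle `ℝ / 2πℤ`. -/
abbrev Circ : Type := Real.Angle

/-- The immersed circle `L₀^{ε,0}` with its tangent line field, for `0 < ε < 1`. -/
def zeroCurve (ε : ℝ) (hε : ε ∈ Ioo (0 : ℝ) 1) : TangentCurve Circ where
  map :=
    { toFun := Function.Periodic.lift (c := 2 * Real.pi)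
        (f := fun t => (⟨toP (zeroLift ε t), not_isCorner_toP (zeroLift_not_mem hε t)⟩ : PStar))
        (fun t => by
          apply Subtype.ext
          refine Quotient.sound (s := pillowSetoid) (?_ : PillowRel _ _)
          refine ⟨-1, -1, Or.inl ?_⟩
          simp only [zeroLift, latticePt, Real.sin_add_two_pi]
          push_cast; ring)
      continuous_toFun := by
        refine Continuous.quotient_lift ?_ _
        exact Continuous.subtype_mk (continuous_toP.comp (continuous_zeroLift ε)) _ }
  line :=
    { toFun := Function.Periodic.lift (c := 2 * Real.pi)
        (f := fun t => lineDir ⟨zeroVel ε t, zeroVel_ne_zero ε t⟩)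
        (fun t => by simp only [zeroVel, Real.cos_add_two_pi])
      continuous_toFun := by
        refine Continuous.quotient_lift ?_ _
        exact continuous_lineDir.comp (Continuous.subtype_mk (continuous_zeroVel ε) _) }

instance : PathConnectedSpace Circ :=
  (show Function.Surjective ((↑) : ℝ → Real.Angle) from
    fun θ => θ.induction_on fun x => ⟨x, rfl⟩).pathConnectedSpace Real.Angle.continuous_coe

/-! ## Proper arcs and restricted immersed arcs -/

/-- A proper immersion of the interval `[0, π]` in `P`, given by its lift to the plane. -/
structure ProperArc where
  lift : ℝ → ℂ
  smooth : ContDiff ℝ ∞ lift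
  immersed : ∀ t ∈ Icc (0 : ℝ) Real.pi, deriv lift t ≠ 0
  left : lift 0 ∈ Lattice
  right : lift Real.pi ∈ Lattice
  interior : ∀ t ∈ Ioo (0 : ℝ) Real.pi, lift t ∉ Lattice

/-- The part of a proper arc in `P*`: its restriction to the open interval. -/
def ProperArc.curve (A : ProperArc) : TangentCurve (Ioo (0 : ℝ) Real.pi) where
  map :=
    { toFun := fun t => ⟨toP (A.lift t), not_isCorner_toP (A.interior t t.2)⟩
      continuous_toFun := Continuous.subtype_mk
        (continuous_toP.comp (A.smooth.continuous.comp continuous_subtype_val)) _ }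
  line :=
    { toFun := fun t => lineDir ⟨deriv A.lift t, A.immersed t (Ioo_subset_Icc_self t.2)⟩
      continuous_toFun := continuous_lineDir.comp (Continuous.subtype_mk
        ((A.smooth.continuous_deriv (by simp)).comp continuous_subtype_val) _) }

instance : PathConnectedSpace (Ioo (0 : ℝ) Real.pi) :=
  isPathConnected_iff_pathConnectedSpace.1
    ((convex_Ioo 0 Real.pi).isPathConnected (nonempty_Ioo.2 Real.pi_pos))

/-- The image in `P` of the plane without the open `δ`-discs around the lattice points. -/
def PBar (δ : ℝ) : Set Pillowcase := {x | ∃ z, toP z = x ∧ ∀ c ∈ Lattice, δ ≤ ‖z - c‖}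

/-- A proper arc is a restricted immersed arc if, for all small `δ > 0`, its part in the compact
surface `PBar δ` is an unobstructed immersed arc: an arc with distinct endpoints on the boundary
circles, transverse there to the boundary, whose lifts to the universal cover are embedded. -/
def ProperArc.IsRestricted (A : ProperArc) : Prop :=
  ∀ᶠ δ : ℝ in 𝓝[>] 0, ∃ a b : ℝ, 0 < a ∧ a < b ∧ b < Real.pi ∧
    (∀ t ∈ Icc (0 : ℝ) Real.pi, toP (A.lift t) ∈ PBar δ ↔ t ∈ Icc a b) ∧
    toP (A.lift a) ≠ toP (A.lift b) ∧
    (∀ t ∈ ({a, b} : Set ℝ), ∃ c ∈ Lattice, ‖A.lift t - c‖ = δ ∧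
      inner ℝ (deriv A.lift t) (A.lift t - c) ≠ 0) ∧
    ∀ (E : Type) [TopologicalSpace E] [SimplyConnectedSpace E] (cov : E → PBar δ),
      IsCoveringMap cov → ∀ f : C(Icc a b, E),
        (∀ t, (cov (f t) : Pillowcase) = toP (A.lift t)) → IsEmbedding f

/-! ## Traceless character varieties -/

/-- `SU(2)` as the group of unit quaternions. -/
abbrev SU2 : Type := unitary ℍ[ℝ]

section CharVar

variable {G ι : Type} [Group G]

/-- Representations of `G` in `SU(2)` sending all the given meridians to traceless elements
(equivalently, to the conjugacy class of `i`), with the topology of pointwise convergence. -/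
def TracelessRep (μ : ι → G) : Type := {ρ : G →* SU2 // ∀ j, ((ρ (μ j) : SU2) : ℍ[ℝ]).re = 0}

instance (μ : ι → G) : TopologicalSpace (TracelessRep μ) :=
  TopologicalSpace.induced (fun ρ (g : G) => ρ.1 g) inferInstance

/-- Conjugacy of representations. -/
def repSetoid (μ : ι → G) : Setoid (TracelessRep μ) where
  r ρ ρ' := ∃ s : SU2, ∀ g, ρ'.1 g = s * ρ.1 g * s⁻¹
  iseqv :=
    { refl := fun ρ => ⟨1, fun g => by simp⟩
      symm := by
        rintro ρ ρ' ⟨s, hs⟩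
        exact ⟨s⁻¹, fun g => by rw [hs]; group⟩
      trans := by
        rintro ρ ρ' ρ'' ⟨s, hs⟩ ⟨t, ht⟩
        exact ⟨t * s, fun g => by rw [ht, hs]; group⟩ }

/-- The traceless character variety, with the quotient topology. -/
abbrev CharVar (μ : ι → G) : Type := Quotient (repSetoid μ)

end CharVar

/-! ## Rational tangles and two-bridge knots

The plane of projection is cut by a horizontal line.  Below it lies the tangle `(Y, T)`: two cups,
joining the positions `0, 1` and `2, 3`, followed (going upwards) by a braid on the four strands
in positions `0, 1, 2, 3`.  Above the line lies the trivial tangle `(D, U)`: two nested caps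
joining the positions `1, 2` and `0, 3`.  The four endpoints on the line, from left to right, are
`a, b, c, d`.  Together the two tangles form a diagram of a link in `S³`. -/

/-- A crossing is either between the strands in positions `0, 1` or between those in positions
`1, 2`. -/
inductive Site
  | left
  | middle
  deriving DecidableEq

/-- A crossing.  `overRight = true` means that, going upwards, the overcrossing strand moves to
the right; otherwise the overcrossing strand moves to the left. -/
structure Crossing where
  site : Site
  overRight : Bool

/-- The two positions of the strands which cross. -/
def Crossing.lo (c : Crossing) : Fin 4 := if c.site = .left then 0 else 1
def Crossing.hi (c : Crossing) : Fin 4 := if c.site = .left then 1 else 2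

/-- The Wirtinger relations at a crossing: from the meridians `x` of the four upward directed
strands just below the crossing to those just above it.  The meridian of the overcrossing strand
does not change, that of the other one is conjugated by it. -/
def Crossing.wirtinger {G : Type} [Group G] (c : Crossing) (x : Fin 4 → G) : Fin 4 → G :=
  if c.overRight then
    Function.update (Function.update x c.lo (x c.lo * x c.hi * (x c.lo)⁻¹)) c.hi (x c.lo)
  else
    Function.update (Function.update x c.lo (x c.hi)) c.hi ((x c.hi)⁻¹ * x c.lo * x c.hi)

/-- The Wirtinger relations of the tangle `T` with braid `w` (read upwards).  The generator
`(k, j)` is the meridian of the strand in position `j` at height `k`, directed upwards. -/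
def tangleRels (w : List Crossing) : Set (FreeGroup (Fin (w.length + 1) × Fin 4)) :=
  {FreeGroup.of (0, 0) * FreeGroup.of (0, 1), FreeGroup.of (0, 2) * FreeGroup.of (0, 3)} ∪
  {r | ∃ (k : Fin w.length) (j : Fin 4), r = FreeGroup.of (k.succ, j) *
    ((w.get k).wirtinger (fun i => FreeGroup.of (k.castSucc, i)) j)⁻¹}

/-- The fundamental group of `Y ∖ T`. -/
abbrev TangleGroup (w : List Crossing) : Type := PresentedGroup (tangleRels w)

/-- The meridians of `T`. -/
def tangleMer (w : List Crossing) (kj : Fin (w.length + 1) × Fin 4) : TangleGroup w :=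
  PresentedGroup.of kj

/-- The fundamental group of the sphere minus the four points `a, b, c, d`, generated by the
meridians of the four upward directed strands. -/
abbrev SphereGroup : Type :=
  PresentedGroup ({FreeGroup.of 0 * FreeGroup.of 1 * FreeGroup.of 2 * FreeGroup.of 3} :
    Set (FreeGroup (Fin 4)))

def sphereMer (j : Fin 4) : SphereGroup := PresentedGroup.of j

/-- `R(Y, T)`. -/
abbrev RTangle (w : List Crossing) : Type := CharVar (tangleMer w)

/-- `R(S², {a, b, c, d})`. -/
abbrev RSphere : Type := CharVar sphereMer

theorem Crossing.wirtinger_prod {G : Type} [Group G] (c : Crossing) (x : Fin 4 → G) :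
    c.wirtinger x 0 * c.wirtinger x 1 * c.wirtinger x 2 * c.wirtinger x 3
      = x 0 * x 1 * x 2 * x 3 := by
  obtain ⟨s, b⟩ := c
  cases s <;> cases b <;>
    simp [Crossing.wirtinger, Crossing.lo, Crossing.hi, Function.update, mul_assoc]

theorem Crossing.wirtinger_map {G H : Type} [Group G] [Group H] (f : G →* H) (c : Crossing)
    (x : Fin 4 → G) (j : Fin 4) : f (c.wirtinger x j) = c.wirtinger (fun i => f (x i)) j := by
  obtain ⟨s, b⟩ := c
  cases s <;> cases b <;> fin_cases j <;>
    simp [Crossing.wirtinger, Crossing.lo, Crossing.hi, Function.update]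

theorem tangleMer_succ (w : List Crossing) (k : Fin w.length) (j : Fin 4) :
    tangleMer w (k.succ, j)
      = (w.get k).wirtinger (fun i => tangleMer w (k.castSucc, i)) j := by
  have h : PresentedGroup.mk (tangleRels w) (FreeGroup.of (k.succ, j) *
      ((w.get k).wirtinger (fun i => FreeGroup.of (k.castSucc, i)) j)⁻¹) = 1 :=
    PresentedGroup.one_of_mem (Or.inr ⟨k, j, rfl⟩)
  rw [map_mul, map_inv, Crossing.wirtinger_map, mul_inv_eq_one] at h
  exact h

theorem tangleMer_prod (w : List Crossing) (k : Fin (w.length + 1)) :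
    tangleMer w (k, 0) * tangleMer w (k, 1) * tangleMer w (k, 2) * tangleMer w (k, 3) = 1 := by
  induction k using Fin.induction with
  | zero =>
    have h1 : PresentedGroup.mk (tangleRels w) (FreeGroup.of (0, 0) * FreeGroup.of (0, 1)) = 1 :=
      PresentedGroup.one_of_mem (Or.inl (Or.inl rfl))
    have h2 : PresentedGroup.mk (tangleRels w) (FreeGroup.of (0, 2) * FreeGroup.of (0, 3)) = 1 :=
      PresentedGroup.one_of_mem (Or.inl (Or.inr rfl))
    rw [map_mul] at h1 h2
    change PresentedGroup.mk _ _ * PresentedGroup.mk _ _ * PresentedGroup.mk _ _ *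
      PresentedGroup.mk _ _ = 1
    rw [h1, one_mul, h2]
  | succ k ih =>
    simp only [tangleMer_succ]
    rw [Crossing.wirtinger_prod]
    exact ih

/-- The map `π₁(S² ∖ {a, b, c, d}) → π₁(Y ∖ T)` induced by the inclusion. -/
def boundaryHom (w : List Crossing) : SphereGroup →* TangleGroup w :=
  PresentedGroup.toGroup (f := fun j => tangleMer w (Fin.last _, j)) (by
    rintro r rfl
    simpa using tangleMer_prod w (Fin.last _))

/-- The restriction map `R(Y, T) → R(S², {a, b, c, d})`. -/
def restrictToSphere (w : List Crossing) : RTangle w → RSphere :=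
  Quotient.map' (s₁ := repSetoid (tangleMer w)) (s₂ := repSetoid sphereMer)
    (fun ρ => ⟨ρ.1.comp (boundaryHom w), fun j => by
      have h := ρ.2 (Fin.last _, j)
      rwa [MonoidHom.comp_apply, sphereMer, boundaryHom, PresentedGroup.toGroup.of]⟩)
    (by
      rintro ρ ρ' ⟨s, hs⟩
      exact ⟨s, fun g => hs _⟩)

/-- An orientation of the link formed by `T` and `U`: `sign k j` is `1` if the strand in position
`j` at height `k` is directed upwards and `-1` if it is directed downwards. -/
structure LinkOrientation (w : List Crossing) where
  sign : Fin (w.length + 1) → Fin 4 → ℤˣ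
  cup₀ : sign 0 0 = -sign 0 1
  cup₁ : sign 0 2 = -sign 0 3
  cross : ∀ (k : Fin w.length) (j : Fin 4),
    sign k.succ j = sign k.castSucc (Equiv.swap (w.get k).lo (w.get k).hi j)
  cap₀ : sign (Fin.last _) 0 = -sign (Fin.last _) 3
  cap₁ : sign (Fin.last _) 1 = -sign (Fin.last _) 2

/-- The quaternion `e^{αk} i = cos α i + sin α j`. -/
def rotQ (α : ℝ) : ℍ[ℝ] := ⟨0, Real.cos α, Real.sin α, 0⟩

@[simp] theorem rotQ_re (α : ℝ) : (rotQ α).re = 0 := rfl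
@[simp] theorem rotQ_imI (α : ℝ) : (rotQ α).imI = Real.cos α := rfl
@[simp] theorem rotQ_imJ (α : ℝ) : (rotQ α).imJ = Real.sin α := rfl
@[simp] theorem rotQ_imK (α : ℝ) : (rotQ α).imK = 0 := rfl

theorem rotQ_mem (α : ℝ) : rotQ α ∈ unitary ℍ[ℝ] := by
  refine Unitary.mem_iff.2 ⟨?_, ?_⟩ <;> ext <;> simp <;>
    nlinarith [Real.sin_sq_add_cos_sq α]

def rot (α : ℝ) : SU2 := ⟨rotQ α, rotQ_mem α⟩

/-- The angles of the images of `a, b, c, d` in the representation with coordinates `(γ, θ)`. -/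
def psiAngle (z : ℂ) : Fin 4 → ℝ := ![0, z.re, z.im, z.im - z.re]

theorem rot_inv (α : ℝ) : (rot α)⁻¹ = -rot α := by
  apply Subtype.ext
  rw [← Unitary.star_eq_inv]
  change star (rotQ α) = -rotQ α
  ext <;> simp

theorem rot_zpow_re (α : ℝ) (e : ℤˣ) : ((rot α ^ (e : ℤ) : SU2) : ℍ[ℝ]).re = 0 := by
  rcases Int.units_eq_one_or e with rfl | rfl
  · rw [Units.val_one, zpow_one]
    exact rotQ_re α
  · simp only [Units.val_neg, Units.val_one, zpow_neg, zpow_one, rot_inv]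
    change (-rotQ α).re = 0
    simp

theorem rot_prod (γ θ : ℝ) : rot 0 * rot γ * rot θ * rot (θ - γ) = 1 := by
  apply Subtype.ext
  change rotQ 0 * rotQ γ * rotQ θ * rotQ (θ - γ) = 1
  have h := Real.sin_sq_add_cos_sq γ
  have h' := Real.sin_sq_add_cos_sq θ
  ext <;> simp [Real.cos_sub, Real.sin_sub]
  · linear_combination (Real.sin θ ^ 2 + Real.cos θ ^ 2) * h + h'
  · ring

theorem psi_rel {w : List Crossing} (o : LinkOrientation w) (z : ℂ) :
    rot (psiAngle z 0) ^ (o.sign (Fin.last _) 0 : ℤ) *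
      rot (psiAngle z 1) ^ (o.sign (Fin.last _) 1 : ℤ) *
      rot (psiAngle z 2) ^ (o.sign (Fin.last _) 2 : ℤ) *
      rot (psiAngle z 3) ^ (o.sign (Fin.last _) 3 : ℤ) = 1 := by
  have h := rot_prod z.re z.im
  rw [o.cap₀, o.cap₁]
  rcases Int.units_eq_one_or (o.sign (Fin.last _) 3) with h3 | h3 <;>
  rcases Int.units_eq_one_or (o.sign (Fin.last _) 2) with h2 | h2 <;>
  · rw [h3, h2]
    simpa [psiAngle, rot_inv] using h

/-- The map `ψ : ℝ² → R(S², {a, b, c, d})` which induces the identification of the pillowcase with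
`R(S², {a, b, c, d})`: the meridians `a, b, c, d`, oriented by the given orientation of the link,
are sent to `i`, `e^{γk} i`, `e^{θk} i`, `e^{(θ-γ)k} i`. -/
def psi {w : List Crossing} (o : LinkOrientation w) (z : ℂ) : RSphere :=
  Quotient.mk (repSetoid sphereMer)
    ⟨PresentedGroup.toGroup
      (f := fun j => rot (psiAngle z j) ^ (o.sign (Fin.last _) j : ℤ)) (by
        rintro r rfl
        simpa using psi_rel o z),
      fun j => by
        rw [sphereMer, PresentedGroup.toGroup.of]
        exact rot_zpow_re _ _⟩

/-- `n` crossings at the given site, with the overcrossing strand moving to the right if `n > 0`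
and to the left if `n < 0`. -/
def twists (s : Site) (n : ℤ) : List Crossing := List.replicate n.natAbs ⟨s, decide (0 < n)⟩

/-- The braid (read upwards) of the rational tangle of `[(a₁, b₁), …, (aₖ, bₖ)]`: it is built from
twist regions with `bₖ, aₖ, …, b₁, a₁` crossings, alternately at the middle and at the left site. -/
def tangleWord : List (ℤ × ℤ) → List Crossing
  | [] => []
  | (a, b) :: l => tangleWord l ++ twists .middle b ++ twists .left (-a)

/-- Numerator and denominator of the continued fraction
`a₁ + 1 / (b₁ + 1 / (a₂ + 1 / (b₂ + ⋯ + 1 / bₖ)))`, with value `1 / 0` for the empty list. -/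
def contFrac : List (ℤ × ℤ) → ℤ × ℤ
  | [] => (1, 0)
  | (a, b) :: l =>
    ((contFrac l).1 + a * ((contFrac l).2 + b * (contFrac l).1),
      (contFrac l).2 + b * (contFrac l).1)

/-- The list is a continued fraction expansion of `p / q` (for coprime `p` and `q`), so that the
link formed by the tangle with braid `tangleWord l` and the trivial tangle `U` is the two-bridge
link `K(p, q)`, in Conway's normal form. -/
def IsExpansion (l : List (ℤ × ℤ)) (p q : ℤ) : Prop :=
  contFrac l = (p, q) ∨ contFrac l = (-p, -q)

/-! ### The signature

The signature of the knot is computed from its diagram by the theorem of Gordon and Litherland: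
`σ(K) = sign(G) - μ`, with `G` the Goeritz form of the checkerboard surface and `μ` the correction
term, the sum of the incidence numbers of the crossings of type II, at which the surface is not
compatible with the orientation of `K`.  If there are none then the surface is a Seifert surface
and `G` is the symmetrised Seifert form.

The surface covers the regions between the strands in positions `0, 1` and those between the
strands in positions `2, 3`.  The other regions are the outer one and the pieces of the strip
between positions `1` and `2`, which the crossings at the middle site cut into pieces; the lowest
piece belongs to the outer region.  -/

/-- The number of crossings of `w` at the middle site. -/
def numMiddle (w : List Crossing) : ℕ := w.countP fun c => c.site = .middle

/-- The coordinate of the `g`-th piece of the strip (from below); the coordinate of the outer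
region, `g = 0`, is zero. -/
def regionCoord (N g : ℕ) : (Fin N → ℝ) →ₗ[ℝ] ℝ :=
  if h : 0 < g ∧ g ≤ N then LinearMap.proj ⟨g - 1, by omega⟩ else 0

/-- The incidence number of a crossing. -/
def Crossing.incidence (c : Crossing) : ℤ :=
  (if c.site = .left then 1 else -1) * (if c.overRight then 1 else -1)

/-- The difference of the coordinates of the two regions outside the surface which meet at the
`k`-th crossing. -/
def regionDiff (w : List Crossing) (k : Fin w.length) : (Fin (numMiddle w) → ℝ) →ₗ[ℝ] ℝ :=
  if (w.get k).site = .left then regionCoord _ (numMiddle (w.take k))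
  else regionCoord _ (numMiddle (w.take k) + 1) - regionCoord _ (numMiddle (w.take k))

/-- The Goeritz form. -/
def goeritz (w : List Crossing) : QuadraticForm ℝ (Fin (numMiddle w) → ℝ) :=
  ∑ k : Fin w.length, ((w.get k).incidence : ℝ) • QuadraticMap.sq.comp (regionDiff w k)

/-- A crossing is of type II if its strands run in the same direction along the band of the
surface at the crossing, which is vertical at a left and horizontal at a middle crossing. -/
def LinkOrientation.TypeII {w : List Crossing} (o : LinkOrientation w) (k : Fin w.length) : Prop :=
  ((w.get k).site = .left ↔
    o.sign k.castSucc (w.get k).lo = o.sign k.castSucc (w.get k).hi)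

open Classical in
/-- The signature of the knot with the given diagram and orientation. -/
def signature {w : List Crossing} (o : LinkOrientation w) : ℤ :=
  (sigPos (goeritz w) : ℤ) - (sigNeg (goeritz w) : ℤ)
    - ∑ k : Fin w.length, if o.TypeII k then (w.get k).incidence else 0

/-! ## Families of intersection points -/

/-- The curve `L₀^{ε,0}` for `0 < ε < ε₀`, where `ε₀ ≤ 1`. -/
abbrev L₀ {ε₀ : ℝ} (hε₀ : ε₀ ≤ 1) (ε : Ioo (0 : ℝ) ε₀) : TangentCurve Circ :=
  zeroCurve ε ⟨ε.2.1, ε.2.2.trans_le hε₀⟩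

/-- The intersection points `x ε` of `L₀^{ε,0}` with an arc form a continuous family, which
converges for `ε → 0` to the point of the arc with parameter `s`. -/
def IsBranch {ε₀ : ℝ} (hε₀ : ε₀ ≤ 1) (A : ProperArc)
    (x : ∀ ε : Ioo (0 : ℝ) ε₀, IntPt (L₀ hε₀ ε) A.curve) (s : ℝ) : Prop :=
  Continuous (fun ε => (x ε).1) ∧
    Tendsto (fun ε => ((x ε).1.2 : ℝ)) (comap Subtype.val (𝓝 0)) (𝓝 s)

end

end TwoBridge

open TwoBridge

/-!
# The instanton chain complex of a two-bridge knot

Everything rests on the fact that the tangent lines of both curves hardly turn relative to the line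
field of slope one. The tangent direction of `L₀` is `(1 - ε cos t · i)(1 + i)` up to a real factor, close to slope
one for small `ε`, while `L₁` is the image of a line segment, of constant slope different from one.
All degrees along paths and all `τ`-corrections can therefore be read off, and the Maslov index with
respect to the line field of slope one vanishes for all pairs of intersection points and all paths
(`exists_transverse_mas_eq_zero`). A bigon has Maslov index one, so there are none, the differential
is zero, and the complex is its own homology (`isEmpty_moduli`, `exists_equiv_homology`).

The grading is then entirely due to the twist by the map `P* → S¹`: the relative grading of two
points is the value of `z` on a loop through them (`gr_eq_zEval`). It does not depend on the loop
since `L₁` is contractible and `L₀` is a figure eight around two corners with opposite orientations,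
on which `z` vanishes (`mas_instField_eq_gr`). For `x_ℓ⁺` and `x_ℓ⁻` the loop encircles one corner
counterclockwise, so the grading difference is one (`gr_eq_one`, `gr_point_neg`). Values of circle
maps on loops are computed by pulling back along lifts to star-convex regions of the plane which
avoid the lattice, where logarithms exist (`LiftsZ.exists_log`). A map `P* → S¹` of the required
kind is built in `stdZ` from the square of an odd doubly periodic function which vanishes exactly at
the lattice points, with indices congruent to one mod 4.

The intersection points are counted by lifting to the plane: the points of `L₀ ∩ L₁` correspond to
the integers `k` with `2|k| ≤ p - 1`, the point of index `k` being given by the unique zero near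
`-2πk/p` of a function which, for small `ε`, is strictly monotone (`rootFun`, `exists_eq_point`).
The sign of the cosine of the parameter on `L₀`, which decides whether the slope of `L₀` is less or
greater than one, is that of `-sin(2πkq/p)`; so one of the indices `±ℓ` gives `x_ℓ⁺` and the other
gives `x_ℓ⁻`.

For the character variety of the tangle, a traceless representation is, up to conjugation, one that
sends the two cups to `i` and `e^{tk} i` for a unique `t ∈ [0, π]` (`cupHomeo`). Half-twists act on
the angles of such a representation by affine integral maps, which multiply up to the continued
fraction expansion, whence the slope of `L₁` (`restrictToSphere_tangleWord`). That the restriction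
is injective comes down to `p` and `q` being coprime (`toP_mul_arcDir_injOn`).
-/

namespace TwoBridge

noncomputable section

/-! ### Total variation of a path in the circle -/

/-- A continuous integer valued function on a preconnected set is constant. -/
theorem eq_of_forall_int {X : Type*} [TopologicalSpace X] {S : Set X} (hS : IsPreconnected S)
    {f : X → ℝ} (hf : ContinuousOn f S) (hint : ∀ x ∈ S, ∃ n : ℤ, f x = n) {x y : X}
    (hx : x ∈ S) (hy : y ∈ S) : f x = f y := by
  have hd : IsDiscrete (range ((↑) : ℤ → ℝ)) := by
    have h : DiscreteTopology (range ((↑) : ℤ → ℝ)) :=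
      (Int.isClosedEmbedding_coe_real.isEmbedding.toHomeomorph.symm.isEmbedding).discreteTopology
    exact isDiscrete_iff_discreteTopology.2 h
  exact hS.constant_of_mapsTo hd hf
    (fun z hz => by obtain ⟨n, hn⟩ := hint z hz; exact ⟨n, hn.symm⟩) hx hy

theorem exp_two_pi_eq_iff {x y : ℝ} :
    Circle.exp (2 * Real.pi * x) = Circle.exp (2 * Real.pi * y) ↔ ∃ n : ℤ, x - y = n := by
  have hp := Real.pi_pos
  rw [← div_eq_one, ← Circle.exp_sub, Circle.exp_eq_one]
  refine exists_congr fun n => ⟨fun h => ?_, fun h => ?_⟩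
  · have : (x - y) * (2 * Real.pi) = n * (2 * Real.pi) := by linarith
    exact mul_right_cancel₀ (by positivity) this
  · rw [← h]; ring

/-- The argument of a point of the circle, in full turns. -/
def turnArg (z : Circle) : ℝ := Complex.arg z / (2 * Real.pi)

theorem exp_turnArg (z : Circle) : Circle.exp (2 * Real.pi * turnArg z) = z := by
  have hp := Real.pi_pos
  rw [turnArg, mul_div_cancel₀ _ (by positivity), Circle.exp_arg]

/-- The total variation of the argument along a path in the circle, in full turns. -/
def turns (α : C(I, Circle)) : ℝ :=
  (exists_circle_lift α).choose 1 - (exists_circle_lift α).choose 0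

theorem turns_eq {α : C(I, Circle)} {g : I → ℝ} (hg : Continuous g)
    (h : ∀ t, Circle.exp (2 * Real.pi * g t) = α t) : turns α = g 1 - g 0 := by
  have hf := (exists_circle_lift α).choose_spec
  set f := (exists_circle_lift α).choose
  have key : f 1 - g 1 = f 0 - g 0 := by
    refine eq_of_forall_int (f := fun t => f t - g t) isPreconnected_univ
      (by fun_prop) (fun t _ => ?_) (mem_univ _) (mem_univ _)
    exact exp_two_pi_eq_iff.1 ((hf t).trans (h t).symm)
  change f 1 - f 0 = _
  linarith

theorem turns_mul (α β : C(I, Circle)) : turns (α * β) = turns α + turns β := by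
  obtain ⟨f, hf⟩ := exists_circle_lift α
  obtain ⟨g, hg⟩ := exists_circle_lift β
  rw [turns_eq f.continuous hf, turns_eq g.continuous hg,
    turns_eq (g := fun t => f t + g t) (by fun_prop) (fun t => by
      rw [mul_add, Circle.exp_add, hf, hg, ContinuousMap.mul_apply])]
  ring

/-- The distance from a real number with image `z` in the circle to the next integer. -/
def ceilDefect (z : Circle) : ℝ := ⌈turnArg z⌉ - turnArg z

theorem ceil_sub_eq_ceilDefect {x : ℝ} {z : Circle} (h : Circle.exp (2 * Real.pi * x) = z) :
    (⌈x⌉ : ℝ) - x = ceilDefect z := by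
  obtain ⟨n, hn⟩ := exp_two_pi_eq_iff.1 (h.trans (exp_turnArg z).symm)
  rw [ceilDefect, show x = turnArg z + n by linarith, Int.ceil_add_intCast]
  push_cast; ring

/-- The degree and the total variation differ by terms which only depend on the endpoints, hence
cancel when degrees are added up along a closed chain of paths. -/
theorem degree_eq_turns (α : C(I, Circle)) :
    (degree α : ℝ) = turns α + ceilDefect (α 1) - ceilDefect (α 0) := by
  have hf := (exists_circle_lift α).choose_spec
  rw [← ceil_sub_eq_ceilDefect (hf 1), ← ceil_sub_eq_ceilDefect (hf 0), degree, turns]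
  push_cast
  ring

theorem degree_eq_turns_of_loop {α : C(I, Circle)} (h : α 0 = α 1) : (degree α : ℝ) = turns α := by
  rw [degree_eq_turns, h]; ring

section Curves

variable {R R₀ R₁ : Type} [TopologicalSpace R] [TopologicalSpace R₀] [TopologicalSpace R₁]

/-- The total variation of `ζ` along the image of the path `γ` under the curve `L`. -/
def turnsAlong (ζ : C(PStar, Circle)) (L : TangentCurve R) {a b : R} (γ : Path a b) : ℝ :=
  turns ⟨fun t => ζ (L.map (γ t)), by fun_prop⟩

theorem turnsAlong_symm (ζ : C(PStar, Circle)) (L : TangentCurve R) {a b : R} (γ : Path a b) :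
    turnsAlong ζ L γ.symm = -turnsAlong ζ L γ := by
  obtain ⟨f, hf⟩ := exists_circle_lift ⟨fun t => ζ (L.map (γ t)), by fun_prop⟩
  rw [turnsAlong, turnsAlong, turns_eq f.continuous hf,
    turns_eq (g := fun t => f (σ t)) (by fun_prop) (fun t => by rw [hf]; rfl)]
  simp

/-- Replacing a line field `ℓ` by `ζ⁻¹ ℓ` adds the variation of `ζ` to that of the tangent line. -/
theorem turns_line_div_inst (zt : C(PStar, Circle)) (L : TangentCurve R) {a b : R}
    (γ : Path a b) :
    turns ⟨fun t => L.line (γ t) / instField zt (L.map (γ t)), by fun_prop⟩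
      = turns ⟨fun t => L.line (γ t) / slopeOne (L.map (γ t)), by fun_prop⟩
        + turnsAlong zt L γ := by
  rw [turnsAlong, ← turns_mul]
  congr 1
  ext1 t
  simp only [instField, ContinuousMap.coe_mk, ContinuousMap.mul_apply, ContinuousMap.inv_apply]
  rw [div_mul_eq_div_div, div_inv_eq_mul, mul_comm, mul_div_assoc, mul_comm]

variable {L₀ : TangentCurve R₀} {L₁ : TangentCurve R₁}

theorem tau_eq (ℓ₀ ℓ₁ ℓ : Circle) :
    (tau ℓ₀ ℓ₁ ℓ : ℝ)
      = Int.fract (turnArg (ℓ₀ / ℓ₁)) - ceilDefect (ℓ₁ / ℓ) + ceilDefect (ℓ₀ / ℓ) := by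
  have h1 : ℓ₀ * Circle.exp (-(2 * Real.pi * Int.fract (turnArg (ℓ₀ / ℓ₁)))) = ℓ₁ := by
    have h2 : Circle.exp (2 * Real.pi * Int.fract (turnArg (ℓ₀ / ℓ₁))) = ℓ₀ / ℓ₁ := by
      rw [← exp_turnArg (ℓ₀ / ℓ₁), exp_two_pi_eq_iff, exp_turnArg]
      exact ⟨-⌊turnArg (ℓ₀ / ℓ₁)⌋, by rw [Int.fract]; push_cast; ring⟩
    rw [Circle.exp_neg, h2, inv_div, mul_div_cancel]
  have htau : tau ℓ₀ ℓ₁ ℓ = -degree ⟨fun t : I => ℓ₀ * Circle.exp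
      (-(2 * Real.pi * Int.fract (turnArg (ℓ₀ / ℓ₁)) * (t : ℝ))) / ℓ, by fun_prop⟩ := rfl
  rw [htau, Int.cast_neg, degree_eq_turns,
    turns_eq (g := fun t : I => turnArg (ℓ₀ / ℓ) - Int.fract (turnArg (ℓ₀ / ℓ₁)) * t)
      (by fun_prop) (fun t => by
        rw [mul_sub, Circle.exp_sub, exp_turnArg]
        change _ = ℓ₀ * Circle.exp (-(2 * Real.pi * Int.fract (turnArg (ℓ₀ / ℓ₁)) * (t : ℝ))) / ℓ
        rw [Circle.exp_neg, ← mul_assoc, ← div_eq_mul_inv, div_right_comm])]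
  simp only [ContinuousMap.coe_mk, Icc.coe_one, Icc.coe_zero, mul_one, mul_zero, neg_zero,
    Circle.exp_zero, h1]
  ring

/-- The Maslov index as one minus the total variation of the closed chain of lines formed by the
tangent lines of both curves and the two rotations at the intersection points. -/
theorem mas_eq_turns (ℓ : LineField) (x y : IntPt L₀ L₁)
    (γ₀ : Path y.1.1 x.1.1) (γ₁ : Path x.1.2 y.1.2) :
    (mas ℓ x y γ₀ γ₁ : ℝ) =
      1 - (turns ⟨fun t => L₀.line (γ₀ t) / ℓ (L₀.map (γ₀ t)), by fun_prop⟩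
        + turns ⟨fun t => L₁.line (γ₁ t) / ℓ (L₁.map (γ₁ t)), by fun_prop⟩
        + Int.fract (turnArg (L₀.line y.1.1 / L₁.line y.1.2))
        + Int.fract (turnArg (L₁.line x.1.2 / L₀.line x.1.1))) := by
  rw [mas, mu, mu]
  push_cast
  rw [degree_eq_turns, degree_eq_turns, tau_eq, tau_eq]
  simp only [ContinuousMap.coe_mk, Path.source, Path.target, x.2, y.2]
  ring

/-- If the tangent lines of `L₁` have constant direction `b` relative to slope one, and those of
`L₀` stay less than one half turn clockwise from it, then every Maslov index vanishes. -/
theorem mas_slopeOne_eq_zero {a : R₀ → ℝ} (ha : Continuous a) {b : ℝ} {c : Circle}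
    (hc : ∀ x, slopeOne x = c)
    (h₀ : ∀ s, L₀.line s = Circle.exp (2 * Real.pi * a s) * c)
    (h₁ : ∀ t, L₁.line t = Circle.exp (2 * Real.pi * b) * c)
    (hb : ∀ s, b - a s ∈ Ioo (0 : ℝ) 1) (x y : IntPt L₀ L₁)
    (γ₀ : Path y.1.1 x.1.1) (γ₁ : Path x.1.2 y.1.2) : mas slopeOne x y γ₀ γ₁ = 0 := by
  have key := mas_eq_turns slopeOne x y γ₀ γ₁
  have fract_turnArg : ∀ {u : ℝ} {z : Circle}, z = Circle.exp (2 * Real.pi * u) →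
      Int.fract (turnArg z) = Int.fract u := by
    intro u z h
    obtain ⟨n, hn⟩ := exp_two_pi_eq_iff.1 ((exp_turnArg z).trans h)
    rw [show turnArg z = u + n by linarith, Int.fract_add_intCast]
  rw [turns_eq (g := fun t => a (γ₀ t)) (by fun_prop) (fun t => by simp [h₀, hc]),
    turns_eq (g := fun _ => b) (by fun_prop) (fun t => by simp [h₁, hc]),
    fract_turnArg (u := a y.1.1 - b) (by rw [h₀, h₁, mul_sub, Circle.exp_sub]; simp),
    fract_turnArg (u := b - a x.1.1) (by rw [h₀, h₁, mul_sub, Circle.exp_sub]; simp)] at key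
  have hx := hb x.1.1
  have hy := hb y.1.1
  rw [Int.fract_eq_self.2 ⟨hx.1.le, hx.2⟩,
    Int.fract_eq_iff (b := a y.1.1 - b + 1).2 ⟨by linarith [hy.2], by linarith [hy.1], -1, by
      push_cast; ring⟩] at key
  simp only [Path.source, Path.target] at key
  have : (mas slopeOne x y γ₀ γ₁ : ℝ) = 0 := by rw [key]; ring
  exact_mod_cast this

theorem mas_instField (zt : C(PStar, Circle)) (x y : IntPt L₀ L₁)
    (γ₀ : Path y.1.1 x.1.1) (γ₁ : Path x.1.2 y.1.2) :
    (mas (instField zt) x y γ₀ γ₁ : ℝ) =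
      mas slopeOne x y γ₀ γ₁ - (turnsAlong zt L₀ γ₀ + turnsAlong zt L₁ γ₁) := by
  rw [mas_eq_turns, mas_eq_turns, turns_line_div_inst, turns_line_div_inst]
  ring

theorem degree_loopThrough (zt : C(PStar, Circle)) (x y : IntPt L₀ L₁)
    (α₀ : Path x.1.1 y.1.1) (α₁ : Path y.1.2 x.1.2) :
    (degree (zt.comp (loopThrough x y α₀ α₁).toContinuousMap) : ℝ)
      = turnsAlong zt L₀ α₀ + turnsAlong zt L₁ α₁ := by
  rw [degree_eq_turns_of_loop (by simp)]
  obtain ⟨f, hf⟩ := exists_circle_lift ⟨fun t => zt (L₀.map (α₀ t)), by fun_prop⟩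
  obtain ⟨g, hg⟩ := exists_circle_lift ⟨fun t => zt (L₁.map (α₁ t)), by fun_prop⟩
  rw [turnsAlong, turnsAlong, turns_eq f.continuous hf, turns_eq g.continuous hg]
  -- the two lifts are concatenated after shifting the second one
  let F : Path (f 0) (f 1) := ⟨f, rfl, rfl⟩
  let G : Path (f 1) (g 1 - g 0 + f 1) :=
    ⟨⟨fun t => g t - g 0 + f 1, by fun_prop⟩, by simp, by simp⟩
  have hFG : Circle.exp (2 * Real.pi * f 1) = Circle.exp (2 * Real.pi * g 0) := by
    rw [hf, hg]
    simp [y.2]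
  rw [turns_eq (g := F.trans G) (F.trans G).continuous (fun t => ?_)]
  · simp only [Path.source, Path.target]; ring
  · simp only [loopThrough, ContinuousMap.comp_apply]
    change _ = zt ((Path.trans _ _) t)
    rw [Path.trans_apply, Path.trans_apply]
    split_ifs with h
    · exact hf _
    · change Circle.exp (2 * Real.pi * (g _ - g 0 + f 1)) = zt (L₁.map (α₁ _))
      rw [mul_add, mul_sub, Circle.exp_add, Circle.exp_sub, hFG, div_mul_cancel]
      exact hg _

end Curves

/-! ### Logarithms of circle valued maps and the local class at a corner -/

theorem exists_lift_of_starConvex {E : Type*} [NormedAddCommGroup E] [NormedSpace ℝ E] {S : Set E}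
    {x : E} (hS : StarConvex ℝ x S) (hx : x ∈ S) (ho : IsOpen S) {f : E → Circle}
    (hf : ContinuousOn f S) :
    ∃ Φ : E → ℝ, ContinuousOn Φ S ∧ ∀ w ∈ S, Circle.exp (2 * Real.pi * Φ w) = f w := by
  have hp := Real.pi_pos
  have := hS.contractibleSpace ⟨x, hx⟩
  have := ho.locallyPathConnectedSpace
  obtain ⟨F, ⟨-, hF⟩, -⟩ := Circle.isCoveringMap_exp.existsUnique_continuousMap_lifts
    (⟨fun w : S => f w, hf.domRestrict⟩ : C(S, Circle)) ⟨x, hx⟩ _ (Circle.exp_arg (f x))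
  classical
  refine ⟨fun w => if h : w ∈ S then F ⟨w, h⟩ / (2 * Real.pi) else 0, ?_, fun w hw => ?_⟩
  · rw [continuousOn_iff_continuous_domRestrict]
    refine (F.continuous.div_const (2 * Real.pi)).congr fun w => ?_
    simp [w.2]
  · beta_reduce
    rw [dif_pos hw, mul_div_cancel₀ _ (by positivity)]
    exact congrFun hF ⟨w, hw⟩

/-- A map `P* → S¹` as a function on the plane, with value `1` at the lattice points. -/
def pull (ζ : C(PStar, Circle)) (z : ℂ) : Circle := by
  classical exact if h : z ∈ Lattice then 1 else ζ ⟨toP z, not_isCorner_toP h⟩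

theorem pull_eq (ζ : C(PStar, Circle)) {z : ℂ} {x : PStar} (h : (x : Pillowcase) = toP z) :
    ζ x = pull ζ z := by
  have hz : z ∉ Lattice := fun hz => x.2 ⟨z, hz, h.symm⟩
  rw [pull, dif_neg hz]
  congr 1
  exact Subtype.ext h

theorem toP_eq_toP_iff {z w : ℂ} : toP z = toP w ↔ PillowRel z w :=
  ⟨fun h => Quotient.exact h, fun h => Quotient.sound (s := pillowSetoid) h⟩

theorem mem_lattice_of_toP_eq {z w : ℂ} (h : toP z = toP w) (hz : z ∈ Lattice) : w ∈ Lattice := by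
  by_contra hw
  exact not_isCorner_toP hw ⟨z, hz, h⟩

theorem pull_congr (ζ : C(PStar, Circle)) {z w : ℂ} (h : toP z = toP w) : pull ζ z = pull ζ w := by
  by_cases hz : z ∈ Lattice
  · rw [pull, pull, dif_pos hz, dif_pos (mem_lattice_of_toP_eq h hz)]
  · rw [← pull_eq ζ (x := ⟨toP z, not_isCorner_toP hz⟩) rfl, pull_eq ζ h]

theorem continuousOn_pull (ζ : C(PStar, Circle)) {S : Set ℂ} (hS : ∀ z ∈ S, z ∉ Lattice) :
    ContinuousOn (pull ζ) S := by
  rw [continuousOn_iff_continuous_domRestrict]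
  refine (ζ.continuous.comp (Continuous.subtype_mk (continuous_toP.comp continuous_subtype_val)
    fun z : S => not_isCorner_toP (hS z z.2))).congr fun z => ?_
  exact pull_eq ζ rfl

theorem latticePt_re (m n : ℤ) : (latticePt m n).re = Real.pi * m := by simp [latticePt]

theorem latticePt_im (m n : ℤ) : (latticePt m n).im = Real.pi * n := by simp [latticePt]

theorem mem_lattice_iff {z : ℂ} :
    z ∈ Lattice ↔ ∃ m n : ℤ, z.re = Real.pi * m ∧ z.im = Real.pi * n := by
  refine exists_congr fun m => exists_congr fun n => ?_
  rw [Complex.ext_iff, latticePt_re, latticePt_im]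

/-- A rectangle around the origin which contains no other lattice point, with sides parallel to
the diagonals, cut along a half diagonal. -/
def slitRect : Set ℂ :=
  {w | |w.re + w.im| < 2 * Real.pi ∧ |w.re - w.im| < Real.pi ∧
    (w.re + w.im ≠ 0 ∨ 0 < w.re - w.im)}

theorem isOpen_slitRect : IsOpen slitRect := by
  have h1 : IsOpen {w : ℂ | |w.re + w.im| < 2 * Real.pi} := isOpen_lt (by fun_prop) (by fun_prop)
  have h2 : IsOpen {w : ℂ | |w.re - w.im| < Real.pi} := isOpen_lt (by fun_prop) (by fun_prop)
  have h3 : IsOpen {w : ℂ | w.re + w.im ≠ 0} := isOpen_ne_fun (by fun_prop) (by fun_prop)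
  have h4 : IsOpen {w : ℂ | 0 < w.re - w.im} := isOpen_lt (by fun_prop) (by fun_prop)
  exact h1.inter (h2.inter (h3.union h4))

theorem add_not_mem_lattice {w : ℂ} (hw : w ∈ slitRect) (m n : ℤ) :
    latticePt m n + w ∉ Lattice := by
  have hp := Real.pi_pos
  rw [mem_lattice_iff]
  rintro ⟨a, b, ha, hb⟩
  rw [Complex.add_re, latticePt_re] at ha
  rw [Complex.add_im, latticePt_im] at hb
  obtain ⟨h1, h2, h3⟩ := hw
  have e1 : w.re + w.im = Real.pi * ((a - m + (b - n) : ℤ) : ℝ) := by push_cast; linarith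
  have e2 : w.re - w.im = Real.pi * ((a - m - (b - n) : ℤ) : ℝ) := by push_cast; linarith
  rw [e1, abs_mul, abs_of_pos hp, mul_comm 2, mul_lt_mul_iff_right₀ hp] at h1
  rw [e2, abs_mul, abs_of_pos hp, mul_lt_iff_lt_one_right hp] at h2
  have h1' : |a - m + (b - n)| < 2 := by exact_mod_cast h1
  have h2' : |a - m - (b - n)| < 1 := by exact_mod_cast h2
  rw [abs_lt] at h1' h2'
  have i1 : a - m + (b - n) = 0 := by omega
  have i2 : a - m - (b - n) = 0 := by omega
  rw [e1, e2, i1, i2] at h3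
  simp at h3

theorem starConvex_slitRect : StarConvex ℝ (⟨Real.pi / 4, -(Real.pi / 4)⟩ : ℂ) slitRect := by
  have hp := Real.pi_pos
  intro w hw a b ha hb hab
  obtain ⟨h1, h2, h3⟩ := hw
  have hre : (a • (⟨Real.pi / 4, -(Real.pi / 4)⟩ : ℂ) + b • w).re = a * (Real.pi / 4) + b * w.re := by
    simp
  have him : (a • (⟨Real.pi / 4, -(Real.pi / 4)⟩ : ℂ) + b • w).im
      = -(a * (Real.pi / 4)) + b * w.im := by
    simp
  have hb1 : b ≤ 1 := by linarith
  rw [abs_lt] at h1 h2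
  rw [slitRect, mem_ofPred_eq, hre, him, abs_lt, abs_lt]
  have s1 : a * (Real.pi / 4) + b * w.re + (-(a * (Real.pi / 4)) + b * w.im)
      = b * (w.re + w.im) := by ring
  have s2 : a * (Real.pi / 4) + b * w.re - (-(a * (Real.pi / 4)) + b * w.im)
      = a * (Real.pi / 2) + b * (w.re - w.im) := by ring
  rw [s1, s2]
  refine ⟨⟨by nlinarith, by nlinarith⟩, ⟨by nlinarith, by nlinarith⟩, ?_⟩
  rcases hb.eq_or_lt with rfl | hb0
  · right
    have : a = 1 := by linarith
    rw [this]; linarith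
  · rcases h3 with h3 | h3
    · exact Or.inl (mul_ne_zero hb0.ne' h3)
    · exact Or.inr (by positivity)

theorem slitRect_base_mem : (⟨Real.pi / 4, -(Real.pi / 4)⟩ : ℂ) ∈ slitRect := by
  have hp := Real.pi_pos
  refine ⟨?_, ?_, Or.inr ?_⟩
  · simp only [add_neg_cancel, abs_zero]; positivity
  · rw [abs_lt]; constructor <;> simp only [sub_neg_eq_add] <;> linarith
  · simp only [sub_neg_eq_add]; linarith

theorem neg_mem_slitRect {w : ℂ} (hw : w ∈ slitRect) (h : w.re + w.im ≠ 0) : -w ∈ slitRect := by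
  obtain ⟨h1, h2, -⟩ := hw
  refine ⟨?_, ?_, Or.inl ?_⟩
  · rwa [Complex.neg_re, Complex.neg_im, ← neg_add, abs_neg]
  · rwa [Complex.neg_re, Complex.neg_im, ← neg_sub', abs_neg]
  · rwa [Complex.neg_re, Complex.neg_im, ← neg_add, neg_ne_zero]

theorem toP_latticePt_sub (m n : ℤ) (w : ℂ) : toP (latticePt m n - w) = toP (latticePt m n + w) :=
  toP_eq_toP_iff.2 ⟨m, n, Or.inr (by
    rw [show 2 * m = m + m by ring, show 2 * n = n + n by ring, ← latticePt_add]; ring)⟩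

/-- Near a corner, a map representing the class `z` has a logarithm on the slit rectangle, which
jumps by `n ≡ 1` mod `4` from a point to the opposite one. -/
theorem LiftsZ.exists_log {zt : C(PStar, Circle)} (hz : LiftsZ zt) (m n : ℤ) :
    ∃ (Φ : ℂ → ℝ) (k : ℤ), ContinuousOn Φ slitRect ∧
      (∀ w ∈ slitRect, Circle.exp (2 * Real.pi * Φ w) = pull zt (latticePt m n + w)) ∧
      ∀ w ∈ slitRect, 0 < w.re + w.im → Φ w - Φ (-w) = 1 + 4 * k := by
  have hp := Real.pi_pos
  obtain ⟨Φ, hΦ, hexp⟩ := exists_lift_of_starConvex starConvex_slitRect slitRect_base_mem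
    isOpen_slitRect (f := fun w => pull zt (latticePt m n + w))
    ((continuousOn_pull zt (S := (fun w => latticePt m n + w) '' slitRect) (by
      rintro _ ⟨w, hw, rfl⟩
      exact add_not_mem_lattice hw m n)).comp (by fun_prop) (mapsTo_image _ _))
  obtain ⟨r, hr, hr0, hr1⟩ := ((hz m n).and (Ioo_mem_nhdsGT (show (0 : ℝ) < Real.pi / 4 by
    positivity))).exists
  -- the small half circle around the lattice point, and its antipode
  let e : I → ℂ := fun t => r * Complex.exp (((Real.pi * (t : ℝ) : ℝ) : ℂ) * Complex.I)
  have he : Continuous e := by fun_prop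
  have here : ∀ t, (e t).re = r * Real.cos (Real.pi * t) := fun t => by
    simp only [e, Complex.re_ofReal_mul, Complex.exp_ofReal_mul_I_re]
  have heim : ∀ t, (e t).im = r * Real.sin (Real.pi * t) := fun t => by
    simp only [e, Complex.im_ofReal_mul, Complex.exp_ofReal_mul_I_im]
  have hmem : ∀ t, -e t ∈ slitRect := by
    intro t
    have c1 := Real.neg_one_le_cos (Real.pi * t)
    have c2 := Real.cos_le_one (Real.pi * t)
    have c3 := Real.neg_one_le_sin (Real.pi * t)
    have c4 := Real.sin_le_one (Real.pi * t)
    have c5 := Real.sin_sq_add_cos_sq (Real.pi * t)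
    have c6 : 0 ≤ Real.sin (Real.pi * t) := Real.sin_nonneg_of_nonneg_of_le_pi
      (mul_nonneg hp.le t.2.1) (by nlinarith [t.2.2])
    rw [slitRect, mem_ofPred_eq, Complex.neg_re, Complex.neg_im, here, heim, abs_lt, abs_lt]
    set c := Real.cos (Real.pi * t)
    set s := Real.sin (Real.pi * t)
    refine ⟨⟨by nlinarith, by nlinarith⟩, ⟨by nlinarith, by nlinarith⟩, ?_⟩
    by_cases h : c + s = 0
    · right
      have : c = -s := by linarith
      have hs : 0 < s := by
        refine c6.lt_of_ne fun h0 => ?_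
        rw [this, ← h0] at c5
        norm_num at c5
      rw [this]
      nlinarith
    · left
      rw [show -(r * c) + -(r * s) = -(r * (c + s)) by ring]
      exact neg_ne_zero.2 (mul_ne_zero hr0.ne' h)
  have hnl : ∀ t, latticePt m n + e t ∉ Lattice := fun t h => by
    refine add_not_mem_lattice (hmem t) m n (mem_lattice_of_toP_eq ?_ h)
    rw [← toP_latticePt_sub, sub_eq_add_neg]
  let α : C(I, PStar) := ⟨fun t => ⟨toP (latticePt m n + e t), not_isCorner_toP (hnl t)⟩,
    Continuous.subtype_mk (continuous_toP.comp (by fun_prop)) _⟩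
  have hα := hr α fun t => rfl
  have e0 : e 0 = r := by simp [e]
  have e1 : e 1 = -r := by simp [e]
  have hα01 : α 0 = α 1 := Subtype.ext (by
    change toP (latticePt m n + e 0) = toP (latticePt m n + e 1)
    rw [e0, e1, ← sub_eq_add_neg, toP_latticePt_sub])
  have hdeg := degree_eq_turns_of_loop (α := zt.comp α) (by simp [hα01])
  rw [turns_eq (g := fun t => Φ (-e t))
    (hΦ.comp_continuous he.neg hmem) (fun t => by
      rw [hexp _ (hmem t), ContinuousMap.comp_apply, ← sub_eq_add_neg]
      rw [pull_eq zt (x := α t) (z := latticePt m n + e t) rfl]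
      exact pull_congr zt (toP_latticePt_sub m n _))] at hdeg
  simp only [e0, e1, neg_neg] at hdeg
  obtain ⟨k, hk⟩ : ∃ k : ℤ, degree (zt.comp α) = 1 + 4 * k := by
    have h1 : ((degree (zt.comp α) - 1 : ℤ) : ZMod 4) = 0 := by push_cast; rw [hα]; ring
    obtain ⟨k, hk⟩ := (ZMod.intCast_zmod_eq_zero_iff_dvd _ 4).1 h1
    exact ⟨k, by push_cast at hk; linarith⟩
  refine ⟨Φ, k, hΦ, hexp, fun w hw hpos => ?_⟩
  -- the jump is an integer, hence constant on the half of the rectangle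
  have hconv : IsPreconnected (slitRect ∩ {w | 0 < w.re + w.im}) := by
    have : slitRect ∩ {w | 0 < w.re + w.im} =
        {w : ℂ | w.re + w.im ∈ Ioo 0 (2 * Real.pi)} ∩ {w | w.re - w.im ∈ Ioo (-Real.pi) Real.pi} := by
      ext w
      simp only [slitRect, mem_inter_iff, mem_ofPred_eq, mem_Ioo, abs_lt]
      constructor
      · rintro ⟨⟨⟨-, h1⟩, h2, -⟩, h3⟩
        exact ⟨⟨h3, h1⟩, h2⟩
      · rintro ⟨⟨h3, h1⟩, h2⟩
        exact ⟨⟨⟨by linarith, h1⟩, h2, Or.inl h3.ne'⟩, h3⟩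
    rw [this]
    refine Convex.isPreconnected (Convex.inter ?_ ?_)
    · exact (convex_Ioo _ _).is_linear_preimage (f := fun w : ℂ => w.re + w.im)
        (Complex.reLm + Complex.imLm).isLinear
    · exact (convex_Ioo _ _).is_linear_preimage (f := fun w : ℂ => w.re - w.im)
        (Complex.reLm - Complex.imLm).isLinear
  have hneg : ∀ w ∈ slitRect ∩ {w | 0 < w.re + w.im}, -w ∈ slitRect := fun w hw =>
    neg_mem_slitRect hw.1 (ne_of_gt hw.2)
  have hr2 : (r : ℂ) ∈ slitRect ∩ {w | 0 < w.re + w.im} := by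
    refine ⟨⟨?_, ?_, Or.inl ?_⟩, ?_⟩ <;> simp [abs_of_pos hr0, hr0, hr0.ne'] <;> linarith
  have := eq_of_forall_int hconv (f := fun w => Φ w - Φ (-w))
    ((hΦ.mono inter_subset_left).sub (hΦ.comp (by fun_prop) hneg))
    (fun w hw => exp_two_pi_eq_iff.1 (by
      rw [hexp _ hw.1, hexp _ (hneg w hw), ← sub_eq_add_neg]
      exact pull_congr zt (toP_latticePt_sub m n _).symm)) ⟨hw, hpos⟩ hr2
  rw [this, ← hdeg, hk]
  push_cast; ring

/-! ### The class `z` along the two curves -/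

theorem sub_eq_sub_of_exp_eq {X : Type*} [TopologicalSpace X] {T : Set X} (hT : IsPreconnected T)
    {f g : X → ℝ} (hf : ContinuousOn f T) (hg : ContinuousOn g T)
    (h : ∀ x ∈ T, Circle.exp (2 * Real.pi * f x) = Circle.exp (2 * Real.pi * g x)) {x y : X}
    (hx : x ∈ T) (hy : y ∈ T) : f x - f y = g x - g y := by
  have := eq_of_forall_int hT (f := fun x => f x - g x) (hf.sub hg)
    (fun x hx => exp_two_pi_eq_iff.1 (h x hx)) hx hy
  linarith

theorem zeroLift_re (ε s : ℝ) : (zeroLift ε s).re = s + ε * Real.sin s + Real.pi / 2 := by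
  simp only [zeroLift, Complex.add_re, Complex.ofReal_re, Complex.re_ofReal_mul, Complex.I_re,
    mul_zero, add_zero]

theorem zeroLift_im (ε s : ℝ) : (zeroLift ε s).im = s - ε * Real.sin s + Real.pi / 2 := by
  simp only [zeroLift, Complex.add_im, Complex.ofReal_im, Complex.im_ofReal_mul, Complex.I_im,
    mul_one, zero_add]

/-- Between its passages near two neighbouring translates of the corner `(0, 0)`, the curve
`L₀` passes the corner `(π, π)` on the lower right. -/
theorem zeroLift_sub_mem_slitRect {ε : ℝ} (hε : ε ∈ Ioo (0 : ℝ) 1) {s : ℝ}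
    (hs : s ∈ Ioo (-(Real.pi / 2)) (3 * Real.pi / 2)) :
    zeroLift ε s - latticePt 1 1 ∈ slitRect := by
  have hp := Real.pi_gt_three
  have s1 := Real.sin_le_one s
  have s2 := Real.neg_one_le_sin s
  rw [slitRect, mem_ofPred_eq, Complex.sub_re, Complex.sub_im, latticePt_re, latticePt_im,
    zeroLift_re, zeroLift_im, abs_lt, abs_lt]
  push_cast
  refine ⟨⟨by linarith [hs.1], by linarith [hs.2]⟩, ⟨by nlinarith [hε.1, hε.2],
    by nlinarith [hε.1, hε.2]⟩, ?_⟩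
  by_cases h : s = Real.pi / 2
  · right
    rw [h, Real.sin_pi_div_two]
    linarith [hε.1]
  · left
    intro h0
    exact h (by linarith)

/-- The curve `L₀` passes the corner `(2π, 2π)` on the upper left. -/
theorem sub_zeroLift_mem_slitRect {ε : ℝ} (hε : ε ∈ Ioo (0 : ℝ) 1) {s : ℝ}
    (hs : s ∈ Icc Real.pi (2 * Real.pi)) : latticePt 2 2 - zeroLift ε s ∈ slitRect := by
  have hp := Real.pi_gt_three
  have s1 := Real.sin_le_one s
  have s2 := Real.neg_one_le_sin s
  rw [slitRect, mem_ofPred_eq, Complex.sub_re, Complex.sub_im, latticePt_re, latticePt_im,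
    zeroLift_re, zeroLift_im, abs_lt, abs_lt]
  push_cast
  refine ⟨⟨by linarith [hs.2], by linarith [hs.1]⟩, ⟨by nlinarith [hε.1, hε.2],
    by nlinarith [hε.1, hε.2]⟩, ?_⟩
  by_cases h : s = 3 * Real.pi / 2
  · right
    rw [h, show 3 * Real.pi / 2 = Real.pi / 2 + Real.pi by ring, Real.sin_add_pi,
      Real.sin_pi_div_two]
    linarith [hε.1]
  · left
    intro h0
    exact h (by linarith)

theorem exists_log_zeroLift (ζ : C(PStar, Circle)) {ε : ℝ} (hε : ε ∈ Ioo (0 : ℝ) 1) :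
    ∃ φ : ℝ → ℝ, Continuous φ ∧ ∀ s, Circle.exp (2 * Real.pi * φ s) = pull ζ (zeroLift ε s) := by
  obtain ⟨φ, hφ, h⟩ := exists_lift_of_starConvex (E := ℝ) (S := univ) (x := 0)
    (f := fun s => pull ζ (zeroLift ε s)) (starConvex_univ 0) (mem_univ _) isOpen_univ
    ((continuousOn_pull ζ (S := range (zeroLift ε)) (by
      rintro _ ⟨s, rfl⟩; exact zeroLift_not_mem hε s)).comp
        (continuous_zeroLift ε).continuousOn fun s _ => mem_range_self s)
  exact ⟨φ, continuousOn_univ.1 hφ, fun s => h s (mem_univ s)⟩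

section Log

variable {zt : C(PStar, Circle)} (hz : LiftsZ zt) {ε : ℝ} (hε : ε ∈ Ioo (0 : ℝ) 1) {φ : ℝ → ℝ}
  (hφ : Continuous φ) (hexp : ∀ s, Circle.exp (2 * Real.pi * φ s) = pull zt (zeroLift ε s))

include hz hε hφ hexp

/-- The curve `L₀` is a figure eight, which encircles one corner counterclockwise and another one
clockwise.  Hence the class `z` vanishes on it. -/
theorem log_zeroLift_period :
    ∃ N : ℤ, ∀ s, ∀ k : ℤ, φ (s + k * (2 * Real.pi)) - φ s = 4 * N * k := by
  have hp := Real.pi_pos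
  have hpd : ∀ s, pull zt (zeroLift ε (s + 2 * Real.pi)) = pull zt (zeroLift ε s) := fun s =>
    pull_congr zt (toP_eq_toP_iff.2 ⟨-1, -1, Or.inl (by
      simp only [zeroLift, latticePt, Real.sin_add_two_pi]
      push_cast; ring)⟩)
  have hconst : ∀ s, φ (s + 2 * Real.pi) - φ s = φ (0 + 2 * Real.pi) - φ 0 := fun s =>
    eq_of_forall_int (f := fun s => φ (s + 2 * Real.pi) - φ s) isPreconnected_univ (by fun_prop)
      (fun s _ => exp_two_pi_eq_iff.1 (by rw [hexp, hexp, hpd])) (mem_univ _) (mem_univ _)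
  obtain ⟨N, hN⟩ : ∃ N : ℤ, φ (0 + 2 * Real.pi) - φ 0 = 4 * N := by
    obtain ⟨Φ₁, k₁, c₁, e₁, j₁⟩ := hz.exists_log 1 1
    obtain ⟨Φ₂, k₂, c₂, e₂, j₂⟩ := hz.exists_log 2 2
    have m1 : ∀ s ∈ Icc 0 Real.pi, zeroLift ε s - latticePt 1 1 ∈ slitRect := fun s hs =>
      zeroLift_sub_mem_slitRect hε ⟨by linarith [hs.1], by linarith [hs.2]⟩
    have w₁ : Continuous fun s => zeroLift ε s - latticePt 1 1 :=
      (continuous_zeroLift ε).sub continuous_const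
    have w₂ : Continuous fun s => latticePt 2 2 - zeroLift ε s :=
      continuous_const.sub (continuous_zeroLift ε)
    have d1 := sub_eq_sub_of_exp_eq (isPreconnected_Icc (a := 0) (b := Real.pi)) hφ.continuousOn
      (c₁.comp (w₁.continuousOn) m1)
      (fun s hs => by rw [hexp, Function.comp_apply, e₁ _ (m1 s hs), add_sub_cancel])
      (right_mem_Icc.2 hp.le) (left_mem_Icc.2 hp.le)
    have d2 := sub_eq_sub_of_exp_eq (isPreconnected_Icc (a := Real.pi) (b := 2 * Real.pi))
      hφ.continuousOn (c₂.comp w₂.continuousOn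
        fun s hs => sub_zeroLift_mem_slitRect hε hs)
      (fun s hs => by
        rw [hexp, Function.comp_apply, e₂ _ (sub_zeroLift_mem_slitRect hε hs),
          ← pull_congr zt (toP_latticePt_sub 2 2 _), sub_sub_cancel])
      (right_mem_Icc.2 (by linarith)) (left_mem_Icc.2 (by linarith))
    have v1 : zeroLift ε 0 - latticePt 1 1 = -(zeroLift ε Real.pi - latticePt 1 1) := by
      simp [zeroLift, latticePt]; ring
    have v2 : latticePt 2 2 - zeroLift ε (2 * Real.pi)
        = -(latticePt 2 2 - zeroLift ε Real.pi) := by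
      simp [zeroLift, latticePt]; ring
    have w1 := j₁ _ (m1 Real.pi (right_mem_Icc.2 hp.le)) (by
      rw [Complex.sub_re, Complex.sub_im, latticePt_re, latticePt_im, zeroLift_re, zeroLift_im]
      push_cast; linarith)
    have w2 := j₂ _ (sub_zeroLift_mem_slitRect hε (s := Real.pi) ⟨le_rfl, by linarith⟩) (by
      rw [Complex.sub_re, Complex.sub_im, latticePt_re, latticePt_im, zeroLift_re, zeroLift_im]
      push_cast; linarith)
    rw [← v1] at w1
    rw [← v2] at w2
    simp only [Function.comp_apply] at d1 d2
    refine ⟨k₁ - k₂, ?_⟩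
    rw [zero_add]
    push_cast
    linarith
  refine ⟨N, fun s k => ?_⟩
  have hper : Function.Periodic (fun s => φ s - 4 * N * (s / (2 * Real.pi))) (2 * Real.pi) := by
    intro s
    have := hconst s
    rw [hN] at this
    have h2 : (s + 2 * Real.pi) / (2 * Real.pi) = s / (2 * Real.pi) + 1 := by field_simp
    simp only [h2]
    linarith
  have := hper.int_mul k s
  beta_reduce at this
  have h2 : (s + k * (2 * Real.pi)) / (2 * Real.pi) = s / (2 * Real.pi) + k := by field_simp
  rw [h2] at this
  linarith

/-- The class `z` along a path in the circle only depends, mod `4`, on the endpoints. -/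
theorem turnsAlong_zeroCurve {a b : ℝ} (γ : Path (a : Circ) (b : Circ)) :
    ∃ k : ℤ, turnsAlong zt (zeroCurve ε hε) γ = φ b - φ a + 4 * k := by
  have hp := Real.pi_pos
  obtain ⟨N, hN⟩ := log_zeroLift_period hz hε hφ hexp
  have hst : ∀ {u v : ℝ}, (u : Circ) = v → ∃ k : ℤ, φ u - φ v = 4 * N * k := by
    intro u v h
    obtain ⟨k, hk⟩ := Real.Angle.angle_eq_iff_two_pi_dvd_sub.1 h
    exact ⟨k, by rw [← hN v k]; congr 2; linarith⟩
  obtain ⟨f, hf⟩ := exists_circle_lift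
    ⟨fun t => Real.Angle.toCircle (γ t), AddCircle.homeomorphCircle'.continuous.comp γ.continuous⟩
  have hcoe : ∀ t, ((2 * Real.pi * f t : ℝ) : Circ) = γ t := fun t => by
    have h := hf t
    rw [← Real.Angle.toCircle_coe] at h
    have h2 := congrArg (fun z : Circle => ((Complex.arg z : ℝ) : Real.Angle)) h
    beta_reduce at h2
    rw [Real.Angle.arg_toCircle] at h2
    exact h2.trans (Real.Angle.arg_toCircle _)
  rw [turnsAlong, turns_eq (g := fun t => φ (2 * Real.pi * f t)) (by fun_prop) (fun t => by
    rw [hexp]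
    exact (pull_eq zt (by rw [← hcoe]; rfl)).symm)]
  obtain ⟨k, hk⟩ := hst ((hcoe 1).trans γ.target)
  obtain ⟨k', hk'⟩ := hst ((hcoe 0).trans γ.source)
  refine ⟨N * (k - k'), ?_⟩
  push_cast
  linarith

end Log

theorem exists_log_arc (ζ : C(PStar, Circle)) (A : ProperArc) :
    ∃ ψ : ℝ → ℝ, ContinuousOn ψ (Ioo 0 Real.pi) ∧
      (∀ t ∈ Ioo 0 Real.pi, Circle.exp (2 * Real.pi * ψ t) = pull ζ (A.lift t)) ∧
      ∀ {a b : Ioo (0 : ℝ) Real.pi} (γ : Path a b), turnsAlong ζ A.curve γ = ψ b - ψ a := by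
  have hp := Real.pi_pos
  have hm : Real.pi / 2 ∈ Ioo 0 Real.pi := ⟨by linarith, by linarith⟩
  obtain ⟨ψ, hψ, h⟩ := exists_lift_of_starConvex (E := ℝ) (S := Ioo 0 Real.pi)
    (f := fun t => pull ζ (A.lift t)) ((convex_Ioo _ _).starConvex hm) hm isOpen_Ioo
    ((continuousOn_pull ζ (S := A.lift '' Ioo 0 Real.pi) (by
      rintro _ ⟨t, ht, rfl⟩; exact A.interior t ht)).comp
        A.smooth.continuous.continuousOn (mapsTo_image _ _))
  refine ⟨ψ, hψ, h, fun {a b} γ => ?_⟩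
  rw [turnsAlong, turns_eq (g := fun t => ψ (γ t))
    (hψ.comp_continuous (continuous_subtype_val.comp γ.continuous) fun t => (γ t).2) (fun t => by
      rw [h _ (γ t).2]
      exact (pull_eq ζ rfl).symm)]
  simp only [Path.source, Path.target]

section Grading

variable {zt : C(PStar, Circle)} (hz : LiftsZ zt) {ε : ℝ} {hε : ε ∈ Ioo (0 : ℝ) 1}
  {A : ProperArc}

include hz

theorem exists_turns_sub_turns {x y : IntPt (zeroCurve ε hε) A.curve}
    (γ₀ γ₀' : Path y.1.1 x.1.1) (γ₁ γ₁' : Path x.1.2 y.1.2) :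
    ∃ k : ℤ, turnsAlong zt (zeroCurve ε hε) γ₀ + turnsAlong zt A.curve γ₁
      = turnsAlong zt (zeroCurve ε hε) γ₀' + turnsAlong zt A.curve γ₁' + 4 * k := by
  obtain ⟨φ, hφ, hexp⟩ := exists_log_zeroLift zt hε
  obtain ⟨ψ, -, -, hψ⟩ := exists_log_arc zt A
  obtain ⟨⟨a, t⟩, hx⟩ := x
  obtain ⟨⟨b, t'⟩, hy⟩ := y
  induction a using Real.Angle.induction_on with | h a => ?_
  induction b using Real.Angle.induction_on with | h b => ?_
  obtain ⟨k, hk⟩ := turnsAlong_zeroCurve hz hε hφ hexp γ₀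
  obtain ⟨k', hk'⟩ := turnsAlong_zeroCurve hz hε hφ hexp γ₀'
  refine ⟨k - k', ?_⟩
  rw [hk, hk', hψ, hψ]
  push_cast; ring

/-- The Maslov index relative to the instanton line field does not depend, mod `4`, on the choice
of the paths. -/
theorem mas_instField_eq_gr (h0 : ∀ (x y : IntPt (zeroCurve ε hε) A.curve)
      (γ₀ : Path y.1.1 x.1.1) (γ₁ : Path x.1.2 y.1.2), mas slopeOne x y γ₀ γ₁ = 0)
    (x y : IntPt (zeroCurve ε hε) A.curve) (γ₀ : Path y.1.1 x.1.1) (γ₁ : Path x.1.2 y.1.2) :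
    (mas (instField zt) x y γ₀ γ₁ : ZMod 4) = gr zt x y := by
  obtain ⟨k, hk⟩ := exists_turns_sub_turns hz γ₀ (PathConnectedSpace.somePath _ _) γ₁
    (PathConnectedSpace.somePath _ _)
  have h1 := mas_instField zt x y γ₀ γ₁
  have h2 := mas_instField zt x y (PathConnectedSpace.somePath _ _)
    (PathConnectedSpace.somePath _ _)
  rw [h0] at h1 h2
  have h3 : mas (instField zt) x y γ₀ γ₁ = mas (instField zt) x y
      (PathConnectedSpace.somePath _ _) (PathConnectedSpace.somePath _ _) + 4 * -k := by
    have : (mas (instField zt) x y γ₀ γ₁ : ℝ) = mas (instField zt) x y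
      (PathConnectedSpace.somePath _ _) (PathConnectedSpace.somePath _ _) + 4 * -k := by linarith
    exact_mod_cast this
  rw [h3, gr, Int.cast_add, Int.cast_mul]
  have h4 : ((4 : ℤ) : ZMod 4) = 0 := rfl
  rw [h4, zero_mul, add_zero]

theorem gr_eq_zEval (h0 : ∀ (x y : IntPt (zeroCurve ε hε) A.curve)
      (γ₀ : Path y.1.1 x.1.1) (γ₁ : Path x.1.2 y.1.2), mas slopeOne x y γ₀ γ₁ = 0)
    (x y : IntPt (zeroCurve ε hε) A.curve) (α₀ : Path x.1.1 y.1.1) (α₁ : Path y.1.2 x.1.2) :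
    gr zt x y = zEval zt (loopThrough x y α₀ α₁) := by
  rw [← mas_instField_eq_gr hz h0 x y α₀.symm α₁.symm, zEval]
  congr 1
  have h1 := mas_instField zt x y α₀.symm α₁.symm
  rw [h0, turnsAlong_symm, turnsAlong_symm] at h1
  have h2 := degree_loopThrough zt x y α₀ α₁
  have : (mas (instField zt) x y α₀.symm α₁.symm : ℝ)
      = degree (zt.comp (loopThrough x y α₀ α₁).toContinuousMap) := by
    rw [h1, h2]; push_cast; ring
  exact_mod_cast this

theorem gr_self (h0 : ∀ (x y : IntPt (zeroCurve ε hε) A.curve)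
      (γ₀ : Path y.1.1 x.1.1) (γ₁ : Path x.1.2 y.1.2), mas slopeOne x y γ₀ γ₁ = 0)
    (x : IntPt (zeroCurve ε hε) A.curve) : gr zt x x = 0 := by
  rw [← mas_instField_eq_gr hz h0 x x (Path.refl _) (Path.refl _)]
  have h1 := mas_instField zt x x (Path.refl _) (Path.refl _)
  have hc : ∀ (u : Circle) (α : C(I, Circle)), (∀ t, α t = u) → turns α = 0 := fun u α h => by
    rw [turns_eq (g := fun _ => turnArg u) continuous_const (fun t => by rw [exp_turnArg, h]),
      sub_self]
  rw [h0, turnsAlong, turnsAlong, hc (zt ((zeroCurve ε hε).map x.1.1)) _ fun t => rfl,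
    hc (zt (A.curve.map x.1.2)) _ fun t => rfl] at h1
  have : mas (instField zt) x x (Path.refl _) (Path.refl _) = 0 := by
    have : (mas (instField zt) x x (Path.refl _) (Path.refl _) : ℝ) = 0 := by
      rw [h1]; push_cast; ring
    exact_mod_cast this
  rw [this, Int.cast_zero]

/-- Suppose that `x` and `y` are consecutive intersection points on `L₀`, on both sides of the
corner `(π, π)`, whose lifts to `L₀` can be joined, after rotating that of `y` by a half turn about
the corner, by a lift of the arc.  The loop which follows `L₀` from `x` to `y` and returns along
the arc then encircles the corner once. -/
theorem gr_eq_one (h0 : ∀ (x y : IntPt (zeroCurve ε hε) A.curve)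
      (γ₀ : Path y.1.1 x.1.1) (γ₁ : Path x.1.2 y.1.2), mas slopeOne x y γ₀ γ₁ = 0)
    {W : ℂ} (hA : ∀ t : ℝ, A.lift t = t * W) {x y : IntPt (zeroCurve ε hε) A.curve} {s₁ s₂ : ℝ}
    (hx : (s₁ : Circ) = x.1.1) (hy : (s₂ : Circ) = y.1.1)
    (hs₁ : s₁ ∈ Ioo (-(Real.pi / 2)) (Real.pi / 2))
    (hs₂ : s₂ ∈ Ioo (Real.pi / 2) (3 * Real.pi / 2)) {e : ℝ} (he : e = 1 ∨ e = -1) {m n : ℤ}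
    (h₁ : zeroLift ε s₁ = e * (x.1.2 : ℝ) * W + latticePt (2 * m) (2 * n))
    (h₂ : latticePt 2 2 - zeroLift ε s₂ = e * (y.1.2 : ℝ) * W + latticePt (2 * m) (2 * n)) :
    gr zt x y = 1 := by
  have hp := Real.pi_pos
  obtain ⟨Φ, k, c, hΦ, j⟩ := hz.exists_log 1 1
  obtain ⟨φ, hφ, hexp⟩ := exists_log_zeroLift zt hε
  obtain ⟨ψ, cψ, hψ, hturn⟩ := exists_log_arc zt A
  obtain ⟨⟨a, t₁⟩, hx'⟩ := x
  obtain ⟨⟨b, t₂⟩, hy'⟩ := y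
  dsimp only at hx hy h₁ h₂
  subst hx hy
  have hm : ∀ s ∈ Ioo (-(Real.pi / 2)) (3 * Real.pi / 2), zeroLift ε s - latticePt 1 1 ∈ slitRect :=
    fun s hs => zeroLift_sub_mem_slitRect hε hs
  have m₁ : s₁ ∈ Ioo (-(Real.pi / 2)) (3 * Real.pi / 2) := ⟨hs₁.1, by linarith [hs₁.2]⟩
  have m₂ : s₂ ∈ Ioo (-(Real.pi / 2)) (3 * Real.pi / 2) := ⟨by linarith [hs₂.1], hs₂.2⟩
  have hw₀ : Continuous fun s => zeroLift ε s - latticePt 1 1 :=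
    (continuous_zeroLift ε).sub continuous_const
  have d0 := sub_eq_sub_of_exp_eq isPreconnected_Ioo hφ.continuousOn
    (c.comp hw₀.continuousOn hm)
    (fun s hs => by rw [hexp, Function.comp_apply, hΦ _ (hm s hs), add_sub_cancel]) m₁ m₂
  simp only [Function.comp_apply] at d0
  -- the lift of the arc from `x` to the rotated lift of `y`, centred at the corner
  let η : ℝ → ℂ := fun t => e * t * W + latticePt (2 * m) (2 * n) - latticePt 1 1
  have hη : Continuous η := by fun_prop
  have hη₁ : η t₁ = zeroLift ε s₁ - latticePt 1 1 := by simp only [η, h₁]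
  have hη₂ : η t₂ = -(zeroLift ε s₂ - latticePt 1 1) := by
    have h22 : latticePt 2 2 = latticePt 1 1 + latticePt 1 1 := by rw [latticePt_add]; rfl
    simp only [η]
    linear_combination h22 - h₂
  have hre : (zeroLift ε s₂ - latticePt 1 1).re + (zeroLift ε s₂ - latticePt 1 1).im
      = 2 * (s₂ - Real.pi / 2) := by
    rw [Complex.sub_re, Complex.sub_im, latticePt_re, latticePt_im, zeroLift_re, zeroLift_im]
    push_cast; ring
  have hre₁ : (zeroLift ε s₁ - latticePt 1 1).re + (zeroLift ε s₁ - latticePt 1 1).im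
      = 2 * (s₁ - Real.pi / 2) := by
    rw [Complex.sub_re, Complex.sub_im, latticePt_re, latticePt_im, zeroLift_re, zeroLift_im]
    push_cast; ring
  -- the left half of the slit rectangle is convex
  let H : Set ℂ := {w : ℂ | w.re + w.im ∈ Ioo (-(2 * Real.pi)) 0} ∩
    {w | w.re - w.im ∈ Ioo (-Real.pi) Real.pi}
  have hHs : H ⊆ slitRect := fun w hw => ⟨abs_lt.2 ⟨hw.1.1, by linarith [hw.1.2]⟩,
    abs_lt.2 hw.2, Or.inl hw.1.2.ne⟩
  have hsH : ∀ w ∈ slitRect, w.re + w.im < 0 → w ∈ H := fun w hw h =>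
    ⟨⟨(abs_lt.1 hw.1).1, h⟩, abs_lt.1 hw.2.1⟩
  have hconv : Convex ℝ (η ⁻¹' H) := by
    have h1 : Convex ℝ H := by
      refine Convex.inter ?_ ?_
      · exact (convex_Ioo _ _).is_linear_preimage (f := fun w : ℂ => w.re + w.im)
          (Complex.reLm + Complex.imLm).isLinear
      · exact (convex_Ioo _ _).is_linear_preimage (f := fun w : ℂ => w.re - w.im)
          (Complex.reLm - Complex.imLm).isLinear
    have h2 := h1.affine_preimage (((LinearMap.toSpanSingleton ℝ ℂ (e * W)).toAffineMap
      + AffineMap.const ℝ ℝ (latticePt (2 * m) (2 * n) - latticePt 1 1)))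
    convert! h2 using 2
    ext t
    simp [η]; ring
  have n₁ : (t₁ : ℝ) ∈ η ⁻¹' H ∩ Ioo 0 Real.pi := by
    refine ⟨hsH _ (hη₁ ▸ hm _ m₁) ?_, t₁.2⟩
    rw [hη₁, hre₁]; linarith [hs₁.2]
  have n₂ : (t₂ : ℝ) ∈ η ⁻¹' H ∩ Ioo 0 Real.pi := by
    refine ⟨hsH _ (hη₂ ▸ neg_mem_slitRect (hm _ m₂) ?_) ?_, t₂.2⟩
    · rw [hre]; linarith [hs₂.1]
    · rw [hη₂, Complex.neg_re, Complex.neg_im, ← neg_add, hre]; linarith [hs₂.1]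
  have htoP : ∀ t : ℝ, toP (latticePt 1 1 + η t) = toP (A.lift t) := fun t => by
    simp only [η, add_sub_cancel, hA]
    rcases he with rfl | rfl
    · exact (toP_eq_toP_iff.2 ⟨m, n, Or.inl (by push_cast; ring)⟩).symm
    · exact (toP_eq_toP_iff.2 ⟨m, n, Or.inr (by push_cast; ring)⟩).symm
  have d1 := sub_eq_sub_of_exp_eq (hconv.inter (convex_Ioo 0 Real.pi)).isPreconnected
    (cψ.mono inter_subset_right) (c.comp hη.continuousOn fun t ht => hHs ht.1)
    (fun t ht => by
      rw [hψ _ ht.2, Function.comp_apply, hΦ _ (hHs ht.1), pull_congr zt (htoP t)]) n₁ n₂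
  simp only [Function.comp_apply, hη₁, hη₂] at d1
  have hj := j _ (hm _ m₂) (by rw [hre]; linarith [hs₂.1])
  let γ₁ : Path t₁ t₂ := PathConnectedSpace.somePath _ _
  let γ₀ : Path (s₂ : Circ) (s₁ : Circ) := PathConnectedSpace.somePath _ _
  obtain ⟨k', hk'⟩ := turnsAlong_zeroCurve hz hε hφ hexp γ₀
  have hmas := mas_instField (L₀ := zeroCurve ε hε) (L₁ := A.curve) zt ⟨(_, t₁), hx'⟩
    ⟨(_, t₂), hy'⟩ γ₀ γ₁
  rw [h0, hk', hturn] at hmas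
  rw [← mas_instField_eq_gr hz h0 _ _ γ₀ γ₁]
  have key : mas (L₀ := zeroCurve ε hε) (L₁ := A.curve) (instField zt) ⟨(_, t₁), hx'⟩
      ⟨(_, t₂), hy'⟩ γ₀ γ₁ = 1 + 4 * (k - k') := by
    have : (mas (L₀ := zeroCurve ε hε) (L₁ := A.curve) (instField zt) ⟨(_, t₁), hx'⟩
      ⟨(_, t₂), hy'⟩ γ₀ γ₁ : ℝ) = 1 + 4 * (k - k') := by
      rw [hmas]; push_cast; linarith
    exact_mod_cast this
  rw [key, Int.cast_add, Int.cast_mul]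
  have h4 : ((4 : ℤ) : ZMod 4) = 0 := rfl
  rw [h4, zero_mul, add_zero, Int.cast_one]

end Grading

/-! ### Existence of a map representing the class `z` -/

theorem lineDir_eq_exp (v : {v : ℂ // v ≠ 0}) : lineDir v = Circle.exp (2 * Complex.arg v) := by
  apply Subtype.ext
  have h : (‖v.1‖ : ℂ) ≠ 0 := by exact_mod_cast norm_ne_zero_iff.2 v.2
  have h2 : (lineDir v : ℂ) = v.1 ^ 2 / (‖v.1‖ : ℂ) ^ 2 := rfl
  refine h2.trans ?_
  rw [Circle.coe_exp, div_eq_iff (pow_ne_zero 2 h)]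
  conv_lhs => rw [← Complex.norm_mul_exp_arg_mul_I v.1]
  rw [mul_pow, ← Complex.exp_nat_mul, mul_comm]
  congr 2
  push_cast; ring

theorem lineDir_mul {v w : ℂ} (hv : v ≠ 0) (hw : w ≠ 0) :
    lineDir ⟨v * w, mul_ne_zero hv hw⟩ = lineDir ⟨v, hv⟩ * lineDir ⟨w, hw⟩ := by
  apply Subtype.ext
  change (v * w) ^ 2 / (‖v * w‖ : ℂ) ^ 2 = v ^ 2 / (‖v‖ : ℂ) ^ 2 * (w ^ 2 / (‖w‖ : ℂ) ^ 2)
  rw [norm_mul, mul_pow, div_mul_div_comm]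
  push_cast
  rw [mul_pow]

theorem lineDir_ofReal {a : ℝ} (ha : (a : ℂ) ≠ 0) : lineDir ⟨a, ha⟩ = 1 := by
  apply Subtype.ext
  change (a : ℂ) ^ 2 / (‖(a : ℂ)‖ : ℂ) ^ 2 = 1
  rw [Complex.norm_real, Real.norm_eq_abs]
  norm_cast
  rw [sq_abs]
  exact div_self (pow_ne_zero 2 (by exact_mod_cast ha))

/-- An odd, doubly periodic function on the plane whose zeros are the lattice points.  The indices
of its zeros are `1`, `1`, `1` and `-3`, hence all congruent to `1` mod `4`. -/
def oddFun (z : ℂ) : ℂ :=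
  (⟨Real.sin z.re, Real.sin z.im⟩ : ℂ) *
    ⟨Real.cos z.re + Real.cos z.im, Real.sin z.re * Real.sin z.im⟩

theorem continuous_oddFun : Continuous oddFun := by
  have h : oddFun = fun z : ℂ => ((Real.sin z.re : ℂ) + (Real.sin z.im : ℂ) * Complex.I) *
      (((Real.cos z.re + Real.cos z.im : ℝ) : ℂ)
        + ((Real.sin z.re * Real.sin z.im : ℝ) : ℂ) * Complex.I) := by
    ext z
    rw [oddFun, Complex.mk_eq_add_mul_I, Complex.mk_eq_add_mul_I]
  rw [h]
  fun_prop

theorem oddFun_ne_zero {z : ℂ} (hz : z ∉ Lattice) : oddFun z ≠ 0 := by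
  rw [mem_lattice_iff] at hz
  have key : Real.sin z.re = 0 → Real.sin z.im = 0 → False := fun h1 h2 => by
    obtain ⟨m, hm⟩ := Real.sin_eq_zero_iff.1 h1
    obtain ⟨n, hn⟩ := Real.sin_eq_zero_iff.1 h2
    exact hz ⟨m, n, by rw [← hm, mul_comm], by rw [← hn, mul_comm]⟩
  refine mul_ne_zero (fun h => ?_) (fun h => ?_)
  · exact key (congrArg Complex.re h) (congrArg Complex.im h)
  · have h1 : Real.cos z.re + Real.cos z.im = 0 := congrArg Complex.re h
    have h2 : Real.sin z.re * Real.sin z.im = 0 := congrArg Complex.im h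
    have h3 : Real.sin z.re ^ 2 = Real.sin z.im ^ 2 := by
      rw [Real.sin_sq, Real.sin_sq, show Real.cos z.re = -Real.cos z.im by linarith, neg_sq]
    rcases mul_eq_zero.1 h2 with h | h
    · rw [h] at h3
      exact key h (pow_eq_zero_iff two_ne_zero |>.1 (h3.symm.trans (by norm_num)))
    · rw [h] at h3
      exact key (pow_eq_zero_iff two_ne_zero |>.1 (h3.trans (by norm_num))) h

theorem oddFun_add (m n : ℤ) (z : ℂ) : oddFun (z + latticePt (2 * m) (2 * n)) = oddFun z := by
  have h : ∀ (k : ℤ) (x : ℝ), x + Real.pi * (2 * k : ℤ) = x + k * (2 * Real.pi) := fun k x => by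
    push_cast; ring
  simp only [oddFun, Complex.add_re, Complex.add_im, latticePt_re, latticePt_im, h,
    Real.sin_add_int_mul_two_pi, Real.cos_add_int_mul_two_pi]

theorem oddFun_neg (z : ℂ) : oddFun (-z) = -oddFun z := by
  simp only [oddFun, Complex.neg_re, Complex.neg_im, Real.sin_neg, Real.cos_neg]
  apply Complex.ext <;> simp <;> ring

theorem oddFun_sq_congr {z w : ℂ} (h : PillowRel z w) : oddFun z ^ 2 = oddFun w ^ 2 := by
  obtain ⟨m, n, rfl | rfl⟩ := h
  · rw [oddFun_add]
  · rw [oddFun_add, oddFun_neg, neg_sq]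

/-- The map `P* → S¹` given by the square of `oddFun`. -/
def stdZ : C(PStar, Circle) where
  toFun x := ⟨Quotient.lift (s := pillowSetoid) (fun z => oddFun z ^ 2 / (‖oddFun z‖ ^ 2 : ℝ))
      (fun z w h => by
        have h1 := oddFun_sq_congr h
        have h2 : ‖oddFun z‖ ^ 2 = ‖oddFun w‖ ^ 2 := by rw [← norm_pow, h1, norm_pow]
        simp only [h1, h2]) x.1, by
    obtain ⟨x, hx⟩ := x
    induction x using Quotient.ind with | _ z => ?_
    have hz : oddFun z ≠ 0 := oddFun_ne_zero fun h => hx ⟨z, h, rfl⟩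
    exact mem_sphere_zero_iff_norm.2 (by simp [hz])⟩
  continuous_toFun := by
    have h1 : Continuous (Quotient.lift (s := pillowSetoid) (fun z => oddFun z ^ 2)
        fun z w h => oddFun_sq_congr h) :=
      Continuous.quotient_lift (continuous_oddFun.pow 2) _
    have h2 : Continuous fun x : PStar => Quotient.lift (s := pillowSetoid) (fun z => oddFun z ^ 2)
        (fun z w h => oddFun_sq_congr h) x.1 := h1.comp continuous_subtype_val
    refine Continuous.subtype_mk ((h2.div (Complex.continuous_ofReal.comp h2.norm) ?_).congr ?_) _
    · rintro ⟨x, hx⟩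
      induction x using Quotient.ind with | _ z => ?_
      have hz : oddFun z ≠ 0 := oddFun_ne_zero fun h => hx ⟨z, h, rfl⟩
      simp [hz]
    · rintro ⟨x, hx⟩
      induction x using Quotient.ind with | _ z => ?_
      simp

theorem stdZ_apply {x : PStar} {z : ℂ} (h : (x : Pillowcase) = toP z) (hz : oddFun z ≠ 0) :
    stdZ x = lineDir ⟨oddFun z, hz⟩ := by
  obtain ⟨x, hx⟩ := x
  subst h
  apply Subtype.ext
  change oddFun z ^ 2 / ((‖oddFun z‖ ^ 2 : ℝ) : ℂ) = oddFun z ^ 2 / (‖oddFun z‖ : ℂ) ^ 2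
  push_cast; rfl

/-- The open sector of complex numbers with argument of absolute value less than `π / 4`. -/
def InSector (a : ℂ) : Prop := |a.im| < a.re

theorem InSector.conj {a : ℂ} (h : InSector a) : InSector (starRingEnd ℂ a) := by
  simpa [InSector] using h

theorem InSector.mul_re_pos {a b : ℂ} (ha : InSector a) (hb : InSector b) : 0 < (a * b).re := by
  rw [InSector, abs_lt] at ha hb
  rw [Complex.mul_re]
  nlinarith [mul_pos (sub_pos.2 ha.2) (sub_pos.2 hb.2), mul_pos (sub_pos.2 ha.1) (sub_pos.2 hb.1),
    mul_pos (sub_pos.2 ha.2) (sub_pos.2 hb.1), mul_pos (sub_pos.2 ha.1) (sub_pos.2 hb.2)]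

theorem abs_sin_sub_self_le {x : ℝ} (hx : |x| ≤ 1) : |Real.sin x - x| ≤ |x| ^ 3 / 4 := by
  have h := Real.sin_bound hx
  have h0 := abs_nonneg x
  have h1 : |x| ^ 5 ≤ |x| ^ 3 := pow_le_pow_of_le_one h0 hx (by norm_num)
  have h2 : |Real.sin x - x| ≤ |Real.sin x - (x - x ^ 3 / 6)| + |x ^ 3 / 6| := by
    rw [show Real.sin x - x = (Real.sin x - (x - x ^ 3 / 6)) - x ^ 3 / 6 by ring]
    exact abs_sub _ _
  have h3 : |x ^ 3 / 6| = |x| ^ 3 / 6 := by rw [abs_div, abs_pow]; norm_num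
  have h4 : 0 ≤ |x| ^ 3 := by positivity
  rw [h3] at h2
  linarith

section Local

variable {x y : ℝ} (hx : |x| ≤ 1) (hy : |y| ≤ 1)

include hx hy

theorem inSector_sin (h0 : 0 < x ^ 2 + y ^ 2) :
    InSector ((⟨Real.sin x, Real.sin y⟩ : ℂ) * ⟨x, -y⟩) := by
  obtain ⟨u, hu⟩ : ∃ u, Real.sin x = x + u := ⟨Real.sin x - x, by ring⟩
  obtain ⟨v, hv⟩ : ∃ v, Real.sin y = y + v := ⟨Real.sin y - y, by ring⟩
  have hu1 : |u| ≤ |x| / 4 := by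
    have h := abs_sin_sub_self_le hx
    rw [hu, add_sub_cancel_left] at h
    have := pow_le_pow_of_le_one (abs_nonneg x) hx (show 1 ≤ 3 by norm_num)
    linarith
  have hv1 : |v| ≤ |y| / 4 := by
    have h := abs_sin_sub_self_le hy
    rw [hv, add_sub_cancel_left] at h
    have := pow_le_pow_of_le_one (abs_nonneg y) hy (show 1 ≤ 3 by norm_num)
    linarith
  have b1 : |x * u| ≤ |x| * (|x| / 4) := by rw [abs_mul]; gcongr
  have b2 : |y * v| ≤ |y| * (|y| / 4) := by rw [abs_mul]; gcongr
  have b3 : |x * v| ≤ |x| * (|y| / 4) := by rw [abs_mul]; gcongr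
  have b4 : |y * u| ≤ |y| * (|x| / 4) := by rw [abs_mul]; gcongr
  rw [InSector, hu, hv, Complex.mul_re, Complex.mul_im, abs_lt]
  rw [abs_le] at b1 b2 b3 b4
  have e1 := sq_abs x
  have e2 := sq_abs y
  have e3 := sq_nonneg (|x| - |y|)
  constructor <;> nlinarith

theorem inSector_cos_add :
    InSector ⟨Real.cos x + Real.cos y, Real.sin x * Real.sin y⟩ := by
  have h : ∀ {x : ℝ}, |x| ≤ 1 → 1 / 2 < Real.cos x := fun {x} hx => by
    rw [← Real.cos_abs, ← Real.cos_pi_div_three]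
    have hp := Real.pi_gt_three
    exact Real.cos_lt_cos_of_nonneg_of_le_pi_div_two (abs_nonneg x) (by linarith) (by linarith)
  have h1 := h hx
  have h2 := h hy
  rw [InSector]
  have h3 : |Real.sin x * Real.sin y| ≤ 1 := by
    rw [abs_mul]
    exact mul_le_one₀ (Real.abs_sin_le_one x) (abs_nonneg _) (Real.abs_sin_le_one y)
  change |Real.sin x * Real.sin y| < Real.cos x + Real.cos y
  linarith

theorem inSector_cos_sub (h0 : 0 < x ^ 2 + y ^ 2) (h1 : x ^ 2 + y ^ 2 < 1 / 2) :
    InSector ((⟨Real.cos x - Real.cos y, -(Real.sin x * Real.sin y)⟩ : ℂ)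
      * ⟨-(x ^ 2 - y ^ 2), 2 * x * y⟩) := by
  obtain ⟨d, hd⟩ : ∃ d, Real.cos x - Real.cos y = -(x ^ 2 - y ^ 2) / 2 + d :=
    ⟨Real.cos x - Real.cos y + (x ^ 2 - y ^ 2) / 2, by ring⟩
  obtain ⟨e, he⟩ : ∃ e, Real.sin x * Real.sin y = x * y + e :=
    ⟨Real.sin x * Real.sin y - x * y, by ring⟩
  set ρ := x ^ 2 + y ^ 2 with hρ
  have hd1 : |d| ≤ ρ ^ 2 / 4 := by
    have c1 := abs_le.1 (Real.cos_bound hx)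
    have c2 := abs_le.1 (Real.cos_bound hy)
    have e1 : |x| ^ 4 = x ^ 4 := by rw [show (4 : ℕ) = 2 * 2 by norm_num, pow_mul, pow_mul, sq_abs]
    have e2 : |y| ^ 4 = y ^ 4 := by rw [show (4 : ℕ) = 2 * 2 by norm_num, pow_mul, pow_mul, sq_abs]
    rw [e1] at c1
    rw [e2] at c2
    have e3 : x ^ 4 + y ^ 4 ≤ ρ ^ 2 := by rw [hρ]; nlinarith [mul_nonneg (sq_nonneg x) (sq_nonneg y)]
    have e4 : 0 ≤ x ^ 4 := by positivity
    have e5 : 0 ≤ y ^ 4 := by positivity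
    rw [abs_le]
    constructor <;> linarith
  have he1 : |e| ≤ ρ ^ 2 / 4 := by
    obtain ⟨u, hu⟩ : ∃ u, Real.sin x = x + u := ⟨Real.sin x - x, by ring⟩
    obtain ⟨v, hv⟩ : ∃ v, Real.sin y = y + v := ⟨Real.sin y - y, by ring⟩
    have hu1 := abs_sin_sub_self_le hx
    have hv1 := abs_sin_sub_self_le hy
    rw [hu, add_sub_cancel_left] at hu1
    rw [hv, add_sub_cancel_left] at hv1
    have hee : e = x * v + y * u + u * v := by rw [hu, hv] at he; linarith
    have b0 : |e| ≤ |x * v| + |y * u| + |u * v| := by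
      rw [hee]
      exact (abs_add_le _ _).trans (by gcongr; exact abs_add_le _ _)
    have b1 : |x * v| ≤ |x| * (|y| ^ 3 / 4) := by rw [abs_mul]; gcongr
    have b2 : |y * u| ≤ |y| * (|x| ^ 3 / 4) := by rw [abs_mul]; gcongr
    have b3 : |u * v| ≤ |x| ^ 3 / 4 * (|y| ^ 3 / 4) := by rw [abs_mul]; gcongr
    have hxy : |x| * |y| ≤ ρ / 2 := by
      rw [hρ, ← sq_abs x, ← sq_abs y]; nlinarith [sq_nonneg (|x| - |y|)]
    have hxy0 : 0 ≤ |x| * |y| := by positivity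
    have b4 : |x| * (|y| ^ 3 / 4) + |y| * (|x| ^ 3 / 4) = |x| * |y| * ρ / 4 := by
      rw [hρ, ← sq_abs x, ← sq_abs y]; ring
    have b5 : |x| ^ 3 / 4 * (|y| ^ 3 / 4) = (|x| * |y|) ^ 3 / 16 := by ring
    have b6 : (|x| * |y|) ^ 3 ≤ (ρ / 2) ^ 3 := by gcongr
    have b7 : |x| * |y| * ρ ≤ ρ / 2 * ρ := by gcongr
    have b8 : ρ ^ 3 ≤ ρ ^ 2 := pow_le_pow_of_le_one h0.le (by linarith) (by norm_num)
    nlinarith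
  have s1 : |x ^ 2 - y ^ 2| ≤ ρ := by rw [abs_le]; constructor <;> nlinarith [sq_nonneg x, sq_nonneg y]
  have s2 : |2 * x * y| ≤ ρ := by
    rw [abs_le]; constructor <;> nlinarith [sq_nonneg (x - y), sq_nonneg (x + y)]
  have p1 : |d * (x ^ 2 - y ^ 2)| ≤ ρ ^ 2 / 4 * ρ := by rw [abs_mul]; gcongr
  have p2 : |d * (2 * x * y)| ≤ ρ ^ 2 / 4 * ρ := by rw [abs_mul]; gcongr
  have p3 : |e * (x ^ 2 - y ^ 2)| ≤ ρ ^ 2 / 4 * ρ := by rw [abs_mul]; gcongr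
  have p4 : |e * (2 * x * y)| ≤ ρ ^ 2 / 4 * ρ := by rw [abs_mul]; gcongr
  have p5 : ρ ^ 2 * ρ < ρ ^ 2 * (1 / 2) := by gcongr
  rw [abs_le] at p1 p2 p3 p4
  have hre : ((⟨Real.cos x - Real.cos y, -(Real.sin x * Real.sin y)⟩ : ℂ)
      * ⟨-(x ^ 2 - y ^ 2), 2 * x * y⟩).re
      = ρ ^ 2 / 2 - d * (x ^ 2 - y ^ 2) + e * (2 * x * y) := by
    rw [Complex.mul_re, hd, he, hρ]; ring
  have him : ((⟨Real.cos x - Real.cos y, -(Real.sin x * Real.sin y)⟩ : ℂ)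
      * ⟨-(x ^ 2 - y ^ 2), 2 * x * y⟩).im = d * (2 * x * y) + e * (x ^ 2 - y ^ 2) := by
    rw [Complex.mul_im, hd, he]; ring
  rw [InSector, hre, him, abs_lt]
  constructor <;> linarith

end Local

/-- If, along the half circle around a lattice point, `oddFun` differs by a factor in the right half
plane from a path of argument `κ π t`, then the value of the class is `κ`. -/
theorem degree_stdZ {m n κ : ℤ} {r C : ℝ}
    (hpos : ∀ t : I, 0 < (oddFun (latticePt m n
        + r * Complex.exp (((Real.pi * (t : ℝ) : ℝ) : ℂ) * Complex.I))
      * (C * Complex.exp (((-(κ * Real.pi * (t : ℝ)) : ℝ) : ℂ) * Complex.I))).re)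
    (hκ : Odd κ) {α : C(I, PStar)}
    (hα : ∀ t : I, (α t : Pillowcase) =
      toP (latticePt m n + r * Complex.exp (((Real.pi * (t : ℝ) : ℝ) : ℂ) * Complex.I))) :
    degree (stdZ.comp α) = κ := by
  have hp := Real.pi_pos
  set e : I → ℂ := fun t => latticePt m n
    + r * Complex.exp (((Real.pi * (t : ℝ) : ℝ) : ℂ) * Complex.I) with he
  set f : I → ℂ := fun t => Complex.exp (((-(κ * Real.pi * (t : ℝ)) : ℝ) : ℂ) * Complex.I) with hf
  set Q : I → ℂ := fun t => oddFun (e t) * (C * f t) with hQ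
  have hQc : Continuous Q := by
    have h1 : Continuous e := by fun_prop
    have h2 : Continuous f := by fun_prop
    exact (continuous_oddFun.comp h1).mul (continuous_const.mul h2)
  have hQpos : ∀ t, 0 < (Q t).re := hpos
  have hQ0 : ∀ t, Q t ≠ 0 := fun t h => by simpa [h] using hQpos t
  have hne : ∀ t, oddFun (e t) ≠ 0 := fun t h => hQ0 t (by simp [hQ, h])
  have hC : (C : ℂ) ≠ 0 := fun h => hQ0 0 (by simp [hQ, h])
  have hf0 : ∀ t, f t ≠ 0 := fun t => Complex.exp_ne_zero _
  have hodd : oddFun (e 1) = -oddFun (e 0) := by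
    have h1 : e 1 = -e 0 + latticePt (2 * m) (2 * n) := by
      rw [show 2 * m = m + m by ring, show 2 * n = n + n by ring, ← latticePt_add]
      simp only [he, Icc.coe_one, Icc.coe_zero, mul_one, mul_zero, Complex.ofReal_zero, zero_mul,
        Complex.exp_zero, Complex.exp_pi_mul_I]
      ring
    rw [h1, oddFun_add, oddFun_neg]
  have hf1 : f 1 = -f 0 := by
    obtain ⟨j, rfl⟩ := hκ
    simp only [hf, Icc.coe_one, Icc.coe_zero, mul_one, mul_zero, neg_zero, Complex.ofReal_zero,
      zero_mul, Complex.exp_zero]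
    have : (((-((2 * j + 1 : ℤ) * Real.pi) : ℝ) : ℂ) * Complex.I)
        = -(Real.pi * Complex.I) + (-j : ℤ) * (2 * Real.pi * Complex.I) := by push_cast; ring
    rw [this, Complex.exp_add, Complex.exp_int_mul_two_pi_mul_I, mul_one, Complex.exp_neg,
      Complex.exp_pi_mul_I, inv_neg, inv_one]
  have hQ1 : Q 1 = Q 0 := by simp only [hQ, hodd, hf1]; ring
  have hloop : (stdZ.comp α) 0 = (stdZ.comp α) 1 := by
    rw [ContinuousMap.comp_apply, ContinuousMap.comp_apply, stdZ_apply (hα 0) (hne 0),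
      stdZ_apply (hα 1) (hne 1)]
    apply Subtype.ext
    change oddFun (e 0) ^ 2 / (‖oddFun (e 0)‖ : ℂ) ^ 2 = oddFun (e 1) ^ 2 / (‖oddFun (e 1)‖ : ℂ) ^ 2
    rw [hodd, neg_sq, norm_neg]
  have hdeg := degree_eq_turns_of_loop hloop
  have hfdir : ∀ t : I, lineDir ⟨f t, hf0 t⟩ = Circle.exp (2 * -(κ * Real.pi * t)) := fun t => by
    apply Subtype.ext
    change f t ^ 2 / (‖f t‖ : ℂ) ^ 2 = _
    rw [hf]
    beta_reduce
    rw [Complex.norm_exp_ofReal_mul_I, Complex.ofReal_one, one_pow, div_one, ← Complex.exp_nat_mul,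
      Circle.coe_exp]
    congr 1
    push_cast; ring
  rw [turns_eq (g := fun t : I => κ * (t : ℝ) + Complex.arg (Q t) / Real.pi) ?_ (fun t => ?_)] at hdeg
  · simp only [hQ1, Icc.coe_one, Icc.coe_zero, mul_one, mul_zero] at hdeg
    have : (degree (stdZ.comp α) : ℝ) = κ := by rw [hdeg]; ring
    exact_mod_cast this
  · refine (by fun_prop : Continuous fun t : I => κ * (t : ℝ)).add (Continuous.div_const ?_ _)
    exact continuous_iff_continuousAt.2 fun t =>
      (Complex.continuousAt_arg (Or.inl (hQpos t))).comp hQc.continuousAt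
  · rw [ContinuousMap.comp_apply, stdZ_apply (hα t) (hne t), mul_add, Circle.exp_add,
      show 2 * Real.pi * (Complex.arg (Q t) / Real.pi) = 2 * Complex.arg (Q t) by field_simp,
      ← lineDir_eq_exp ⟨Q t, hQ0 t⟩]
    have h1 := lineDir_mul (hne t) (mul_ne_zero hC (hf0 t))
    rw [lineDir_mul hC (hf0 t), lineDir_ofReal, one_mul, hfdir] at h1
    change _ * lineDir ⟨oddFun (e t) * (C * f t), _⟩ = _
    rw [h1, mul_left_comm, ← Circle.exp_add]
    convert mul_one _ using 2
    rw [← Circle.exp_zero]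
    congr 1
    ring

theorem sin_pi_mul_add (k : ℤ) (x : ℝ) :
    Real.sin (Real.pi * k + x) = (-1 : ℝ) ^ k * Real.sin x := by
  rw [add_comm, mul_comm, Real.sin_add_int_mul_pi]

theorem cos_pi_mul_add (k : ℤ) (x : ℝ) :
    Real.cos (Real.pi * k + x) = (-1 : ℝ) ^ k * Real.cos x := by
  rw [add_comm, mul_comm, Real.cos_add_int_mul_pi]

theorem stdZ_liftsZ : LiftsZ stdZ := by
  intro m n
  filter_upwards [Ioo_mem_nhdsGT (show (0 : ℝ) < 1 / 2 by norm_num)] with r hr α hα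
  have hE : ∀ t : I, (r : ℂ) * Complex.exp (((Real.pi * (t : ℝ) : ℝ) : ℂ) * Complex.I)
      = ⟨r * Real.cos (Real.pi * t), r * Real.sin (Real.pi * t)⟩ := fun t => by
    rw [Complex.ext_iff, Complex.re_ofReal_mul, Complex.im_ofReal_mul, Complex.exp_ofReal_mul_I_re,
      Complex.exp_ofReal_mul_I_im]
    exact ⟨rfl, rfl⟩
  -- the local form of `oddFun` at a lattice point, according to the parity of its coordinates
  have hodd : ∀ x y : ℝ, oddFun (latticePt m n + ⟨x, y⟩)
      = ⟨(-1 : ℝ) ^ m * Real.sin x, (-1 : ℝ) ^ n * Real.sin y⟩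
        * ⟨(-1 : ℝ) ^ m * Real.cos x + (-1 : ℝ) ^ n * Real.cos y,
          (-1 : ℝ) ^ m * Real.sin x * ((-1 : ℝ) ^ n * Real.sin y)⟩ := fun x y => by
    simp only [oddFun, Complex.add_re, Complex.add_im, latticePt_re, latticePt_im, sin_pi_mul_add,
      cos_pi_mul_add]
  have hb : ∀ t : I, ∃ x y : ℝ, r * Real.cos (Real.pi * t) = x ∧ r * Real.sin (Real.pi * t) = y ∧
      |x| ≤ 1 ∧ |y| ≤ 1 ∧ 0 < x ^ 2 + y ^ 2 ∧ x ^ 2 + y ^ 2 < 1 / 2 := fun t => by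
    refine ⟨_, _, rfl, rfl, ?_, ?_, ?_⟩
    · rw [abs_mul, abs_of_pos hr.1]
      nlinarith [Real.abs_cos_le_one (Real.pi * t), abs_nonneg (Real.cos (Real.pi * t)), hr.1, hr.2]
    · rw [abs_mul, abs_of_pos hr.1]
      nlinarith [Real.abs_sin_le_one (Real.pi * t), abs_nonneg (Real.sin (Real.pi * t)), hr.1, hr.2]
    · have : (r * Real.cos (Real.pi * t)) ^ 2 + (r * Real.sin (Real.pi * t)) ^ 2 = r ^ 2 := by
        nlinarith [Real.sin_sq_add_cos_sq (Real.pi * t)]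
      rw [this]
      constructor <;> nlinarith [hr.1, hr.2]
  -- the model with index one
  have hone : ∀ t : I, (r : ℂ) * Complex.exp (((-(((1 : ℤ) : ℝ) * Real.pi * (t : ℝ)) : ℝ) : ℂ)
      * Complex.I) = ⟨r * Real.cos (Real.pi * t), -(r * Real.sin (Real.pi * t))⟩ := fun t => by
    rw [Complex.ext_iff, Complex.re_ofReal_mul, Complex.im_ofReal_mul, Complex.exp_ofReal_mul_I_re,
      Complex.exp_ofReal_mul_I_im]
    constructor <;> simp
  have hdeg : ∃ κ : ℤ, degree (stdZ.comp α) = κ ∧ (κ = 1 ∨ κ = -3) := by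
    rcases Int.even_or_odd m with hm | hm <;> rcases Int.even_or_odd n with hn | hn <;>
      rw [hm.neg_one_zpow, hn.neg_one_zpow] at hodd
    · refine ⟨1, degree_stdZ (C := r) (fun t => ?_) odd_one hα, Or.inl rfl⟩
      rw [hone, hE, hodd]
      obtain ⟨x, y, hx, hy, h1, h2, h3, h4⟩ := hb t
      rw [hx, hy]
      convert (inSector_sin h1 h2 h3).mul_re_pos (inSector_cos_add h1 h2) using 2
      apply Complex.ext <;> simp <;> ring
    · refine ⟨1, degree_stdZ (C := -r ^ 3) (fun t => ?_) odd_one hα, Or.inl rfl⟩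
      rw [show ((-r ^ 3 : ℝ) : ℂ) = ((-r ^ 2 : ℝ) : ℂ) * r by push_cast; ring, mul_assoc, hone, hE,
        hodd]
      obtain ⟨x, y, hx, hy, h1, h2, h3, h4⟩ := hb t
      have hr2 : r ^ 2 = x ^ 2 + y ^ 2 := by
        rw [← hx, ← hy]; nlinarith [Real.sin_sq_add_cos_sq (Real.pi * t)]
      rw [hx, hy, hr2]
      convert (inSector_sin h1 h2 h3).conj.mul_re_pos (inSector_cos_sub h1 h2 h3 h4) using 2
      apply Complex.ext <;> simp [-Complex.ofReal_add, -Complex.ofReal_pow, -Complex.ofReal_neg] <;>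
        ring
    · refine ⟨-3, degree_stdZ (C := -r ^ 3) (fun t => ?_) (by decide) hα, Or.inr rfl⟩
      have h3 : ((-r ^ 3 : ℝ) : ℂ) * Complex.exp (((-(((-3 : ℤ) : ℝ) * Real.pi * (t : ℝ)) : ℝ) : ℂ)
          * Complex.I) = -(r * Complex.exp (((Real.pi * (t : ℝ) : ℝ) : ℂ) * Complex.I)) ^ 3 := by
        rw [mul_pow, ← Complex.exp_nat_mul]
        push_cast
        rw [neg_mul]
        congr 3
        ring
      rw [h3, hE, hodd]
      obtain ⟨x, y, hx, hy, h1, h2, h3, h4⟩ := hb t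
      rw [hx, hy]
      convert (inSector_sin h1 h2 h3).conj.mul_re_pos (inSector_cos_sub h1 h2 h3 h4).conj using 2
      apply Complex.ext <;> simp [pow_succ] <;> ring
    · refine ⟨1, degree_stdZ (C := r) (fun t => ?_) odd_one hα, Or.inl rfl⟩
      rw [hone, hE, hodd]
      obtain ⟨x, y, hx, hy, h1, h2, h3, h4⟩ := hb t
      rw [hx, hy]
      convert (inSector_sin h1 h2 h3).mul_re_pos (inSector_cos_add h1 h2).conj using 2
      apply Complex.ext <;> simp <;> ring
  obtain ⟨κ, h1, rfl | rfl⟩ := hdeg <;> rw [h1] <;> rfl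

/-! ### The pillowcase as a character variety -/

theorem pillowRel_of_cos {z w : ℂ} (h1 : Real.cos z.re = Real.cos w.re)
    (h2 : Real.cos z.im = Real.cos w.im)
    (h3 : Real.cos (z.re - z.im) = Real.cos (w.re - w.im)) : PillowRel z w := by
  have key : ∀ m n : ℤ, (w.re = 2 * m * Real.pi + z.re ∧ w.im = 2 * n * Real.pi + z.im) ∨
      (w.re = 2 * m * Real.pi - z.re ∧ w.im = 2 * n * Real.pi - z.im) → PillowRel z w := by
    rintro m n (⟨a, b⟩ | ⟨a, b⟩)
    · refine ⟨m, n, Or.inl (Complex.ext ?_ ?_)⟩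
      · rw [Complex.add_re, latticePt_re, a]; push_cast; ring
      · rw [Complex.add_im, latticePt_im, b]; push_cast; ring
    · refine ⟨m, n, Or.inr (Complex.ext ?_ ?_)⟩
      · rw [Complex.add_re, latticePt_re, a, Complex.neg_re]; push_cast; ring
      · rw [Complex.add_im, latticePt_im, b, Complex.neg_im]; push_cast; ring
  have hs : Real.cos (z.re + z.im) = Real.cos (z.re - z.im) → Real.sin z.re = 0 ∨ Real.sin z.im = 0 :=
    fun h => by
      rw [Real.cos_add, Real.cos_sub] at h
      exact mul_eq_zero.1 (by linarith)
  obtain ⟨m, hm⟩ := Real.cos_eq_cos_iff.1 h1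
  obtain ⟨n, hn⟩ := Real.cos_eq_cos_iff.1 h2
  -- if the two signs differ then one of the sines vanishes, so that one of them can be changed
  rcases hm with hm | hm <;> rcases hn with hn | hn
  · exact key m n (Or.inl ⟨hm, hn⟩)
  · have h4 : Real.cos (w.re - w.im) = Real.cos (z.re + z.im) := by
      rw [hm, hn, show 2 * m * Real.pi + z.re - (2 * n * Real.pi - z.im)
        = z.re + z.im + (m - n : ℤ) * (2 * Real.pi) by push_cast; ring,
        Real.cos_add_int_mul_two_pi]
    rcases hs (by rw [← h4, h3]) with h | h <;> obtain ⟨a, ha⟩ := Real.sin_eq_zero_iff.1 h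
    · exact key (m + a) n (Or.inr ⟨by rw [hm]; push_cast; linarith, hn⟩)
    · exact key m (n - a) (Or.inl ⟨hm, by rw [hn]; push_cast; linarith⟩)
  · have h4 : Real.cos (w.re - w.im) = Real.cos (z.re + z.im) := by
      rw [hm, hn, show 2 * m * Real.pi - z.re - (2 * n * Real.pi + z.im)
        = -(z.re + z.im) + (m - n : ℤ) * (2 * Real.pi) by push_cast; ring,
        Real.cos_add_int_mul_two_pi, Real.cos_neg]
    rcases hs (by rw [← h4, h3]) with h | h <;> obtain ⟨a, ha⟩ := Real.sin_eq_zero_iff.1 h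
    · exact key (m - a) n (Or.inl ⟨by rw [hm]; push_cast; linarith, hn⟩)
    · exact key m (n + a) (Or.inr ⟨hm, by rw [hn]; push_cast; linarith⟩)
  · exact key m n (Or.inr ⟨hm, hn⟩)

theorem cos_of_pillowRel {z w : ℂ} (h : PillowRel z w) : Real.cos z.re = Real.cos w.re ∧
    Real.cos z.im = Real.cos w.im ∧ Real.cos (z.re - z.im) = Real.cos (w.re - w.im) := by
  obtain ⟨m, n, rfl | rfl⟩ := h
  · simp only [Complex.add_re, Complex.add_im, latticePt_re, latticePt_im]
    refine ⟨?_, ?_, ?_⟩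
    · rw [← Real.cos_add_int_mul_two_pi z.re m]; congr 1; push_cast; ring
    · rw [← Real.cos_add_int_mul_two_pi z.im n]; congr 1; push_cast; ring
    · rw [← Real.cos_add_int_mul_two_pi (z.re - z.im) (m - n)]; congr 1; push_cast; ring
  · simp only [Complex.add_re, Complex.add_im, latticePt_re, latticePt_im, Complex.neg_re,
      Complex.neg_im]
    refine ⟨?_, ?_, ?_⟩
    · rw [← Real.cos_neg z.re, ← Real.cos_add_int_mul_two_pi _ m]; congr 1; push_cast; ring
    · rw [← Real.cos_neg z.im, ← Real.cos_add_int_mul_two_pi _ n]; congr 1; push_cast; ring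
    · rw [← Real.cos_neg (z.re - z.im), ← Real.cos_add_int_mul_two_pi _ (m - n)]
      congr 1; push_cast; ring

/-- The cosines of the three angle differences embed the pillowcase in `ℝ³`. -/
instance : T2Space Pillowcase := by
  let F : Pillowcase → ℝ × ℝ × ℝ := Quotient.lift (s := pillowSetoid)
    (fun z => (Real.cos z.re, Real.cos z.im, Real.cos (z.re - z.im))) fun z w h => by
      obtain ⟨h1, h2, h3⟩ := cos_of_pillowRel h
      rw [h1, h2, h3]
  have hF : Continuous F := Continuous.quotient_lift (by fun_prop) _
  refine T2Space.of_injective_continuous (f := F) (fun x y h => ?_) hF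
  induction x using Quotient.ind with | _ z => ?_
  induction y using Quotient.ind with | _ w => ?_
  simp only [F, Quotient.lift_mk, Prod.mk.injEq] at h
  exact Quotient.sound (s := pillowSetoid) (pillowRel_of_cos h.1 h.2.1 h.2.2)

theorem SU2.re_conj (s x : SU2) : ((s * x * s⁻¹ : SU2) : ℍ[ℝ]).re = (x : ℍ[ℝ]).re := by
  have h : ∀ a b : SU2, ((a * b : SU2) : ℍ[ℝ]).re = ((b * a : SU2) : ℍ[ℝ]).re := fun a b => by
    rw [Submonoid.coe_mul, Submonoid.coe_mul, Quaternion.re_mul, Quaternion.re_mul]; ring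
  rw [h, inv_mul_cancel_left]

/-- A nonzero quaternion which intertwines `x` and `y` can be normalised to a conjugating element
of `SU(2)`. -/
theorem SU2.exists_conj {x y : SU2} {q : ℍ[ℝ]} (hq : q ≠ 0)
    (h : q * (x : ℍ[ℝ]) = (y : ℍ[ℝ]) * q) : ∃ s : SU2, s = ‖q‖⁻¹ • q ∧ s * x * s⁻¹ = y := by
  have hn : ‖q‖ ≠ 0 := norm_ne_zero_iff.2 hq
  have hs : ‖q‖⁻¹ • q ∈ unitary ℍ[ℝ] := by
    have h1 : Quaternion.normSq q = ‖q‖ * ‖q‖ := Quaternion.normSq_eq_norm_mul_self q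
    have h2 : (‖q‖⁻¹ * ‖q‖⁻¹) * (‖q‖ * ‖q‖) = 1 := by field_simp
    refine Unitary.mem_iff.2 ⟨?_, ?_⟩
    · rw [Quaternion.star_smul, smul_mul_smul_comm, Quaternion.star_mul_self, h1,
        ← Quaternion.coe_smul, smul_eq_mul, h2, Quaternion.coe_one]
    · rw [Quaternion.star_smul, smul_mul_smul_comm, Quaternion.self_mul_star, h1,
        ← Quaternion.coe_smul, smul_eq_mul, h2, Quaternion.coe_one]
  refine ⟨⟨_, hs⟩, rfl, mul_inv_eq_of_eq_mul (Subtype.ext ?_)⟩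
  rw [Submonoid.coe_mul, Submonoid.coe_mul]
  change ‖q‖⁻¹ • q * (x : ℍ[ℝ]) = (y : ℍ[ℝ]) * ‖q‖⁻¹ • q
  rw [smul_mul_assoc, h, mul_smul_comm]

theorem SU2.normSq_eq_one (x : SU2) : (x : ℍ[ℝ]).re ^ 2 + (x : ℍ[ℝ]).imI ^ 2 + (x : ℍ[ℝ]).imJ ^ 2
    + (x : ℍ[ℝ]).imK ^ 2 = 1 := by
  have h1 := congrArg QuaternionAlgebra.re (Unitary.mem_iff.1 x.2).1
  rw [Quaternion.re_mul] at h1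
  simp only [Quaternion.re_star, Quaternion.imI_star, Quaternion.imJ_star, Quaternion.imK_star,
    Quaternion.re_one] at h1
  linarith

theorem rot_conj (α β : ℝ) : rot α * rot β * (rot α)⁻¹ = rot (2 * α - β) := by
  rw [rot_inv]
  apply Subtype.ext
  change rotQ α * rotQ β * -rotQ α = rotQ (2 * α - β)
  have h := Real.sin_sq_add_cos_sq α
  ext
  · simp
  · simp [Real.cos_sub, Real.sin_two_mul, Real.cos_two_mul]
    linear_combination (-Real.cos β) * h
  · simp [Real.sin_sub, Real.sin_two_mul, Real.cos_two_mul]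
    linear_combination Real.sin β * h
  · simp

theorem rot_conj_inv (α β : ℝ) : (rot α)⁻¹ * rot β * rot α = rot (2 * α - β) := by
  have h := rot_conj α β
  rw [rot_inv] at h ⊢
  rw [← h]
  apply Subtype.ext
  change -rotQ α * rotQ β * rotQ α = rotQ α * rotQ β * -rotQ α
  rw [neg_mul, neg_mul, mul_neg]

theorem rot_zpow_conj (α β : ℝ) (d e : ℤˣ) :
    rot α ^ (d : ℤ) * rot β ^ (e : ℤ) * (rot α ^ (d : ℤ))⁻¹ = rot (2 * α - β) ^ (e : ℤ) := by
  rw [← conj_zpow]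
  congr 1
  rcases Int.units_eq_one_or d with rfl | rfl
  · simpa using rot_conj α β
  · simpa using rot_conj_inv α β

theorem rot_zpow_conj_inv (α β : ℝ) (d e : ℤˣ) :
    (rot α ^ (d : ℤ))⁻¹ * rot β ^ (e : ℤ) * rot α ^ (d : ℤ) = rot (2 * α - β) ^ (e : ℤ) := by
  have h := rot_zpow_conj α β (-d) e
  simpa using h

theorem rot_mul_re (α β : ℝ) : ((rot α * rot β : SU2) : ℍ[ℝ]).re = -Real.cos (α - β) := by
  change (rotQ α * rotQ β).re = _
  rw [Quaternion.re_mul, Real.cos_sub]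
  simp; ring

theorem rot_add_two_pi (α : ℝ) (n : ℤ) : rot (α + n * (2 * Real.pi)) = rot α := by
  apply Subtype.ext
  change rotQ _ = rotQ _
  simp only [rotQ, Real.cos_add_int_mul_two_pi, Real.sin_add_int_mul_two_pi]
  rfl

/-- Rotations about the axis `k` act simply transitively on the quaternions `rot α`. -/
theorem exists_rot_shift (φ : ℝ) : ∃ s : SU2, ∀ α, s * rot α * s⁻¹ = rot (α + φ) := by
  -- the product of the two half turns about `rot 0` and `rot (φ / 2)`
  refine ⟨rot (φ / 2) * rot 0, fun α => ?_⟩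
  have : rot (φ / 2) * rot 0 * rot α * (rot (φ / 2) * rot 0)⁻¹
      = rot (φ / 2) * (rot 0 * rot α * (rot 0)⁻¹) * (rot (φ / 2))⁻¹ := by group
  rw [this, rot_conj, rot_conj]
  congr 1
  ring

theorem units_zpow_zpow {G : Type*} [Group G] (x : G) (e : ℤˣ) :
    (x ^ (e : ℤ)) ^ (e : ℤ) = x := by
  rw [← zpow_mul, ← Units.val_mul, Int.units_mul_self, Units.val_one, zpow_one]

section Psi

variable {w : List Crossing} (o : LinkOrientation w)

theorem sphereGroup_hom_ext {f g : SphereGroup →* SU2}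
    (h : ∀ j, f (sphereMer j) = g (sphereMer j)) : f = g :=
  PresentedGroup.ext h

theorem psi_eq_psi_iff {z z' : ℂ} : psi o z = psi o z' ↔ PillowRel z z' := by
  constructor
  · intro h
    obtain ⟨s, hs⟩ := Quotient.exact h
    have key : ∀ i j, Real.cos (psiAngle z i - psiAngle z j)
        = Real.cos (psiAngle z' i - psiAngle z' j) := fun i j => by
      have h1 := congrArg (fun x : SU2 => (x : ℍ[ℝ]).re) (hs (sphereMer i ^
        (o.sign (Fin.last _) i : ℤ) * sphereMer j ^ (o.sign (Fin.last _) j : ℤ)))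
      beta_reduce at h1
      rw [SU2.re_conj] at h1
      simp only [map_mul, map_zpow, sphereMer, PresentedGroup.toGroup.of, units_zpow_zpow,
        rot_mul_re] at h1
      linarith
    refine pillowRel_of_cos ?_ ?_ ?_
    · simpa [psiAngle] using key 1 0
    · simpa [psiAngle] using key 2 0
    · simpa [psiAngle] using key 1 2
  · rintro ⟨m, n, h⟩
    refine Quotient.sound (s := repSetoid sphereMer) ?_
    rcases h with rfl | rfl
    · refine ⟨1, fun g => ?_⟩
      rw [one_mul, inv_one, mul_one]
      refine DFunLike.congr_fun (sphereGroup_hom_ext fun j => ?_) g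
      simp only [sphereMer, PresentedGroup.toGroup.of]
      congr 1
      obtain ⟨k, hk⟩ : ∃ k : ℤ, psiAngle (z + latticePt (2 * m) (2 * n)) j
          = psiAngle z j + k * (2 * Real.pi) := by
        fin_cases j
        · exact ⟨0, by simp [psiAngle]⟩
        · exact ⟨m, by simp [psiAngle, latticePt_re]; ring⟩
        · exact ⟨n, by simp [psiAngle, latticePt_im]; ring⟩
        · exact ⟨n - m, by simp [psiAngle, latticePt_re, latticePt_im]; ring⟩
      rw [hk, rot_add_two_pi]
    · refine ⟨rot 0, fun g => ?_⟩
      refine DFunLike.congr_fun (g := (MulAut.conj (rot 0)).toMonoidHom.comp _)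
        (sphereGroup_hom_ext fun j => ?_) g
      simp only [sphereMer, PresentedGroup.toGroup.of, MonoidHom.comp_apply,
        MulEquiv.toMonoidHom_eq_coe, MonoidHom.coe_coe, map_zpow, MulAut.conj_apply, rot_conj]
      congr 1
      obtain ⟨k, hk⟩ : ∃ k : ℤ, psiAngle (-z + latticePt (2 * m) (2 * n)) j
          = 2 * 0 - psiAngle z j + k * (2 * Real.pi) := by
        fin_cases j
        · exact ⟨0, by simp [psiAngle]⟩
        · exact ⟨m, by simp [psiAngle, latticePt_re]; ring⟩
        · exact ⟨n, by simp [psiAngle, latticePt_im]; ring⟩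
        · exact ⟨n - m, by simp [psiAngle, latticePt_re, latticePt_im]; ring⟩
      rw [hk, rot_add_two_pi]

end Psi

/-- The quaternion with the given coordinates. -/
def quat (a b c d : ℝ) : ℍ[ℝ] := ⟨a, b, c, d⟩

@[simp] theorem quat_re (a b c d : ℝ) : (quat a b c d).re = a := rfl
@[simp] theorem quat_imI (a b c d : ℝ) : (quat a b c d).imI = b := rfl
@[simp] theorem quat_imJ (a b c d : ℝ) : (quat a b c d).imJ = c := rfl
@[simp] theorem quat_imK (a b c d : ℝ) : (quat a b c d).imK = d := rfl

/-- Two pure unit quaternions can be conjugated simultaneously to the quaternions `rot 0` and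
`rot (-t)`, where `t ∈ [0, π]` is the angle between them. -/
theorem exists_conj_rot {x z : SU2} (hx : (x : ℍ[ℝ]).re = 0) (hz : (z : ℍ[ℝ]).re = 0) :
    ∃ s : SU2, s * x * s⁻¹ = rot 0 ∧
      s * z * s⁻¹ = rot (-Real.arccos (-((x * z : SU2) : ℍ[ℝ]).re)) := by
  obtain ⟨s₁, hs₁⟩ : ∃ s : SU2, s * x * s⁻¹ = rot 0 := by
    have hn := x.normSq_eq_one
    rw [hx] at hn
    by_cases h : rotQ 0 + (x : ℍ[ℝ]) = 0
    · have e1 : (x : ℍ[ℝ]) = quat 0 (-1) 0 0 := by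
        rw [← neg_eq_of_add_eq_zero_right h]
        ext <;> simp
      obtain ⟨s, -, hs⟩ := SU2.exists_conj (x := x) (y := rot 0) (q := quat 0 0 1 0)
        (fun h0 => by simpa using congrArg QuaternionAlgebra.imJ h0) (by
          rw [e1]
          change _ = rotQ 0 * _
          ext <;> simp)
      exact ⟨s, hs⟩
    · obtain ⟨s, -, hs⟩ := SU2.exists_conj (x := x) (y := rot 0) h (by
        change _ = rotQ 0 * _
        ext <;> simp [hx] <;> linarith)
      exact ⟨s, hs⟩
  set z₁ := s₁ * z * s₁⁻¹ with hz₁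
  have hz₁re : (z₁ : ℍ[ℝ]).re = 0 := by rw [hz₁, SU2.re_conj, hz]
  have hn := z₁.normSq_eq_one
  rw [hz₁re] at hn
  have hinner : -((x * z : SU2) : ℍ[ℝ]).re = (z₁ : ℍ[ℝ]).imI := by
    have h1 : s₁ * (x * z) * s₁⁻¹ = rot 0 * z₁ := by rw [← hs₁, hz₁]; group
    rw [← SU2.re_conj s₁, h1]
    change -(rotQ 0 * (z₁ : ℍ[ℝ])).re = _
    rw [Quaternion.re_mul]
    simp
  rw [hinner]
  set β := -Real.arccos (z₁ : ℍ[ℝ]).imI with hβ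
  have hcos : Real.cos β = (z₁ : ℍ[ℝ]).imI := by
    rw [hβ, Real.cos_neg, Real.cos_arccos] <;>
      nlinarith [sq_nonneg (z₁ : ℍ[ℝ]).imJ, sq_nonneg (z₁ : ℍ[ℝ]).imK]
  have hsin : Real.sin β ^ 2 = (z₁ : ℍ[ℝ]).imJ ^ 2 + (z₁ : ℍ[ℝ]).imK ^ 2 := by
    have := Real.sin_sq_add_cos_sq β
    rw [hcos] at this
    linarith
  obtain ⟨q, hq0, hq1, hq2⟩ : ∃ q : ℍ[ℝ], q ≠ 0 ∧ q * rotQ 0 = rotQ 0 * q ∧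
      q * (z₁ : ℍ[ℝ]) = rotQ β * q := by
    by_cases h : quat (Real.sin β + (z₁ : ℍ[ℝ]).imJ) (-(z₁ : ℍ[ℝ]).imK) 0 0 = 0
    · refine ⟨rotQ 0, fun h0 => by simpa using congrArg QuaternionAlgebra.imI h0, rfl, ?_⟩
      have h1 : Real.sin β + (z₁ : ℍ[ℝ]).imJ = 0 := congrArg QuaternionAlgebra.re h
      have h2 : -(z₁ : ℍ[ℝ]).imK = 0 := congrArg QuaternionAlgebra.imI h
      ext <;> simp [hz₁re, hcos] <;> linarith
    · refine ⟨_, h, by ext <;> simp, ?_⟩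
      ext <;> simp [hz₁re, hcos]
      · ring
      · ring
      · nlinarith
      · ring
  obtain ⟨s₂, hs₂, hs₂'⟩ := SU2.exists_conj (x := z₁) (y := rot β) hq0 hq2
  obtain ⟨s₃, hs₃, hs₃'⟩ := SU2.exists_conj (x := rot 0) (y := rot 0) hq0 hq1
  have h23 : s₃ = s₂ := Subtype.ext (hs₃.trans hs₂.symm)
  rw [h23] at hs₃'
  refine ⟨s₂ * s₁, ?_, ?_⟩
  · rw [← hs₃', ← hs₁]; group
  · rw [← hs₂', hz₁]; group

/-! ### The character variety of the rational tangle -/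

/-- The effect of a crossing on the angles of a representation whose meridians are sent to
quaternions of the form `rot α`. -/
def Crossing.angles (c : Crossing) (x : Fin 4 → ℝ) : Fin 4 → ℝ :=
  if c.overRight then
    Function.update (Function.update x c.lo (2 * x c.lo - x c.hi)) c.hi (x c.lo)
  else
    Function.update (Function.update x c.lo (x c.hi)) c.hi (2 * x c.hi - x c.lo)

theorem Crossing.angles_smul (c : Crossing) (t : ℝ) (x : Fin 4 → ℝ) (j : Fin 4) :
    c.angles (fun i => t * x i) j = t * c.angles x j := by
  obtain ⟨s, b⟩ := c
  cases s <;> cases b <;> fin_cases j <;>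
    simp [Crossing.angles, Crossing.lo, Crossing.hi, Function.update] <;> ring

theorem Crossing.wirtinger_rot (c : Crossing) (x : Fin 4 → ℝ) (s : Fin 4 → ℤˣ) (j : Fin 4) :
    c.wirtinger (fun i => rot (x i) ^ (s i : ℤ)) j
      = rot (c.angles x j) ^ (s (Equiv.swap c.lo c.hi j) : ℤ) := by
  obtain ⟨t, b⟩ := c
  cases t <;> cases b <;> fin_cases j <;>
    simp [Crossing.angles, Crossing.wirtinger, Crossing.lo, Crossing.hi, Function.update,
      rot_zpow_conj, rot_zpow_conj_inv, Equiv.swap_apply_def]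

/-- The angles of the representation at height `k`, relative to the angle between the two cups. -/
def baseAngle (w : List Crossing) (k : ℕ) : Fin 4 → ℝ :=
  (w.take k).foldl (fun x c => c.angles x) ![0, 0, -1, -1]

theorem baseAngle_succ (w : List Crossing) (k : Fin w.length) :
    baseAngle w (k + 1) = (w.get k).angles (baseAngle w k) := by
  rw [baseAngle, List.take_succ_eq_append_getElem k.2, List.foldl_append]
  rfl

section Tangle

variable {w : List Crossing} (o : LinkOrientation w)

/-- The representation of the tangle group for which the meridians of the two cups are at
angle `t`. -/
def repAt (t : ℝ) : TracelessRep (tangleMer w) :=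
  ⟨PresentedGroup.toGroup
    (f := fun kj => rot (t * baseAngle w kj.1 kj.2) ^ (o.sign kj.1 kj.2 : ℤ)) (by
      rintro r ((rfl | rfl) | ⟨k, j, rfl⟩)
      · rw [map_mul, FreeGroup.lift_apply_of, FreeGroup.lift_apply_of, o.cup₀]
        simp [baseAngle]
      · rw [map_mul, FreeGroup.lift_apply_of, FreeGroup.lift_apply_of, o.cup₁]
        simp [baseAngle]
      · rw [map_mul, map_inv, mul_inv_eq_one, Crossing.wirtinger_map, FreeGroup.lift_apply_of]
        simp only [FreeGroup.lift_apply_of]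
        rw [Crossing.wirtinger_rot, Crossing.angles_smul, o.cross, Fin.val_succ, baseAngle_succ]
        rfl),
    fun kj => by
      rw [tangleMer, PresentedGroup.toGroup.of]
      exact rot_zpow_re _ _⟩

theorem repAt_apply (t : ℝ) (kj : Fin (w.length + 1) × Fin 4) :
    (repAt o t).1 (tangleMer w kj) = rot (t * baseAngle w kj.1 kj.2) ^ (o.sign kj.1 kj.2 : ℤ) := by
  rw [repAt, tangleMer, PresentedGroup.toGroup.of]

theorem continuous_rot : Continuous rot := by
  refine Continuous.subtype_mk ?_ _
  have h : rotQ = fun α => Real.cos α • quat 0 1 0 0 + Real.sin α • quat 0 0 1 0 := by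
    ext α <;> simp
  rw [h]
  fun_prop

theorem continuous_SU2_inv : Continuous fun x : SU2 => x⁻¹ := by
  have h : (fun x : SU2 => x⁻¹) = fun x => star x := by
    ext1 x
    exact (Unitary.star_eq_inv x).symm
  rw [h]
  exact Continuous.subtype_mk (continuous_star.comp continuous_subtype_val) _

theorem continuous_repAt : Continuous (repAt o) := by
  refine continuous_induced_rng.2 (continuous_pi fun g => ?_)
  change Continuous fun t => (repAt o t).1 g
  induction g using PresentedGroup.induction_on with | _ g => ?_
  induction g using FreeGroup.induction_on with
  | C1 => simpa using continuous_const
  | of kj =>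
    have h : (fun t => (repAt o t).1 (PresentedGroup.mk (tangleRels w) (FreeGroup.of kj)))
        = fun t => rot (t * baseAngle w kj.1 kj.2) ^ (o.sign kj.1 kj.2 : ℤ) :=
      funext fun t => repAt_apply o t kj
    rw [h]
    have h1 : Continuous fun t : ℝ => rot (t * baseAngle w kj.1 kj.2) :=
      continuous_rot.comp (by fun_prop)
    rcases Int.units_eq_one_or (o.sign kj.1 kj.2) with h | h
    · simpa [h] using h1
    · have h2 : Continuous fun t : ℝ => (rot (t * baseAngle w kj.1 kj.2))⁻¹ :=
        continuous_SU2_inv.comp h1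
      simpa [h] using h2
  | inv_of g ih =>
    simp only [map_inv]
    exact continuous_SU2_inv.comp ih
  | mul g h ihg ihh =>
    simp only [map_mul]
    exact ihg.mul ihh

/-- A representation of the tangle group is determined by the meridians of the two cups. -/
theorem tangleHom_ext {f g : TangleGroup w →* SU2} (h0 : f (tangleMer w (0, 0)) = g (tangleMer w (0, 0)))
    (h2 : f (tangleMer w (0, 2)) = g (tangleMer w (0, 2))) : f = g := by
  have r1 : tangleMer w (0, 1) = (tangleMer w (0, 0))⁻¹ := by
    refine (inv_eq_of_mul_eq_one_right ?_).symm
    exact PresentedGroup.one_of_mem (rels := tangleRels w) (Or.inl (Or.inl rfl))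
  have r2 : tangleMer w (0, 3) = (tangleMer w (0, 2))⁻¹ := by
    refine (inv_eq_of_mul_eq_one_right ?_).symm
    exact PresentedGroup.one_of_mem (rels := tangleRels w) (Or.inl (Or.inr rfl))
  refine PresentedGroup.ext fun kj => ?_
  change f (tangleMer w kj) = g (tangleMer w kj)
  obtain ⟨k, j⟩ := kj
  induction k using Fin.induction generalizing j with
  | zero =>
    fin_cases j
    · exact h0
    · change f (tangleMer w (0, 1)) = g (tangleMer w (0, 1))
      rw [r1, map_inv, map_inv, h0]
    · exact h2
    · change f (tangleMer w (0, 3)) = g (tangleMer w (0, 3))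
      rw [r2, map_inv, map_inv, h2]
  | succ k ih =>
    rw [tangleMer_succ, Crossing.wirtinger_map, Crossing.wirtinger_map]
    simp only [ih]

/-- The element of the tangle group whose trace measures the angle between the two cups. -/
def cupProduct : TangleGroup w :=
  tangleMer w (0, 0) ^ (o.sign 0 0 : ℤ) * tangleMer w (0, 2) ^ (o.sign 0 2 : ℤ)

/-- The angle between the two cups. -/
def cupAngle : RTangle w → ℝ :=
  Quotient.lift (s := repSetoid (tangleMer w))
    (fun ρ => Real.arccos (-((ρ.1 (cupProduct o) : SU2) : ℍ[ℝ]).re)) (by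
      rintro ρ ρ' ⟨s, hs⟩
      simp only [hs, SU2.re_conj])

theorem continuous_cupAngle : Continuous (cupAngle o) := by
  refine Continuous.quotient_lift ?_ _
  have h1 : Continuous fun ρ : TracelessRep (tangleMer w) => ρ.1 (cupProduct o) :=
    (continuous_apply (cupProduct o)).comp continuous_induced_dom
  exact Real.continuous_arccos.comp
    (Quaternion.continuous_re.comp (continuous_subtype_val.comp h1)).neg

theorem cupAngle_mem (x : RTangle w) : cupAngle o x ∈ Icc 0 Real.pi := by
  induction x using Quotient.ind with | _ ρ => ?_
  exact ⟨Real.arccos_nonneg _, Real.arccos_le_pi _⟩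

theorem cupAngle_repAt {t : ℝ} (ht : t ∈ Icc 0 Real.pi) :
    cupAngle o (Quotient.mk (repSetoid (tangleMer w)) (repAt o t)) = t := by
  change Real.arccos (-(((repAt o t).1 (cupProduct o) : SU2) : ℍ[ℝ]).re) = t
  rw [cupProduct, map_mul, map_zpow, map_zpow, repAt_apply, repAt_apply, units_zpow_zpow,
    units_zpow_zpow, rot_mul_re, neg_neg]
  have h : t * baseAngle w (0 : Fin (w.length + 1)) 0 - t * baseAngle w (0 : Fin (w.length + 1)) 2
      = t := by
    simp [baseAngle]
  rw [h, Real.arccos_cos ht.1 ht.2]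

theorem repAt_cupAngle (x : RTangle w) :
    Quotient.mk (repSetoid (tangleMer w)) (repAt o (cupAngle o x)) = x := by
  induction x using Quotient.ind with | _ ρ => ?_
  have hpow : ∀ (g : TangleGroup w) (e : ℤˣ), ((ρ.1 g : SU2) : ℍ[ℝ]).re = 0 →
      ((ρ.1 (g ^ (e : ℤ)) : SU2) : ℍ[ℝ]).re = 0 := by
    intro g e h
    rcases Int.units_eq_one_or e with rfl | rfl
    · simpa using h
    · rw [Units.val_neg, Units.val_one, zpow_neg, zpow_one, map_inv, ← Unitary.star_eq_inv]
      exact (Quaternion.re_star _).trans h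
  obtain ⟨s, h0, h2⟩ := exists_conj_rot (hpow _ (o.sign 0 0) (ρ.2 (0, 0)))
    (hpow _ (o.sign 0 2) (ρ.2 (0, 2)))
  rw [← map_mul] at h2
  change s * _ * s⁻¹ = rot (-(cupAngle o (Quotient.mk (repSetoid (tangleMer w)) ρ))) at h2
  refine (Quotient.sound (s := repSetoid (tangleMer w)) ⟨s, fun g => ?_⟩).symm
  refine DFunLike.congr_fun (g := (MulAut.conj s).toMonoidHom.comp _) (tangleHom_ext ?_ ?_) g
  · rw [repAt_apply, MonoidHom.comp_apply]
    change _ = s * _ * s⁻¹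
    have h3 := congrArg (· ^ (o.sign 0 0 : ℤ)) h0
    beta_reduce at h3
    rw [conj_zpow, ← map_zpow, units_zpow_zpow] at h3
    rw [h3]
    simp [baseAngle]
  · rw [repAt_apply, MonoidHom.comp_apply]
    change _ = s * _ * s⁻¹
    have h3 := congrArg (· ^ (o.sign 0 2 : ℤ)) h2
    beta_reduce at h3
    rw [conj_zpow, ← map_zpow, units_zpow_zpow] at h3
    rw [h3]
    simp [baseAngle]

/-- The character variety of the tangle is an interval, parametrised by the angle between the two
cups. -/
def cupHomeo : Icc (0 : ℝ) Real.pi ≃ₜ RTangle w where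
  toFun t := Quotient.mk (repSetoid (tangleMer w)) (repAt o t)
  invFun x := ⟨cupAngle o x, cupAngle_mem o x⟩
  left_inv t := Subtype.ext (cupAngle_repAt o t.2)
  right_inv x := repAt_cupAngle o x
  continuous_toFun := continuous_quotient_mk'.comp
    ((continuous_repAt o).comp continuous_subtype_val)
  continuous_invFun := (continuous_cupAngle o).subtype_mk _

/-- If the angles at the top satisfy the relation in the sphere group then the restriction of the
representation with angle `t` to the boundary is given by their differences. -/
theorem restrictToSphere_repAt (t : ℝ)
    (h : baseAngle w w.length 3 - baseAngle w w.length 2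
      = -(baseAngle w w.length 1 - baseAngle w w.length 0)) :
    restrictToSphere w (Quotient.mk (repSetoid (tangleMer w)) (repAt o t))
      = psi o ⟨t * (baseAngle w w.length 1 - baseAngle w w.length 0),
          t * (baseAngle w w.length 2 - baseAngle w w.length 0)⟩ := by
  obtain ⟨s, hs⟩ := exists_rot_shift (-(t * baseAngle w w.length 0))
  refine Quotient.sound (s := repSetoid sphereMer) ⟨s, fun g => ?_⟩
  refine DFunLike.congr_fun (g := (MulAut.conj s).toMonoidHom.comp _)
    (sphereGroup_hom_ext fun j => ?_) g
  simp only [sphereMer, PresentedGroup.toGroup.of, MonoidHom.comp_apply, boundaryHom, repAt_apply,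
    MulEquiv.toMonoidHom_eq_coe, MonoidHom.coe_coe, map_zpow, MulAut.conj_apply, hs, Fin.val_last]
  congr 2
  fin_cases j
  · simp [psiAngle]
  · simp [psiAngle]; ring
  · simp [psiAngle]; ring
  · simp [psiAngle]
    linear_combination (-t) * h

end Tangle

/-! ### The slope of the arc and continued fractions -/

/-- The differences of the four angles `x` are those of the rational tangle of slope `(P, Q)`. -/
def HasSlope (x : Fin 4 → ℝ) (P Q : ℝ) : Prop :=
  x 1 - x 0 = Q ∧ x 2 - x 1 = -P ∧ x 3 - x 2 = -Q

theorem HasSlope.angles_middle {x : Fin 4 → ℝ} {P Q : ℝ} (h : HasSlope x P Q) (b : Bool) :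
    HasSlope (Crossing.angles ⟨.middle, b⟩ x) P (Q + (if b then 1 else -1) * P) := by
  obtain ⟨h1, h2, h3⟩ := h
  cases b <;> refine ⟨?_, ?_, ?_⟩ <;>
    simp [Crossing.angles, Crossing.lo, Crossing.hi, Function.update] <;> linarith

theorem HasSlope.angles_left {x : Fin 4 → ℝ} {P Q : ℝ} (h : HasSlope x P Q) (b : Bool) :
    HasSlope (Crossing.angles ⟨.left, b⟩ x) (P - (if b then 1 else -1) * Q) Q := by
  obtain ⟨h1, h2, h3⟩ := h
  cases b <;> refine ⟨?_, ?_, ?_⟩ <;>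
    simp [Crossing.angles, Crossing.lo, Crossing.hi, Function.update] <;> linarith

theorem natAbs_mul_sign (n : ℤ) :
    ((n.natAbs : ℕ) : ℝ) * (if decide (0 < n) = true then 1 else -1) = n := by
  rcases lt_or_ge 0 n with h | h
  · have : ((n.natAbs : ℤ) : ℝ) = n := by rw [Int.natAbs_of_nonneg h.le]
    simpa [h] using this
  · rw [if_neg (by simpa using h), Nat.cast_natAbs, abs_of_nonpos h]
    push_cast; ring

theorem HasSlope.twists_middle {x : Fin 4 → ℝ} {P Q : ℝ} (h : HasSlope x P Q) (n : ℤ) :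
    HasSlope ((twists .middle n).foldl (fun x c => c.angles x) x) P (Q + n * P) := by
  have key : ∀ (m : ℕ) (b : Bool) {x : Fin 4 → ℝ} {Q : ℝ}, HasSlope x P Q →
      HasSlope ((List.replicate m (⟨.middle, b⟩ : Crossing)).foldl (fun x c => c.angles x) x) P
        (Q + m * (if b then 1 else -1) * P) := by
    intro m b
    induction m with
    | zero => intro x Q h; simpa using h
    | succ m ih =>
      intro x Q h
      rw [List.replicate_succ, List.foldl_cons]
      convert! ih (h.angles_middle b) using 1
      push_cast; ring
  have := key n.natAbs (decide (0 < n)) h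
  rwa [natAbs_mul_sign] at this

theorem HasSlope.twists_left {x : Fin 4 → ℝ} {P Q : ℝ} (h : HasSlope x P Q) (n : ℤ) :
    HasSlope ((twists .left n).foldl (fun x c => c.angles x) x) (P - n * Q) Q := by
  have key : ∀ (m : ℕ) (b : Bool) {x : Fin 4 → ℝ} {P : ℝ}, HasSlope x P Q →
      HasSlope ((List.replicate m (⟨.left, b⟩ : Crossing)).foldl (fun x c => c.angles x) x)
        (P - m * (if b then 1 else -1) * Q) Q := by
    intro m b
    induction m with
    | zero => intro x P h; simpa using h
    | succ m ih =>
      intro x P h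
      rw [List.replicate_succ, List.foldl_cons]
      convert! ih (h.angles_left b) using 1
      push_cast; ring
  have := key n.natAbs (decide (0 < n)) h
  rwa [natAbs_mul_sign] at this

theorem hasSlope_tangleWord (l : List (ℤ × ℤ)) :
    HasSlope (baseAngle (tangleWord l) (tangleWord l).length) (contFrac l).1 (contFrac l).2 := by
  rw [baseAngle, List.take_length]
  induction l with
  | nil => refine ⟨?_, ?_, ?_⟩ <;> simp [tangleWord, contFrac]
  | cons ab l ih =>
    obtain ⟨a, b⟩ := ab
    rw [tangleWord, List.foldl_append, List.foldl_append]
    have h := (ih.twists_middle b).twists_left (-a)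
    convert! h using 1
    · simp only [contFrac]; push_cast; ring
    · simp only [contFrac]; push_cast; ring

theorem restrictToSphere_tangleWord {p q : ℤ} {l : List (ℤ × ℤ)} (hl : IsExpansion l p q)
    (o : LinkOrientation (tangleWord l)) (t : Icc (0 : ℝ) Real.pi) :
    restrictToSphere (tangleWord l) (cupHomeo o t)
      = psi o (((t : ℝ) : ℂ) * ((q : ℂ) + ((q - p : ℤ) : ℂ) * Complex.I)) := by
  obtain ⟨h1, h2, h3⟩ := hasSlope_tangleWord l
  refine (restrictToSphere_repAt o t (by rw [h1, h3])).trans ((psi_eq_psi_iff o).2 ?_)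
  have h4 : baseAngle (tangleWord l) (tangleWord l).length 2
      - baseAngle (tangleWord l) (tangleWord l).length 0 = (contFrac l).2 - (contFrac l).1 := by
    linarith
  rw [h1, h4]
  rcases hl with hl | hl <;> rw [hl]
  · refine ⟨0, 0, Or.inl (Complex.ext ?_ ?_)⟩ <;> simp [latticePt]
  · refine ⟨0, 0, Or.inr (Complex.ext ?_ ?_)⟩ <;> simp [latticePt]
    ring

/-! ### The linear arc -/

/-- The direction `(q, q - p)` of the linear arc. -/
def arcDir (p q : ℤ) : ℂ := (q : ℂ) + ((q - p : ℤ) : ℂ) * Complex.I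

@[simp] theorem arcDir_re (p q : ℤ) : (arcDir p q).re = q := by simp [arcDir]

@[simp] theorem arcDir_im (p q : ℤ) : (arcDir p q).im = q - p := by simp [arcDir]

theorem ofReal_mul_arcDir_re (p q : ℤ) (t : ℝ) : ((t : ℂ) * arcDir p q).re = t * q := by
  rw [Complex.re_ofReal_mul, arcDir_re]

theorem ofReal_mul_arcDir_im (p q : ℤ) (t : ℝ) : ((t : ℂ) * arcDir p q).im = t * (q - p) := by
  rw [Complex.im_ofReal_mul, arcDir_im]

theorem arcDir_ne_zero {p : ℤ} (hp : 0 < p) (q : ℤ) : arcDir p q ≠ 0 := fun h => by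
  have h1 := congrArg Complex.re h
  have h2 := congrArg Complex.im h
  rw [arcDir_re, Complex.zero_re] at h1
  rw [arcDir_im, Complex.zero_im, h1] at h2
  have : (0 : ℝ) < p := by exact_mod_cast hp
  linarith

theorem exists_bezout {p q : ℤ} (hpq : IsCoprime p q) :
    ∃ a b : ℝ, (∃ i : ℤ, a = i) ∧ (∃ i : ℤ, b = i) ∧ a * q + b * (q - p) = 1 := by
  obtain ⟨u, v, h⟩ := hpq
  refine ⟨v + u, -u, ⟨v + u, by push_cast; rfl⟩, ⟨-u, by push_cast; rfl⟩, ?_⟩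
  have : (u : ℝ) * p + v * q = 1 := by exact_mod_cast h
  linarith

/-- A multiple of the primitive vector `(q, q - p)` lies in `r ℤ²` only if the factor lies
in `r ℤ`. -/
theorem exists_eq_mul_of_mul_arcDir {p q : ℤ} (hpq : IsCoprime p q) {t r : ℝ} {m n : ℤ}
    (h1 : t * q = r * m) (h2 : t * (q - p) = r * n) : ∃ k : ℤ, t = r * k := by
  obtain ⟨_, _, ⟨i, rfl⟩, ⟨j, rfl⟩, h⟩ := exists_bezout hpq
  refine ⟨i * m + j * n, ?_⟩
  push_cast
  linear_combination (-t) * h + i * h1 + j * h2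

theorem hasDerivAt_ofReal_mul (W : ℂ) (t : ℝ) : HasDerivAt (fun t : ℝ => (t : ℂ) * W) W t := by
  simpa using (Complex.ofRealCLM.hasDerivAt (x := t)).mul_const W

/-- The linear arc of slope `(q - p) / q` from the corner `(0, 0)`. -/
def linArc {p q : ℤ} (hp : 0 < p) (hpq : IsCoprime p q) : ProperArc where
  lift t := t * arcDir p q
  smooth := Complex.ofRealCLM.contDiff.mul contDiff_const
  immersed t _ := by
    rw [(hasDerivAt_ofReal_mul (arcDir p q) t).deriv]
    exact arcDir_ne_zero hp q
  left := ⟨0, 0, by simp [latticePt]⟩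
  right := ⟨q, q - p, Complex.ext (by rw [ofReal_mul_arcDir_re, latticePt_re])
    (by rw [ofReal_mul_arcDir_im, latticePt_im]; push_cast; ring)⟩
  interior t ht h := by
    obtain ⟨m, n, h1, h2⟩ := mem_lattice_iff.1 h
    rw [ofReal_mul_arcDir_re] at h1
    rw [ofReal_mul_arcDir_im] at h2
    obtain ⟨k, hk⟩ := exists_eq_mul_of_mul_arcDir hpq h1 h2
    have hp := Real.pi_pos
    have k1 : (0 : ℝ) < k := pos_of_mul_pos_right (hk ▸ ht.1) hp.le
    have k2 : (k : ℝ) < 1 := by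
      have := ht.2
      rw [hk] at this
      exact (mul_lt_iff_lt_one_right hp).1 this
    have k1' : 0 < k := by exact_mod_cast k1
    have k2' : k < 1 := by exact_mod_cast k2
    omega

section Arc

variable {p q : ℤ} (hp : 0 < p) (hpq : IsCoprime p q)

theorem deriv_linArc (t : ℝ) : deriv (linArc hp hpq).lift t = arcDir p q :=
  (hasDerivAt_ofReal_mul (arcDir p q) t).deriv

include hpq in
theorem toP_mul_arcDir_injOn :
    InjOn (fun t : ℝ => toP (t * arcDir p q)) (Icc 0 Real.pi) := by
  intro t ht t' ht' h
  have hpi := Real.pi_pos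
  obtain ⟨m, n, h | h⟩ := toP_eq_toP_iff.1 h
  · have h1 := congrArg Complex.re h
    have h2 := congrArg Complex.im h
    rw [Complex.add_re, latticePt_re, ofReal_mul_arcDir_re, ofReal_mul_arcDir_re] at h1
    rw [Complex.add_im, latticePt_im, ofReal_mul_arcDir_im, ofReal_mul_arcDir_im] at h2
    obtain ⟨k, hk⟩ := exists_eq_mul_of_mul_arcDir hpq (t := t' - t) (r := 2 * Real.pi) (m := m)
      (n := n) (by push_cast at h1; linarith) (by push_cast at h2; linarith)
    have k1 : (-1 : ℝ) < k := by nlinarith [ht.1, ht.2, ht'.1, ht'.2]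
    have k2 : (k : ℝ) < 1 := by nlinarith [ht.1, ht.2, ht'.1, ht'.2]
    have k1' : -1 < k := by exact_mod_cast k1
    have k2' : k < 1 := by exact_mod_cast k2
    obtain rfl : k = 0 := by omega
    simp at hk
    linarith
  · have h1 := congrArg Complex.re h
    have h2 := congrArg Complex.im h
    rw [Complex.add_re, latticePt_re, Complex.neg_re, ofReal_mul_arcDir_re,
      ofReal_mul_arcDir_re] at h1
    rw [Complex.add_im, latticePt_im, Complex.neg_im, ofReal_mul_arcDir_im,
      ofReal_mul_arcDir_im] at h2
    obtain ⟨k, hk⟩ := exists_eq_mul_of_mul_arcDir hpq (t := t' + t) (r := 2 * Real.pi) (m := m)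
      (n := n) (by push_cast at h1; linarith) (by push_cast at h2; linarith)
    have k1 : (-1 : ℝ) < k := by nlinarith [ht.1, ht.2, ht'.1, ht'.2]
    have k2 : (k : ℝ) < 2 := by nlinarith [ht.1, ht.2, ht'.1, ht'.2]
    have k1' : -1 < k := by exact_mod_cast k1
    have k2' : k < 2 := by exact_mod_cast k2
    obtain rfl | rfl : k = 0 ∨ k = 1 := by omega
    · simp at hk
      linarith [ht.1, ht'.1]
    · simp at hk
      linarith [ht.2, ht'.2]

theorem continuous_toP_linArc : Continuous fun t : ℝ => toP ((linArc hp hpq).lift t) :=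
  continuous_toP.comp (linArc hp hpq).smooth.continuous

theorem isEmbedding_linArc {a b : ℝ} (ha : 0 ≤ a) (hb : b ≤ Real.pi) :
    IsEmbedding fun t : Icc a b => toP ((linArc hp hpq).lift t) := by
  refine (Continuous.isClosedEmbedding
    ((continuous_toP_linArc hp hpq).comp continuous_subtype_val) fun t t' h => ?_).isEmbedding
  exact Subtype.ext (toP_mul_arcDir_injOn hpq ⟨ha.trans t.2.1, t.2.2.trans hb⟩
    ⟨ha.trans t'.2.1, t'.2.2.trans hb⟩ h)

theorem toP_mem_PBar_iff {z : ℂ} {δ : ℝ} : toP z ∈ PBar δ ↔ ∀ c ∈ Lattice, δ ≤ ‖z - c‖ := by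
  refine ⟨?_, fun h => ⟨z, rfl, h⟩⟩
  rintro ⟨w, hw, h⟩ _ ⟨a, b, rfl⟩
  obtain ⟨m, n, rfl | rfl⟩ := toP_eq_toP_iff.1 hw
  · have := h _ ⟨a - 2 * m, b - 2 * n, rfl⟩
    convert this using 2
    rw [show latticePt a b = latticePt (2 * m + (a - 2 * m)) (2 * n + (b - 2 * n)) by congr 1 <;> ring,
      ← latticePt_add]
    ring
  · have := h _ ⟨2 * m - a, 2 * n - b, rfl⟩
    have e : -w + latticePt (2 * m) (2 * n) - latticePt a b
        = -(w - latticePt (2 * m - a) (2 * n - b)) := by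
      rw [sub_eq_add_neg (2 * m), sub_eq_add_neg (2 * n), ← latticePt_add, ← latticePt_neg]
      ring
    rwa [e, norm_neg]

include hpq in
/-- The distance from a point of the arc to the lattice is its distance to one of the ends, unless
it exceeds a fixed constant. -/
theorem le_norm_sub_lattice {δ t : ℝ} (hδ : δ * ‖arcDir p q‖ ≤ Real.pi)
    (h0 : δ ≤ t * ‖arcDir p q‖) (h1 : δ ≤ (Real.pi - t) * ‖arcDir p q‖) (hR : 0 < ‖arcDir p q‖)
    {c : ℂ} (hc : c ∈ Lattice) : δ ≤ ‖(t : ℂ) * arcDir p q - c‖ := by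
  have hpi := Real.pi_pos
  set W := arcDir p q with hW
  obtain ⟨m, n, rfl⟩ := hc
  by_cases hmn : m * (q - p) - n * q = 0
  · -- the lattice point lies on the line spanned by the arc
    have e : (m : ℝ) * (q - p) = n * q := by exact_mod_cast sub_eq_zero.1 hmn
    obtain ⟨k, hk⟩ : ∃ k : ℤ, latticePt m n = ((Real.pi * k : ℝ) : ℂ) * W := by
      obtain ⟨_, _, ⟨i, rfl⟩, ⟨j, rfl⟩, h⟩ := exists_bezout hpq
      refine ⟨i * m + j * n, Complex.ext ?_ ?_⟩
      · rw [latticePt_re, ofReal_mul_arcDir_re]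
        push_cast
        linear_combination (-Real.pi * m) * h + (Real.pi * j) * e
      · rw [latticePt_im, ofReal_mul_arcDir_im]
        push_cast
        linear_combination (-Real.pi * n) * h - (Real.pi * i) * e
    rw [hk, ← sub_mul, norm_mul, ← Complex.ofReal_sub, Complex.norm_real, Real.norm_eq_abs]
    rcases le_or_gt k 0 with hk0 | hk0
    · have : (k : ℝ) ≤ 0 := by exact_mod_cast hk0
      refine h0.trans (mul_le_mul_of_nonneg_right ?_ hR.le)
      exact le_trans (by nlinarith) (le_abs_self _)
    · have : (1 : ℝ) ≤ k := by exact_mod_cast hk0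
      refine h1.trans (mul_le_mul_of_nonneg_right ?_ hR.le)
      rw [abs_sub_comm]
      exact le_trans (by nlinarith) (le_abs_self _)
  · -- otherwise the area spanned with the direction of the arc is at least `π`
    have h1 : (1 : ℝ) ≤ |((m * (q - p) - n * q : ℤ) : ℝ)| := by
      exact_mod_cast Int.one_le_abs hmn
    have h2 : ((starRingEnd ℂ) ((t : ℂ) * W - latticePt m n) * W).im
        = -(Real.pi * ((m * (q - p) - n * q : ℤ) : ℝ)) := by
      rw [Complex.mul_im, Complex.conj_re, Complex.conj_im, Complex.sub_re, Complex.sub_im,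
        latticePt_re, latticePt_im, ofReal_mul_arcDir_re, ofReal_mul_arcDir_im, arcDir_re,
        arcDir_im]
      push_cast; ring
    have h3 := Complex.abs_im_le_norm ((starRingEnd ℂ) ((t : ℂ) * W - latticePt m n) * W)
    rw [h2, abs_neg, abs_mul, abs_of_pos hpi, norm_mul, Complex.norm_conj] at h3
    have h4 : δ * ‖W‖ ≤ ‖(t : ℂ) * W - latticePt m n‖ * ‖W‖ := by nlinarith
    exact le_of_mul_le_mul_right h4 hR

theorem linArc_isRestricted : (linArc hp hpq).IsRestricted := by
  have hpi := Real.pi_pos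
  have hW := arcDir_ne_zero hp q
  have hR : 0 < ‖arcDir p q‖ := norm_pos_iff.2 hW
  set W := arcDir p q with hWdef
  set R := ‖W‖
  have hlift : ∀ t : ℝ, (linArc hp hpq).lift t = t * W := fun t => rfl
  have hπW : ((Real.pi : ℝ) : ℂ) * W ∈ Lattice := (linArc hp hpq).right
  have h0W : (0 : ℂ) ∈ Lattice := ⟨0, 0, by simp [latticePt]⟩
  filter_upwards [Ioo_mem_nhdsGT (show 0 < min (Real.pi / R) (Real.pi * R / 2) by positivity)]
    with δ hδ
  have hδ0 := hδ.1
  have hδ1 : δ * R ≤ Real.pi := (le_div_iff₀ hR).1 (hδ.2.le.trans (min_le_left _ _))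
  have hδ2 : δ < Real.pi * R / 2 := hδ.2.trans_le (min_le_right _ _)
  have haR : δ / R * R = δ := div_mul_cancel₀ _ hR.ne'
  have ha : 0 < δ / R := by positivity
  have hab : δ / R < Real.pi / 2 := by rw [div_lt_iff₀ hR]; linarith
  refine ⟨δ / R, Real.pi - δ / R, ha, by linarith, by linarith, ?_, ?_, ?_, ?_⟩
  · intro t ht
    rw [hlift, toP_mem_PBar_iff]
    constructor
    · intro h
      have h1 := h 0 h0W
      have h2 := h _ hπW
      rw [sub_zero, norm_mul, Complex.norm_real, Real.norm_eq_abs, abs_of_nonneg ht.1] at h1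
      rw [← sub_mul, norm_mul, ← Complex.ofReal_sub, Complex.norm_real, Real.norm_eq_abs,
        abs_sub_comm, abs_of_nonneg (by linarith [ht.2])] at h2
      have h1' := (div_le_iff₀ hR).2 h1
      have h2' := (div_le_iff₀ hR).2 h2
      exact ⟨h1', by linarith⟩
    · intro h c hc
      exact le_norm_sub_lattice hpq hδ1 ((div_le_iff₀ hR).1 h.1)
        ((div_le_iff₀ hR).1 (by linarith [h.2])) hR hc
  · intro h
    have := toP_mul_arcDir_injOn hpq ⟨ha.le, by linarith⟩ ⟨by linarith, by linarith⟩ h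
    linarith
  · have hinner : ∀ x : ℝ, inner ℝ W ((x : ℂ) * W) = x * R ^ 2 := fun x => by
      rw [← Complex.real_smul, inner_smul_right, real_inner_self_eq_norm_sq]
    rintro t (rfl | rfl)
    · refine ⟨0, h0W, ?_, ?_⟩
      · rw [sub_zero, hlift, norm_mul, Complex.norm_real, Real.norm_eq_abs, abs_of_pos ha, haR]
      · rw [deriv_linArc, hlift, sub_zero, hinner]
        positivity
    · refine ⟨_, hπW, ?_, ?_⟩
      · rw [hlift, ← sub_mul, ← Complex.ofReal_sub, norm_mul, Complex.norm_real, Real.norm_eq_abs,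
          show Real.pi - δ / R - Real.pi = -(δ / R) by ring, abs_neg, abs_of_pos ha, haR]
      · rw [deriv_linArc, hlift, ← sub_mul, ← Complex.ofReal_sub, hinner,
          show Real.pi - δ / R - Real.pi = -(δ / R) by ring]
        exact (mul_neg_of_neg_of_pos (by linarith) (by positivity)).ne
  · intro E _ _ cov hcov f hf
    refine IsEmbedding.of_comp f.continuous
      (continuous_subtype_val.comp hcov.continuous) ?_
    have : (Subtype.val ∘ cov) ∘ f = fun t : Icc (δ / R) (Real.pi - δ / R) =>
        toP ((linArc hp hpq).lift t) := funext hf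
    rw [this]
    exact isEmbedding_linArc hp hpq ha.le (by linarith)

end Arc

/-! ### The intersection points

The lift of an intersection point of `L₀` with the arc satisfies `zeroLift ε s = τ (q, q - p)`
modulo `2π ℤ²`, where `|τ|` is the parameter along the arc.  Solving the sum of the two coordinates
for `s` leaves one equation for `τ`, which depends on an integer `k`. -/

/-- The function whose zeros `τ` are the intersection points of index `k`. -/
def rootFun (p q k : ℤ) (ε τ : ℝ) : ℝ :=
  p * τ + 2 * Real.pi * k + 2 * ε * ((-1 : ℝ) ^ k * Real.cos (τ * (2 * q - p) / 2))

/-- The parameter on `L₀` of the intersection point of index `k` with parameter `τ`. -/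
def angleAt (p q k : ℤ) (τ : ℝ) : ℝ := τ * (2 * q - p) / 2 + Real.pi * k - Real.pi / 2

theorem abs_neg_one_zpow (k : ℤ) : |(-1 : ℝ) ^ k| = 1 := by
  rw [abs_zpow, abs_neg, abs_one, one_zpow]

theorem sin_angleAt (p q k : ℤ) (τ : ℝ) :
    Real.sin (angleAt p q k τ) = -((-1 : ℝ) ^ k * Real.cos (τ * (2 * q - p) / 2)) := by
  rw [angleAt, Real.sin_sub_pi_div_two, add_comm, cos_pi_mul_add]

theorem cos_angleAt (p q k : ℤ) (τ : ℝ) :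
    Real.cos (angleAt p q k τ) = (-1 : ℝ) ^ k * Real.sin (τ * (2 * q - p) / 2) := by
  rw [angleAt, Real.cos_sub_pi_div_two, add_comm, sin_pi_mul_add]

theorem zeroLift_angleAt {p q k : ℤ} {ε τ : ℝ} (h : rootFun p q k ε τ = 0) :
    zeroLift ε (angleAt p q k τ) = τ * arcDir p q + latticePt (2 * k) 0 := by
  rw [rootFun] at h
  apply Complex.ext
  · rw [zeroLift_re, Complex.add_re, ofReal_mul_arcDir_re, latticePt_re, sin_angleAt, angleAt]
    push_cast; linarith
  · rw [zeroLift_im, Complex.add_im, ofReal_mul_arcDir_im, latticePt_im, sin_angleAt, angleAt]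
    push_cast; linarith

theorem zeroLift_add (ε s : ℝ) (n : ℤ) :
    zeroLift ε (s + n * (2 * Real.pi)) = zeroLift ε s + latticePt (2 * n) (2 * n) := by
  apply Complex.ext
  · rw [Complex.add_re, zeroLift_re, zeroLift_re, latticePt_re, Real.sin_add_int_mul_two_pi]
    push_cast; ring
  · rw [Complex.add_im, zeroLift_im, zeroLift_im, latticePt_im, Real.sin_add_int_mul_two_pi]
    push_cast; ring

/-- Every intersection point is given by a zero of one of the functions `rootFun`. -/
theorem exists_root_of_toP_eq {p q : ℤ} {ε s t : ℝ}
    (h : toP (zeroLift ε s) = toP (t * arcDir p q)) :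
    ∃ (k n : ℤ) (τ : ℝ), (τ = t ∨ τ = -t) ∧ s = angleAt p q k τ + n * (2 * Real.pi) ∧
      rootFun p q k ε τ = 0 := by
  obtain ⟨m, n, τ, hτ, hz⟩ : ∃ (m n : ℤ) (τ : ℝ), (τ = t ∨ τ = -t) ∧
      zeroLift ε s = τ * arcDir p q + latticePt (2 * m) (2 * n) := by
    obtain ⟨m, n, h | h⟩ := toP_eq_toP_iff.1 h
    · refine ⟨-m, -n, t, Or.inl rfl, ?_⟩
      rw [h, show 2 * -m = -(2 * m) by ring, show 2 * -n = -(2 * n) by ring, ← latticePt_neg]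
      ring
    · refine ⟨m, n, -t, Or.inr rfl, ?_⟩
      rw [Complex.ofReal_neg, neg_mul, h]
      ring
  have h1 := congrArg Complex.re hz
  have h2 := congrArg Complex.im hz
  rw [zeroLift_re, Complex.add_re, ofReal_mul_arcDir_re, latticePt_re] at h1
  rw [zeroLift_im, Complex.add_im, ofReal_mul_arcDir_im, latticePt_im] at h2
  push_cast at h1 h2
  have hs : s = angleAt p q (m - n) τ + n * (2 * Real.pi) := by
    rw [angleAt]; push_cast; linarith
  have h3 : Real.sin s = -((-1 : ℝ) ^ (m - n) * Real.cos (τ * (2 * q - p) / 2)) := by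
    rw [hs, Real.sin_add_int_mul_two_pi, sin_angleAt]
  refine ⟨m - n, n, τ, hτ, hs, ?_⟩
  rw [h3] at h1 h2
  rw [rootFun]
  push_cast
  linarith

section Root

variable {p : ℤ} (hp : 0 < p) {q : ℤ} (k : ℤ) {ε : ℝ} (hε₀ : 0 ≤ ε)
  (hε : ε * |(2 * q - p : ℝ)| ≤ p / 2)

include hε₀ hε in
theorem rootFun_sub_ge (τ τ' : ℝ) :
    p / 2 * |τ - τ'| ≤ |rootFun p q k ε τ - rootFun p q k ε τ'| := by
  have h1 : rootFun p q k ε τ - rootFun p q k ε τ' = p * (τ - τ') + 2 * ε * ((-1 : ℝ) ^ k *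
      (Real.cos (τ * (2 * q - p) / 2) - Real.cos (τ' * (2 * q - p) / 2))) := by
    rw [rootFun, rootFun]; ring
  have h2 := Real.abs_cos_sub_cos_le (τ * (2 * q - p) / 2) (τ' * (2 * q - p) / 2)
  rw [show τ * (2 * q - p) / 2 - τ' * (2 * q - p) / 2 = (τ - τ') * ((2 * q - p) / 2) by ring,
    abs_mul, abs_div, abs_two] at h2
  have h3 : |2 * ε * ((-1 : ℝ) ^ k *
      (Real.cos (τ * (2 * q - p) / 2) - Real.cos (τ' * (2 * q - p) / 2)))| ≤ p / 2 * |τ - τ'| := by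
    rw [abs_mul (2 * ε), abs_mul ((-1 : ℝ) ^ k), abs_neg_one_zpow, one_mul,
      abs_of_nonneg (by linarith : 0 ≤ 2 * ε)]
    calc _ ≤ 2 * ε * (|τ - τ'| * (|(2 * q - p : ℝ)| / 2)) := by gcongr
      _ = ε * |(2 * q - p : ℝ)| * |τ - τ'| := by ring
      _ ≤ _ := by gcongr
  have h4 : |(p : ℝ) * (τ - τ')| ≤ |rootFun p q k ε τ - rootFun p q k ε τ'| + p / 2 * |τ - τ'| := by
    rw [h1]
    refine le_trans ?_ (add_le_add_right h3 _)
    have := abs_sub ((p : ℝ) * (τ - τ') + 2 * ε * ((-1 : ℝ) ^ k *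
      (Real.cos (τ * (2 * q - p) / 2) - Real.cos (τ' * (2 * q - p) / 2)))) (2 * ε * ((-1 : ℝ) ^ k *
      (Real.cos (τ * (2 * q - p) / 2) - Real.cos (τ' * (2 * q - p) / 2))))
    rwa [add_sub_cancel_right] at this
  have h5 : (p : ℝ) * |τ - τ'| ≤ |(p : ℝ) * (τ - τ')| := by
    rw [abs_mul]
    gcongr
    exact le_abs_self _
  linarith

theorem abs_rootFun_correction_le {ε : ℝ} (hε₀ : 0 ≤ ε) (x : ℝ) :
    |2 * ε * ((-1 : ℝ) ^ k * Real.cos x)| ≤ 2 * ε := by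
  rw [abs_mul (2 * ε), abs_mul ((-1 : ℝ) ^ k), abs_neg_one_zpow, one_mul,
    abs_of_nonneg (by linarith : 0 ≤ 2 * ε)]
  exact mul_le_of_le_one_right (by linarith) (Real.abs_cos_le_one _)

include hp hε₀ in
theorem abs_root_add_le {τ : ℝ} (h : rootFun p q k ε τ = 0) :
    |τ + 2 * Real.pi * k / p| ≤ 2 * ε / p := by
  have hp' : (0 : ℝ) < p := by exact_mod_cast hp
  rw [rootFun] at h
  have h1 := abs_rootFun_correction_le k hε₀ (τ * (2 * q - p) / 2)
  rw [le_div_iff₀ hp', ← abs_of_pos hp', ← abs_mul, abs_of_pos hp', add_mul,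
    div_mul_cancel₀ _ hp'.ne', show τ * p + 2 * Real.pi * k
      = -(2 * ε * ((-1 : ℝ) ^ k * Real.cos (τ * (2 * q - p) / 2))) by linarith, abs_neg]
  exact h1

include hp hε₀ in
theorem exists_root : ∃ τ, rootFun p q k ε τ = 0 := by
  have hp' : (0 : ℝ) < p := by exact_mod_cast hp
  have hc : Continuous (rootFun p q k ε) := by unfold rootFun; fun_prop
  have hle : (-(2 * Real.pi * k) - 2 * ε) / p ≤ (-(2 * Real.pi * k) + 2 * ε) / p := by
    gcongr; linarith
  have hmem : (0 : ℝ) ∈ Icc (rootFun p q k ε ((-(2 * Real.pi * k) - 2 * ε) / p))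
      (rootFun p q k ε ((-(2 * Real.pi * k) + 2 * ε) / p)) := by
    constructor <;> rw [rootFun, mul_div_cancel₀ _ hp'.ne']
    · linarith [(abs_le.1 (abs_rootFun_correction_le k hε₀
        ((-(2 * Real.pi * k) - 2 * ε) / p * (2 * q - p) / 2))).2]
    · linarith [(abs_le.1 (abs_rootFun_correction_le k hε₀
        ((-(2 * Real.pi * k) + 2 * ε) / p * (2 * q - p) / 2))).1]
  obtain ⟨τ, -, hτ⟩ := intermediate_value_Icc hle hc.continuousOn hmem
  exact ⟨τ, hτ⟩

include hp hε₀ hε in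
theorem root_unique {τ τ' : ℝ} (h : rootFun p q k ε τ = 0) (h' : rootFun p q k ε τ' = 0) :
    τ = τ' := by
  have hp' : (0 : ℝ) < p := by exact_mod_cast hp
  have := rootFun_sub_ge k hε₀ hε τ τ'
  rw [h, h', sub_self, abs_zero] at this
  have h0 : |τ - τ'| ≤ 0 := by nlinarith [abs_nonneg (τ - τ')]
  exact sub_eq_zero.1 (abs_nonpos_iff.1 h0)

end Root

/-- The zero of `rootFun` for `ε ≥ 0`, which is unique for small `ε`.  The value for `ε < 0` is
immaterial. -/
def root {p : ℤ} (hp : 0 < p) (q k : ℤ) (ε : ℝ) : ℝ := by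
  classical exact if h : 0 ≤ ε then (exists_root (q := q) hp k h).choose else 0

section Point

variable {p : ℤ} (hp : 0 < p) (q : ℤ)

theorem rootFun_root (k : ℤ) {ε : ℝ} (hε : 0 ≤ ε) : rootFun p q k ε (root hp q k ε) = 0 := by
  rw [root, dif_pos hε]
  exact (exists_root (q := q) hp k hε).choose_spec

theorem root_lipschitz (k : ℤ) {ε ε' : ℝ} (hε₀ : 0 ≤ ε) (hε₀' : 0 ≤ ε')
    (hε : ε * |(2 * q - p : ℝ)| ≤ p / 2) :
    |root hp q k ε - root hp q k ε'| ≤ 4 / p * |ε - ε'| := by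
  have hp' : (0 : ℝ) < p := by exact_mod_cast hp
  have h1 := rootFun_sub_ge k hε₀ hε (root hp q k ε) (root hp q k ε')
  have h2 := rootFun_root hp q k hε₀'
  set τ' := root hp q k ε'
  have h3 : rootFun p q k ε τ' = 2 * (ε - ε') * ((-1 : ℝ) ^ k * Real.cos (τ' * (2 * q - p) / 2)) := by
    rw [rootFun] at h2 ⊢
    linarith
  rw [rootFun_root hp q k hε₀, zero_sub, abs_neg, h3, abs_mul, abs_mul, abs_mul, abs_neg_one_zpow,
    one_mul, abs_two] at h1
  have h4 : 2 * |ε - ε'| * |Real.cos (τ' * (2 * q - p) / 2)| ≤ 2 * |ε - ε'| :=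
    mul_le_of_le_one_right (by positivity) (Real.abs_cos_le_one _)
  rw [div_mul_eq_mul_div, le_div_iff₀ hp']
  linarith

variable {q} (hpq : IsCoprime p q) {ε : ℝ} (hε : ε ∈ Ioo (0 : ℝ) 1)

include hε in
theorem abs_root_mem {k : ℤ} (hk : 2 * |k| ≤ p - 1) :
    |root hp q k ε| ∈ Ioo (0 : ℝ) Real.pi := by
  have hpi := Real.pi_gt_three
  have hp' : (0 : ℝ) < p := by exact_mod_cast hp
  have h := rootFun_root hp q k hε.1.le
  refine ⟨abs_pos.2 fun h0 => ?_, ?_⟩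
  · rw [h0, rootFun] at h
    simp only [mul_zero, zero_mul, zero_div, Real.cos_zero, mul_one, zero_add] at h
    have h1 : 2 * Real.pi * |(k : ℝ)| = 2 * ε := by
      have h2 : 2 * Real.pi * k = -(2 * ε * (-1 : ℝ) ^ k) := by linarith
      have h3 := congrArg abs h2
      rw [abs_neg, abs_mul (2 * Real.pi), abs_mul (2 * ε), abs_neg_one_zpow, mul_one,
        abs_of_pos (by positivity), abs_of_pos (show 0 < 2 * ε by linarith [hε.1])] at h3
      exact h3
    have h4 : |(k : ℝ)| < 1 := by nlinarith [hε.2, abs_nonneg (k : ℝ)]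
    have h5 : |k| < 1 := by exact_mod_cast h4
    have h6 : k = 0 := Int.abs_lt_one_iff.1 h5
    rw [h6] at h1
    simp at h1
    exact hε.1.ne' h1
  · have h1 := abs_root_add_le hp k hε.1.le h
    have h2 : |root hp q k ε| ≤ |root hp q k ε + 2 * Real.pi * k / p| + |2 * Real.pi * k / p| := by
      have := abs_sub (root hp q k ε + 2 * Real.pi * k / p) (2 * Real.pi * k / p)
      rwa [add_sub_cancel_right] at this
    have h3 : |2 * Real.pi * k / p| = 2 * Real.pi * |(k : ℝ)| / p := by
      rw [abs_div, abs_mul, abs_of_pos hp', abs_of_pos (by positivity : 0 < 2 * Real.pi)]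
    have h4 : 2 * |(k : ℝ)| ≤ p - 1 := by exact_mod_cast hk
    have h5 : 2 * ε / p + 2 * Real.pi * |(k : ℝ)| / p < Real.pi := by
      rw [← add_div, div_lt_iff₀ hp']
      nlinarith [hε.2]
    linarith

/-- The intersection point of index `k`. -/
def point {k : ℤ} (hk : 2 * |k| ≤ p - 1) : IntPt (zeroCurve ε hε) (linArc hp hpq).curve :=
  ⟨((angleAt p q k (root hp q k ε) : Real.Angle), ⟨|root hp q k ε|, abs_root_mem hp hε hk⟩), by
    apply Subtype.ext
    change toP (zeroLift ε (angleAt p q k (root hp q k ε)))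
      = toP (((|root hp q k ε| : ℝ) : ℂ) * arcDir p q)
    rw [zeroLift_angleAt (rootFun_root hp q k hε.1.le)]
    rcases abs_choice (root hp q k ε) with h | h <;> rw [h]
    · exact toP_eq_toP_iff.2 ⟨-k, 0, Or.inl (by
        rw [show 2 * -k = -(2 * k) by ring, mul_zero,
          show latticePt (-(2 * k)) 0 = -latticePt (2 * k) 0 by rw [latticePt_neg, neg_zero]]
        ring)⟩
    · exact toP_eq_toP_iff.2 ⟨k, 0, Or.inr (by rw [mul_zero]; push_cast; ring)⟩⟩

theorem exists_eq_point (hodd : Odd p) (hε' : ε * |(2 * q - p : ℝ)| ≤ p / 2)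
    (x : IntPt (zeroCurve ε hε) (linArc hp hpq).curve) :
    ∃ (k : ℤ) (hk : 2 * |k| ≤ p - 1), x = point hp hpq hε hk := by
  have hpi := Real.pi_gt_three
  have hp' : (0 : ℝ) < p := by exact_mod_cast hp
  obtain ⟨⟨θ, t⟩, hx⟩ := x
  induction θ using Real.Angle.induction_on with | h s => ?_
  have hx' : toP (zeroLift ε s) = toP ((t : ℝ) * arcDir p q) := congrArg Subtype.val hx
  obtain ⟨k, n, τ, hτ, hs, hroot⟩ := exists_root_of_toP_eq hx'
  have hτt : |τ| = t := by
    rcases hτ with rfl | rfl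
    · exact abs_of_pos t.2.1
    · rw [abs_neg, abs_of_pos t.2.1]
  have h1 := abs_root_add_le hp k hε.1.le hroot
  have h2 : |2 * Real.pi * k / p| ≤ |τ + 2 * Real.pi * k / p| + |τ| := by
    have := abs_sub (τ + 2 * Real.pi * k / p) τ
    rwa [add_sub_cancel_left] at this
  have h3 : |2 * Real.pi * k / p| = 2 * Real.pi * |(k : ℝ)| / p := by
    rw [abs_div, abs_mul, abs_of_pos hp', abs_of_pos (by positivity : 0 < 2 * Real.pi)]
  have h4 : 2 * Real.pi * |(k : ℝ)| < 2 * ε + Real.pi * p := by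
    have h5 : 2 * Real.pi * |(k : ℝ)| / p < 2 * ε / p + Real.pi := by
      rw [← h3]; linarith [t.2.2]
    rw [div_lt_iff₀ hp', add_mul, div_mul_cancel₀ _ hp'.ne'] at h5
    exact h5
  have h6 : 2 * |(k : ℝ)| < p + 1 := by nlinarith [hε.2]
  have h7 : 2 * |k| < p + 1 := by exact_mod_cast h6
  have hk : 2 * |k| ≤ p - 1 := by
    obtain ⟨j, rfl⟩ := hodd
    omega
  have hr : root hp q k ε = τ :=
    root_unique hp k hε.1.le hε' (rootFun_root hp q k hε.1.le) hroot
  refine ⟨k, hk, Subtype.ext (Prod.ext ?_ (Subtype.ext ?_))⟩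
  · change (s : Real.Angle) = angleAt p q k (root hp q k ε)
    rw [hr]
    exact Real.Angle.angle_eq_iff_two_pi_dvd_sub.2 ⟨n, by rw [hs]; ring⟩
  · change (t : ℝ) = |root hp q k ε|
    rw [hr, hτt]

variable {k : ℤ} (hk : 2 * |k| ≤ p - 1)

theorem abs_point_sub_le :
    |((point hp hpq hε hk).1.2 : ℝ) - 2 * Real.pi * |(k : ℝ)| / p| ≤ 2 * ε / p := by
  have hp' : (0 : ℝ) < p := by exact_mod_cast hp
  have hpi := Real.pi_pos
  have h1 := abs_root_add_le hp k hε.1.le (rootFun_root hp q k hε.1.le)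
  refine le_trans ?_ h1
  change |(|root hp q k ε| - 2 * Real.pi * |(k : ℝ)| / p)| ≤ _
  have h3 : 2 * Real.pi * |(k : ℝ)| / p = |-(2 * Real.pi * k / p)| := by
    rw [abs_neg, abs_div, abs_mul, abs_of_pos hp', abs_of_pos (by positivity : 0 < 2 * Real.pi)]
  rw [h3]
  refine (abs_abs_sub_abs_le_abs_sub _ _).trans (le_of_eq ?_)
  rw [sub_neg_eq_add]

/-- At the intersection point of index `k` the slope of `L₀` is greater or less than one, according
to the sign of `sin (2π k q / p)`. -/
theorem abs_cos_point_add_le : |(point hp hpq hε hk).1.1.cos + Real.sin (2 * Real.pi * k * q / p)|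
    ≤ ε * |(2 * q - p : ℝ)| / p := by
  have hp' : (0 : ℝ) < p := by exact_mod_cast hp
  have h1 := abs_root_add_le hp k hε.1.le (rootFun_root hp q k hε.1.le)
  have h2 : (point hp hpq hε hk).1.1.cos
      = (-1 : ℝ) ^ k * Real.sin (root hp q k ε * (2 * q - p) / 2) := by
    rw [← cos_angleAt]; rfl
  have h3 : Real.sin (2 * Real.pi * k * q / p)
      = -((-1 : ℝ) ^ k * Real.sin (-(2 * Real.pi * k / p) * (2 * q - p) / 2)) := by
    rw [← sin_pi_mul_add, show Real.pi * k + -(2 * Real.pi * k / p) * (2 * q - p) / 2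
      = -(2 * Real.pi * k * q / p) + k * (2 * Real.pi) by field_simp; ring,
      Real.sin_add_int_mul_two_pi, Real.sin_neg, neg_neg]
  rw [h2, h3, ← sub_eq_add_neg, ← mul_sub, abs_mul, abs_neg_one_zpow, one_mul]
  refine (Real.abs_sin_sub_sin_le _ _).trans ?_
  rw [show root hp q k ε * (2 * q - p) / 2 - -(2 * Real.pi * k / p) * (2 * q - p) / 2
    = (root hp q k ε + 2 * Real.pi * k / p) * ((2 * q - p) / 2) by ring, abs_mul, abs_div, abs_two]
  calc _ ≤ 2 * ε / p * (|(2 * q - p : ℝ)| / 2) := by gcongr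
    _ = _ := by ring

theorem sin_ne_zero_of_index (hodd : Odd p) (hpq : IsCoprime p q) {k : ℤ} (hk : 2 * |k| ≤ p - 1)
    (hk0 : k ≠ 0) : Real.sin (2 * Real.pi * k * q / p) ≠ 0 := by
  have hp' : (0 : ℝ) < p := by have := abs_nonneg k; exact_mod_cast (by omega : 0 < p)
  intro h
  obtain ⟨n, hn⟩ := Real.sin_eq_zero_iff.1 h
  rw [eq_div_iff hp'.ne'] at hn
  have h1 : (n : ℝ) * p = 2 * k * q := by
    have : Real.pi * ((n : ℝ) * p) = Real.pi * (2 * k * q) := by linarith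
    exact mul_left_cancel₀ Real.pi_ne_zero this
  have h2 : n * p = 2 * k * q := by exact_mod_cast h1
  have h3 : p ∣ 2 * k := hpq.dvd_of_dvd_mul_right ⟨n, by rw [← h2, mul_comm]⟩
  have h4 : p ∣ k := by
    refine IsCoprime.dvd_of_dvd_mul_left ?_ h3
    obtain ⟨j, rfl⟩ := hodd
    exact ⟨1, -j, by ring⟩
  have h5 := Int.le_of_dvd (abs_pos.2 hk0) ((dvd_abs p k).2 h4)
  have := abs_pos.2 hk0
  omega

theorem point_injective {k' : ℤ} (hk' : 2 * |k'| ≤ p - 1)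
    (hsin : ∀ k : ℤ, k ≠ 0 → 2 * |k| ≤ p - 1 →
      ε * |(2 * q - p : ℝ)| / p < |Real.sin (2 * Real.pi * k * q / p)|)
    (h : point hp hpq hε hk = point hp hpq hε hk') : k = k' := by
  have hpi := Real.pi_gt_three
  have hp' : (0 : ℝ) < p := by exact_mod_cast hp
  have h1 := abs_point_sub_le hp hpq hε hk
  have h1' := abs_point_sub_le hp hpq hε hk'
  rw [h] at h1
  have h2 : |2 * Real.pi * |(k : ℝ)| / p - 2 * Real.pi * |(k' : ℝ)| / p| ≤ 4 * ε / p := by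
    rw [abs_le] at h1 h1' ⊢
    have : 4 * ε / p = 2 * ε / p + 2 * ε / p := by ring
    constructor <;> linarith
  have h3 : |(|(k : ℝ)| - |(k' : ℝ)|)| < 1 := by
    rw [← sub_div, ← mul_sub, abs_div, abs_of_pos hp', div_le_div_iff_of_pos_right hp', abs_mul,
      abs_of_pos (by positivity)] at h2
    nlinarith [hε.2, abs_nonneg (|(k : ℝ)| - |(k' : ℝ)|)]
  have h4 : |(|k| - |k'|)| < 1 := by exact_mod_cast h3
  have h5 := Int.abs_lt_one_iff.1 h4
  rcases abs_eq_abs.1 (sub_eq_zero.1 h5) with h6 | h6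
  · exact h6
  · by_contra hne
    have hk0 : k' ≠ 0 := by rintro rfl; exact hne (by simpa using h6)
    have c1 := abs_cos_point_add_le hp hpq hε hk
    have c2 := abs_cos_point_add_le hp hpq hε hk'
    have c3 := hsin k' hk0 hk'
    rw [h, h6, show 2 * Real.pi * ((-k' : ℤ) : ℝ) * q / p = -(2 * Real.pi * k' * q / p) by
      push_cast; ring, Real.sin_neg] at c1
    rw [abs_le] at c1 c2
    rcases abs_choice (Real.sin (2 * Real.pi * k' * q / p)) with h | h <;> rw [h] at c3 <;> linarith

end Point

theorem isBranch_point {p q k : ℤ} (hp : 0 < p) (hpq : IsCoprime p q) (hk : 2 * |k| ≤ p - 1)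
    {ε₀ : ℝ} (hε₀ : ε₀ ≤ 1) (hN : ∀ ε ∈ Ioo 0 ε₀, ε * |(2 * q - p : ℝ)| ≤ p / 2) :
    IsBranch hε₀ (linArc hp hpq)
      (fun ε => point hp hpq ⟨ε.2.1, ε.2.2.trans_le hε₀⟩ hk) (2 * Real.pi * |(k : ℝ)| / p) := by
  have hp' : (0 : ℝ) < p := by exact_mod_cast hp
  constructor
  · have hc : Continuous fun ε : Ioo (0 : ℝ) ε₀ => root hp q k ε := by
      refine (LipschitzWith.of_dist_le_mul (K := Real.toNNReal (4 / p)) fun ε ε' => ?_).continuous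
      rw [Real.coe_toNNReal _ (by positivity), Real.dist_eq]
      exact root_lipschitz hp q k ε.2.1.le ε'.2.1.le (hN ε ε.2)
    refine Continuous.prodMk ?_ ?_
    · refine Real.Angle.continuous_coe.comp ?_
      unfold angleAt
      fun_prop
    · exact Continuous.subtype_mk hc.abs _
  · refine tendsto_iff_dist_tendsto_zero.2 (squeeze_zero (fun _ => dist_nonneg) (fun ε =>
      abs_point_sub_le hp hpq ⟨ε.2.1, ε.2.2.trans_le hε₀⟩ hk) ?_)
    have : Tendsto (fun ε : ℝ => 2 * ε / p) (𝓝 0) (𝓝 (2 * 0 / p)) :=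
      (Continuous.tendsto (by fun_prop) 0)
    rw [mul_zero, zero_div] at this
    exact this.comp tendsto_comap

/-! ### Vanishing of the Maslov index and of the differential -/

theorem lineDir_congr {v w : ℂ} (h : v = w) (hv : v ≠ 0) (hw : w ≠ 0) :
    lineDir ⟨v, hv⟩ = lineDir ⟨w, hw⟩ := by
  subst h; rfl

/-- For small `ε` the tangent lines of `L₀` are close to slope one, which is not the slope of the
arc. -/
theorem exists_transverse_mas_eq_zero {p q : ℤ} (hp : 0 < p) (hpq : IsCoprime p q) :
    ∃ δ > 0, ∀ (ε : ℝ) (hε : ε ∈ Ioo (0 : ℝ) 1), ε < δ →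
      Transverse (zeroCurve ε hε) (linArc hp hpq).curve ∧
      ∀ (x y : IntPt (zeroCurve ε hε) (linArc hp hpq).curve)
        (γ₀ : Path y.1.1 x.1.1) (γ₁ : Path x.1.2 y.1.2), mas slopeOne x y γ₀ γ₁ = 0 := by
  have hpi := Real.pi_pos
  have hp' : (0 : ℝ) < p := by exact_mod_cast hp
  have h1I : (1 : ℂ) + Complex.I ≠ 0 := fun h => by simpa using congrArg Complex.re h
  set c : Circle := lineDir ⟨1 + Complex.I, h1I⟩ with hc
  -- the direction of the arc in the frame in which slope one is the real direction
  set V : ℂ := ⟨2 * q - p, -p⟩ with hV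
  have hV0 : V ≠ 0 := fun h => by
    have : (-p : ℝ) = 0 := congrArg Complex.im h
    linarith
  set b : ℝ := Int.fract (Complex.arg V / Real.pi) with hb
  have hbV : Circle.exp (2 * Real.pi * b) = lineDir ⟨V, hV0⟩ := by
    rw [lineDir_eq_exp, show 2 * Complex.arg V = 2 * Real.pi * (Complex.arg V / Real.pi) by field_simp,
      exp_two_pi_eq_iff]
    exact ⟨-⌊Complex.arg V / Real.pi⌋, by rw [hb, Int.fract]; push_cast; ring⟩
  have hb1 : b < 1 := Int.fract_lt_one _
  have hb0 : 0 < b := by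
    refine (Int.fract_nonneg _).lt_of_ne fun h => ?_
    obtain ⟨n, hn⟩ := Int.fract_eq_zero_iff.1 h.symm
    have h2 : Real.sin (Complex.arg V) = 0 := by
      rw [eq_div_iff hpi.ne'] at hn
      rw [← hn]
      exact Real.sin_int_mul_pi n
    rw [Complex.sin_arg, div_eq_zero_iff] at h2
    rcases h2 with h2 | h2
    · have : (-p : ℝ) = 0 := h2
      linarith
    · exact hV0 (norm_eq_zero.1 h2)
  have hf : ContinuousAt (fun x : ℝ => Complex.arg (1 - x * Complex.I)) 0 :=
    ContinuousAt.comp (g := Complex.arg) (Complex.continuousAt_arg (Or.inl (by simp)))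
      (by fun_prop)
  obtain ⟨δ, hδ, hsmall⟩ := Metric.continuousAt_iff.1 hf (Real.pi * min b (1 - b))
    (mul_pos hpi (lt_min hb0 (by linarith)))
  refine ⟨δ, hδ, fun ε hε hεδ => ?_⟩
  let a : Circ → ℝ := fun θ => Complex.arg (1 - ((ε * θ.cos : ℝ) : ℂ) * Complex.I) / Real.pi
  have ha : Continuous a := by
    refine Continuous.div_const ?_ _
    refine continuous_iff_continuousAt.2 fun θ => ?_
    have h : Continuous fun θ : Circ => 1 - ((ε * θ.cos : ℝ) : ℂ) * Complex.I := by
      have := Real.Angle.continuous_cos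
      fun_prop
    exact ContinuousAt.comp (g := Complex.arg) (Complex.continuousAt_arg (Or.inl (by simp)))
      h.continuousAt
  have hab : ∀ θ, b - a θ ∈ Ioo (0 : ℝ) 1 := fun θ => by
    have h := hsmall (x := ε * θ.cos) (by
      rw [dist_zero_right, Real.norm_eq_abs, abs_mul, abs_of_pos hε.1]
      induction θ using Real.Angle.induction_on with | h s => ?_
      rw [Real.Angle.cos_coe]
      nlinarith [Real.abs_cos_le_one s, abs_nonneg (Real.cos s), hε.1])
    rw [Real.dist_eq] at h
    simp only [Complex.ofReal_zero, zero_mul, sub_zero, Complex.arg_one] at h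
    have h2 : |a θ| < min b (1 - b) := by
      simp only [a]
      rw [abs_div, abs_of_pos hpi, div_lt_iff₀ hpi, mul_comm (min b (1 - b))]
      exact h
    rw [lt_min_iff, abs_lt, abs_lt] at h2
    exact ⟨by linarith [h2.1.2], by linarith [h2.2.1]⟩
  have hl₀ : ∀ θ, (zeroCurve ε hε).line θ = Circle.exp (2 * Real.pi * a θ) * c := fun θ => by
    induction θ using Real.Angle.induction_on with | h s => ?_
    have hne : 1 - ((ε * Real.cos s : ℝ) : ℂ) * Complex.I ≠ 0 := fun h => by
      simpa using congrArg Complex.re h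
    have h1 : (zeroCurve ε hε).line (s : Real.Angle) = lineDir ⟨zeroVel ε s, zeroVel_ne_zero ε s⟩ :=
      rfl
    rw [h1, lineDir_congr (w := (1 - ((ε * Real.cos s : ℝ) : ℂ) * Complex.I) * (1 + Complex.I)) _ _
      (mul_ne_zero hne h1I), lineDir_mul hne h1I, lineDir_eq_exp]
    · congr 2
      simp only [a, Real.Angle.cos_coe]
      field_simp
    · simp only [zeroVel]
      push_cast
      linear_combination (ε * Complex.cos s) * Complex.I_sq
  have hl₁ : ∀ t, (linArc hp hpq).curve.line t = Circle.exp (2 * Real.pi * b) * c := fun t => by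
    have h1 : (linArc hp hpq).curve.line t = lineDir ⟨deriv (linArc hp hpq).lift t, _⟩ := rfl
    have hhalf : ((1 / 2 : ℝ) : ℂ) ≠ 0 := by norm_num
    rw [h1, hbV, hc, ← lineDir_mul hV0 h1I,
      lineDir_congr (w := ((1 / 2 : ℝ) : ℂ) * (V * (1 + Complex.I))) _ _
        (mul_ne_zero hhalf (mul_ne_zero hV0 h1I)),
      lineDir_mul hhalf (mul_ne_zero hV0 h1I), lineDir_ofReal, one_mul]
    rw [deriv_linArc]
    apply Complex.ext
    · rw [arcDir_re, Complex.re_ofReal_mul, hV, Complex.mul_re]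
      simp
    · rw [arcDir_im, Complex.im_ofReal_mul, hV, Complex.mul_im]
      simp
      ring
  refine ⟨fun x h => ?_, fun x y γ₀ γ₁ => mas_slopeOne_eq_zero ha (fun _ => rfl) hl₀ hl₁ hab x y γ₀ γ₁⟩
  rw [hl₀, hl₁, mul_left_inj, exp_two_pi_eq_iff] at h
  obtain ⟨n, hn⟩ := h
  have hx := hab x.1.1
  have n1 : (-1 : ℝ) < n := by linarith [hx.2]
  have n2 : (n : ℝ) < 0 := by linarith [hx.1]
  have n1' : -1 < n := by exact_mod_cast n1
  have n2' : n < 0 := by exact_mod_cast n2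
  omega

section Homology

variable {R₀ R₁ : Type} [TopologicalSpace R₀] [TopologicalSpace R₁]
  {L₀ : TangentCurve R₀} {L₁ : TangentCurve R₁}

theorem isEmpty_moduli {x y : IntPt L₀ L₁}
    (h : ∀ (γ₀ : Path y.1.1 x.1.1) (γ₁ : Path x.1.2 y.1.2), mas slopeOne x y γ₀ γ₁ = 0) :
    IsEmpty (Moduli L₀ L₁ x y) := by
  refine ⟨fun m => ?_⟩
  obtain ⟨b, -⟩ := Quot.exists_rep m
  have := b.maslov
  rw [h] at this
  exact zero_ne_one this

theorem bdry_eq_zero (h : ∀ x y, IsEmpty (Moduli L₀ L₁ x y)) : bdry L₀ L₁ = 0 := by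
  refine Finsupp.lhom_ext fun x a => ?_
  rw [bdry, Finsupp.linearCombination_single, LinearMap.zero_apply]
  have : ∀ y, Finsupp.single y (Nat.card (Moduli L₀ L₁ x y) : ZMod 2)
      = (0 : Cplx L₀ L₁) := fun y => by
    have := h x y
    rw [Nat.card_of_isEmpty, Nat.cast_zero, Finsupp.single_zero]
  simp only [this, finsum_zero, smul_zero]

/-- If the differential vanishes then the complex is its own homology. -/
theorem exists_equiv_homology (h : bdry L₀ L₁ = 0) : ∃ e : Cplx L₀ L₁ ≃ₗ[ZMod 2] HF L₀ L₁,
    (∀ c : Cyc L₀ L₁, e c = homologyClass c) ∧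
      ∀ (deg : IntPt L₀ L₁ → ZMod 4) (i : ZMod 4),
        (degPart deg i).map e.toLinearMap = degPartHF deg i := by
  have hC : Cyc L₀ L₁ = ⊤ := by rw [Cyc, h, LinearMap.ker_zero]
  have hB : Bnd L₀ L₁ = ⊥ := by
    rw [Bnd, h, LinearMap.range_zero, Submodule.comap_bot, Submodule.ker_subtype]
  let e : Cplx L₀ L₁ ≃ₗ[ZMod 2] HF L₀ L₁ :=
    (LinearEquiv.ofTop _ hC).symm.trans (Submodule.quotEquivOfEqBot _ hB).symm
  have he : ∀ c : Cyc L₀ L₁, e c = homologyClass c := fun c => rfl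
  refine ⟨e, he, fun deg i => le_antisymm ?_ ?_⟩
  · rintro _ ⟨c, hc, rfl⟩
    exact ⟨⟨c, hC ▸ Submodule.mem_top⟩, hc, rfl⟩
  · rintro _ ⟨c, hc, rfl⟩
    exact ⟨c, hc, he c⟩

end Homology

/-! ### The grading of neighbouring intersection points -/

/-- The points of index `±k` with `k ≠ 0` are the two intersection points near the same point of the
arc, on the two strands of `L₀`.  The loop through them encircles the corner between the strands. -/
theorem gr_point_neg {p q : ℤ} (hp : 0 < p) (hpq : IsCoprime p q) {ε : ℝ} (hε : ε ∈ Ioo (0 : ℝ) 1)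
    (hN : ε * |(2 * q - p : ℝ)| ≤ p / 2) {zt : C(PStar, Circle)} (hz : LiftsZ zt)
    (h0 : ∀ (x y : IntPt (zeroCurve ε hε) (linArc hp hpq).curve)
      (γ₀ : Path y.1.1 x.1.1) (γ₁ : Path x.1.2 y.1.2), mas slopeOne x y γ₀ γ₁ = 0)
    {k : ℤ} (hk0 : k ≠ 0) (hk : 2 * |k| ≤ p - 1) (hk' : 2 * |(-k)| ≤ p - 1)
    (hcos : 0 < (point hp hpq hε hk).1.1.cos) (hcos' : (point hp hpq hε hk').1.1.cos < 0) :
    gr zt (point hp hpq hε hk) (point hp hpq hε hk') = 1 := by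
  have hpi := Real.pi_gt_three
  have hp' : (0 : ℝ) < p := by exact_mod_cast hp
  set τ := root hp q k ε with hτ
  set τ' := root hp q (-k) ε with hτ'
  have hroot : rootFun p q k ε τ = 0 := rootFun_root hp q k hε.1.le
  have hroot' : rootFun p q (-k) ε τ' = 0 := rootFun_root hp q (-k) hε.1.le
  have b1 := abs_le.1 (abs_root_add_le hp k hε.1.le hroot)
  have b2 := abs_le.1 (abs_root_add_le hp (-k) hε.1.le hroot')
  have hkk : 2 * Real.pi * ((-k : ℤ) : ℝ) / p = -(2 * Real.pi * k / p) := by push_cast; ring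
  rw [hkk] at b2
  -- the parameters `τ` and `τ'` have opposite signs
  have hbig : 2 * ε / p < 2 * Real.pi * |(k : ℝ)| / p := by
    have : (1 : ℝ) ≤ |(k : ℝ)| := by exact_mod_cast Int.one_le_abs hk0
    rw [div_lt_div_iff_of_pos_right hp']
    nlinarith [hε.2]
  obtain ⟨e, he, h1, h2⟩ : ∃ e : ℝ, (e = 1 ∨ e = -1) ∧ e * |τ| = τ ∧ e * |τ'| = -τ' := by
    rcases hk0.lt_or_gt with h | h
    · have hkr : (k : ℝ) < 0 := by exact_mod_cast h
      have : 2 * Real.pi * |(k : ℝ)| / p = -(2 * Real.pi * k / p) := by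
        rw [abs_of_neg hkr]; ring
      rw [this] at hbig
      refine ⟨1, Or.inl rfl, ?_, ?_⟩
      · rw [abs_of_pos (by linarith), one_mul]
      · rw [abs_of_neg (by linarith), one_mul]
    · have hkr : (0 : ℝ) < k := by exact_mod_cast h
      rw [abs_of_pos hkr] at hbig
      refine ⟨-1, Or.inr rfl, ?_, ?_⟩
      · rw [abs_of_neg (by linarith)]; ring
      · rw [abs_of_pos (by linarith)]; ring
  -- real lifts of the two points of `L₀`, nearly symmetric about `π / 2`
  set s := (point hp hpq hε hk).1.1.toReal with hs
  have hs1 := abs_lt.1 (Real.Angle.cos_pos_iff_abs_toReal_lt_pi_div_two.1 hcos)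
  rw [← hs] at hs1
  obtain ⟨n, hn⟩ : ∃ n : ℤ, s = angleAt p q k τ + n * (2 * Real.pi) := by
    have h : ((s : ℝ) : Real.Angle) = (angleAt p q k τ : ℝ) := Real.Angle.coe_toReal _
    obtain ⟨n, hn⟩ := Real.Angle.angle_eq_iff_two_pi_dvd_sub.1 h
    exact ⟨n, by linarith⟩
  set s' := angleAt p q (-k) τ' + (1 - n : ℤ) * (2 * Real.pi) with hs'
  have hs'coe : ((s' : ℝ) : Real.Angle) = (point hp hpq hε hk').1.1 := by
    change _ = ((angleAt p q (-k) τ' : ℝ) : Real.Angle)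
    exact Real.Angle.angle_eq_iff_two_pi_dvd_sub.2 ⟨1 - n, by rw [hs']; ring⟩
  have hsum : s + s' = Real.pi + (τ + τ') * ((2 * q - p) / 2) := by
    rw [hn, hs', angleAt, angleAt]; push_cast; ring
  have hsmall : |(τ + τ') * ((2 * q - p : ℝ) / 2)| ≤ 1 := by
    have h3 : |τ + τ'| ≤ 4 * ε / p := by
      have : 4 * ε / p = 2 * ε / p + 2 * ε / p := by ring
      rw [abs_le]; constructor <;> linarith [b1.1, b1.2, b2.1, b2.2]
    rw [abs_mul, abs_div, abs_two]
    calc _ ≤ 4 * ε / p * (|(2 * q - p : ℝ)| / 2) := by gcongr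
      _ = 2 * (ε * |(2 * q - p : ℝ)|) / p := by ring
      _ ≤ 2 * (p / 2) / p := by gcongr
      _ = 1 := by field_simp
  rw [abs_le] at hsmall
  have hcs' : Real.cos s' < 0 := by
    rw [← Real.Angle.cos_coe, hs'coe]; exact hcos'
  have hs2 : s' ∈ Ioo (Real.pi / 2) (3 * Real.pi / 2) := by
    constructor
    · by_contra! h
      exact hcs'.not_ge (Real.cos_nonneg_of_neg_pi_div_two_le_of_le (by linarith [hs1.2]) h)
    · by_contra! h
      rw [← Real.cos_sub_two_pi] at hcs'
      exact hcs'.not_ge (Real.cos_nonneg_of_neg_pi_div_two_le_of_le (by linarith)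
        (by linarith [hs1.1]))
  refine gr_eq_one hz h0 (W := arcDir p q) (fun t => rfl) (s₁ := s) (s₂ := s')
    (Real.Angle.coe_toReal _) hs'coe hs1 hs2 he (m := k + n) (n := n) ?_ ?_
  · change _ = (e : ℂ) * ((|τ| : ℝ) : ℂ) * arcDir p q + _
    rw [← Complex.ofReal_mul, h1, hn, zeroLift_add, zeroLift_angleAt hroot, add_assoc, latticePt_add]
    congr 2 <;> ring
  · change _ = (e : ℂ) * ((|τ'| : ℝ) : ℂ) * arcDir p q + _
    rw [← Complex.ofReal_mul, h2, hs', zeroLift_add, zeroLift_angleAt hroot', add_assoc,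
      latticePt_add, sub_eq_add_neg, neg_add, latticePt_neg, add_left_comm, latticePt_add,
      Complex.ofReal_neg, neg_mul]
    congr 2 <;> ring

/-! ### The intersection points and the restriction map -/

/-- A bound for `ε` below which the intersection points are separated by the sign of the cosine of
their parameters on `L₀`, are the `p` expected ones, and have vanishing Maslov indices with respect
to the line field of slope one. -/
theorem exists_small_parameter {p q : ℤ} (hp : 0 < p) (hodd : Odd p) (hpq : IsCoprime p q) :
    ∃ ε₀ : ℝ, 0 < ε₀ ∧ ε₀ ≤ 1 ∧ ∀ ε ∈ Ioo 0 ε₀, ε * |(2 * q - p : ℝ)| ≤ p / 2 ∧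
      (∀ k : ℤ, k ≠ 0 → 2 * |k| ≤ p - 1 →
        ε * |(2 * q - p : ℝ)| / p < |Real.sin (2 * Real.pi * k * q / p)|) ∧
      ∀ hε : ε ∈ Ioo (0 : ℝ) 1, Transverse (zeroCurve ε hε) (linArc hp hpq).curve ∧
        ∀ (x y : IntPt (zeroCurve ε hε) (linArc hp hpq).curve) (γ₀ : Path y.1.1 x.1.1)
          (γ₁ : Path x.1.2 y.1.2), mas slopeOne x y γ₀ γ₁ = 0 := by
  have hp' : (0 : ℝ) < p := by exact_mod_cast hp
  obtain ⟨δ, hδ, hmas⟩ := exists_transverse_mas_eq_zero hp hpq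
  have h1 : ∀ᶠ ε : ℝ in 𝓝[>] 0, ε * |(2 * q - p : ℝ)| < p / 2 :=
    have hc : Continuous fun ε : ℝ => ε * |(2 * q - p : ℝ)| := by fun_prop
    ((hc.tendsto' _ _ (zero_mul _)).mono_left nhdsWithin_le_nhds).eventually_lt_const
      (half_pos hp')
  have h2 : ∀ᶠ ε : ℝ in 𝓝[>] 0, ∀ k ∈ {k : ℤ | k ≠ 0 ∧ 2 * |k| ≤ p - 1},
      ε * |(2 * q - p : ℝ)| / p < |Real.sin (2 * Real.pi * k * q / p)| := by
    have hfin : {k : ℤ | k ≠ 0 ∧ 2 * |k| ≤ p - 1}.Finite :=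
      (finite_Icc (-p) p).subset fun k hk => by
        have := abs_le.1 (by have := hk.2; have := abs_nonneg k; omega : |k| ≤ p)
        exact this
    refine (eventually_all_finite hfin).2 fun k hk => ?_
    refine Tendsto.eventually_lt_const (abs_pos.2 (sin_ne_zero_of_index hodd hpq hk.2 hk.1)) ?_
    have hc : Continuous fun ε : ℝ => ε * |(2 * q - p : ℝ)| / p := by fun_prop
    exact (hc.tendsto' _ _ (by simp)).mono_left nhdsWithin_le_nhds
  have h3 : ∀ᶠ ε : ℝ in 𝓝[>] 0, ε < δ :=
    (tendsto_id.mono_left nhdsWithin_le_nhds).eventually_lt_const hδ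
  obtain ⟨u, hu, hsub⟩ := mem_nhdsGT_iff_exists_Ioo_subset.1 (h1.and (h2.and h3))
  refine ⟨min u 1, lt_min hu one_pos, min_le_right _ _, fun ε hε => ?_⟩
  obtain ⟨e1, e2, e3⟩ := hsub ⟨hε.1, hε.2.trans_le (min_le_left _ _)⟩
  exact ⟨e1.le, fun k hk hk' => e2 k ⟨hk, hk'⟩, fun hε' => hmas ε hε' e3⟩

/-- The index of the intersection point `x_{i+1}⁺`: of the two indices `±(i + 1)` it is the one
whose point has positive cosine on `L₀`. -/
def posIndex (p q : ℤ) (i : ℕ) : ℤ :=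
  if 0 < Real.sin (2 * Real.pi * ((i : ℤ) + 1 : ℤ) * q / p) then -(i + 1) else i + 1

section PosIndex

variable {p q : ℤ}

theorem posIndex_eq (i : ℕ) : posIndex p q i = i + 1 ∨ posIndex p q i = -(i + 1) := by
  rw [posIndex]; split_ifs
  exacts [Or.inr rfl, Or.inl rfl]

theorem abs_posIndex (i : ℕ) : |posIndex p q i| = i + 1 := by
  rcases posIndex_eq (p := p) (q := q) i with h | h <;> rw [h]
  · exact abs_of_nonneg (by omega)
  · rw [abs_neg]; exact abs_of_nonneg (by omega)

theorem posIndex_ne_zero (i : ℕ) : posIndex p q i ≠ 0 :=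
  abs_pos.1 (by rw [abs_posIndex]; omega)

theorem two_mul_abs_posIndex_le (i : Fin ((p - 1) / 2).toNat) :
    2 * |posIndex p q i| ≤ p - 1 := by
  rw [abs_posIndex]; have := i.2; omega

theorem two_mul_abs_neg_posIndex_le (i : Fin ((p - 1) / 2).toNat) :
    2 * |-posIndex p q i| ≤ p - 1 := by
  rw [abs_neg]; exact two_mul_abs_posIndex_le i

theorem sin_posIndex_nonpos (i : ℕ) : Real.sin (2 * Real.pi * posIndex p q i * q / p) ≤ 0 := by
  rw [posIndex]; split_ifs with h
  · rw [show 2 * Real.pi * ((-(i + 1) : ℤ) : ℝ) * q / p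
      = -(2 * Real.pi * ((i : ℤ) + 1 : ℤ) * q / p) by push_cast; ring, Real.sin_neg]
    linarith
  · exact not_lt.1 h

/-- Every index of an intersection point is `0` or of the form `± posIndex p q i`. -/
theorem index_cases {k : ℤ} (hk : 2 * |k| ≤ p - 1) : k = 0 ∨
    ∃ i : Fin ((p - 1) / 2).toNat, k = posIndex p q i ∨ k = -posIndex p q i := by
  by_cases hk0 : k = 0
  · exact Or.inl hk0
  have h1 : 0 < |k| := abs_pos.2 hk0
  refine Or.inr ⟨⟨(|k| - 1).toNat, by omega⟩, ?_⟩
  have h2 : |k| = |posIndex p q (|k| - 1).toNat| := by rw [abs_posIndex]; omega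
  exact abs_eq_abs.1 h2

end PosIndex

section Points

variable {p q : ℤ} (hp : 0 < p) (hpq : IsCoprime p q) {ε : ℝ} (hε : ε ∈ Ioo (0 : ℝ) 1)
  (hsin : ∀ k : ℤ, k ≠ 0 → 2 * |k| ≤ p - 1 →
    ε * |(2 * q - p : ℝ)| / p < |Real.sin (2 * Real.pi * k * q / p)|)
include hsin

theorem cos_point_posIndex (i : Fin ((p - 1) / 2).toNat) :
    0 < (point hp hpq hε (two_mul_abs_posIndex_le (q := q) i)).1.1.cos := by
  have h1 := abs_le.1 (abs_cos_point_add_le hp hpq hε (two_mul_abs_posIndex_le (q := q) i))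
  have h2 := hsin _ (posIndex_ne_zero i) (two_mul_abs_posIndex_le (q := q) i)
  rw [abs_of_nonpos (sin_posIndex_nonpos _)] at h2
  linarith [h1.1]

theorem cos_point_neg_posIndex (i : Fin ((p - 1) / 2).toNat) :
    (point hp hpq hε (two_mul_abs_neg_posIndex_le (q := q) i)).1.1.cos < 0 := by
  have h1 := abs_le.1 (abs_cos_point_add_le hp hpq hε (two_mul_abs_neg_posIndex_le (q := q) i))
  have h2 := hsin _ (posIndex_ne_zero i) (two_mul_abs_posIndex_le (q := q) i)
  rw [abs_of_nonpos (sin_posIndex_nonpos _)] at h2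
  rw [show 2 * Real.pi * ((-posIndex p q i : ℤ) : ℝ) * q / p
      = -(2 * Real.pi * (posIndex p q i) * q / p) by push_cast; ring, Real.sin_neg] at h1
  linarith [h1.2]

theorem bijective_points (hodd : Odd p) (hN : ε * |(2 * q - p : ℝ)| ≤ p / 2)
    (h0 : 2 * |(0 : ℤ)| ≤ p - 1) :
    Function.Bijective (fun c : Unit ⊕ Fin ((p - 1) / 2).toNat ⊕ Fin ((p - 1) / 2).toNat =>
      Sum.elim (fun _ => point hp hpq hε h0)
        (Sum.elim (fun i => point hp hpq hε (two_mul_abs_posIndex_le (q := q) i))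
          (fun i => point hp hpq hε (two_mul_abs_neg_posIndex_le (q := q) i))) c) := by
  have hP := two_mul_abs_posIndex_le (p := p) (q := q)
  have hM := two_mul_abs_neg_posIndex_le (p := p) (q := q)
  have hinj : ∀ {k k' : ℤ} (hk : 2 * |k| ≤ p - 1) (hk' : 2 * |k'| ≤ p - 1),
      point hp hpq hε hk = point hp hpq hε hk' → k = k' := fun hk hk' h =>
    point_injective hp hpq hε hk hk' hsin h
  have habs : ∀ i j : Fin ((p - 1) / 2).toNat,
      |posIndex p q i| = |posIndex p q j| → i = j := fun i j h => by
    rw [abs_posIndex, abs_posIndex] at h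
    exact Fin.ext (by omega)
  have hne : ∀ i j : Fin ((p - 1) / 2).toNat, posIndex p q i ≠ -posIndex p q j := fun i j h => by
    have hij := habs i j (by rw [h, abs_neg])
    subst hij
    have := posIndex_ne_zero (p := p) (q := q) i
    omega
  constructor
  · rintro (_ | i | i) (_ | j | j) h
    · rfl
    · exact absurd (hinj h0 (hP j) h).symm (posIndex_ne_zero j)
    · exact absurd (neg_eq_zero.1 (hinj h0 (hM j) h).symm) (posIndex_ne_zero j)
    · exact absurd (hinj (hP i) h0 h) (posIndex_ne_zero i)
    · rw [habs i j (congrArg _ (hinj (hP i) (hP j) h))]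
    · exact absurd (hinj (hP i) (hM j) h) (hne i j)
    · exact absurd (neg_eq_zero.1 (hinj (hM i) h0 h)) (posIndex_ne_zero i)
    · exact absurd (hinj (hM i) (hP j) h).symm (hne j i)
    · rw [habs i j (congrArg _ (neg_injective (hinj (hM i) (hM j) h)))]
  · intro x
    obtain ⟨k, hk, rfl⟩ := exists_eq_point hp hpq hε hodd hN x
    obtain rfl | ⟨i, rfl | rfl⟩ := index_cases (q := q) hk
    exacts [⟨Sum.inl (), rfl⟩, ⟨Sum.inr (Sum.inl i), rfl⟩, ⟨Sum.inr (Sum.inr i), rfl⟩]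

end Points

theorem finrank_cplx {R₀ R₁ : Type} [TopologicalSpace R₀] [TopologicalSpace R₁]
    {L₀ : TangentCurve R₀} {L₁ : TangentCurve R₁} {N : ℕ}
    {f : Unit ⊕ Fin N ⊕ Fin N → IntPt L₀ L₁} (hf : Function.Bijective f) :
    Module.finrank (ZMod 2) (Cplx L₀ L₁) = 2 * N + 1 := by
  let _ := Fintype.ofBijective f hf
  rw [Module.finrank_finsupp_self, ← Fintype.card_of_bijective hf]
  simp only [Fintype.card_sum, Fintype.card_unit, Fintype.card_fin]
  ring

/-- The restriction map from the character variety of the tangle to the pillowcase. -/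
def restrictionMap {p q : ℤ} (hp : 0 < p) (hpq : IsCoprime p q) {w : List Crossing}
    (o : LinkOrientation w) : C(RTangle w, Pillowcase) where
  toFun ρ := toP ((linArc hp hpq).lift ((cupHomeo o).symm ρ))
  continuous_toFun := (isEmbedding_linArc hp hpq le_rfl le_rfl).continuous.comp
    (cupHomeo o).symm.continuous

theorem isEmbedding_restrictionMap {p q : ℤ} (hp : 0 < p) (hpq : IsCoprime p q)
    {w : List Crossing} (o : LinkOrientation w) : IsEmbedding (restrictionMap hp hpq o) :=
  (isEmbedding_linArc hp hpq le_rfl le_rfl).comp (cupHomeo o).symm.isEmbedding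

theorem restrictionMap_eq_toP_iff {p q : ℤ} (hp : 0 < p) (hpq : IsCoprime p q)
    {l : List (ℤ × ℤ)} (hl : IsExpansion l p q) (o : LinkOrientation (tangleWord l))
    (ρ : RTangle (tangleWord l)) (z : ℂ) :
    restrictionMap hp hpq o ρ = toP z ↔ psi o z = restrictToSphere (tangleWord l) ρ := by
  obtain ⟨t, rfl⟩ := (cupHomeo o).surjective ρ
  rw [restrictToSphere_tangleWord hl, psi_eq_psi_iff, ← toP_eq_toP_iff, eq_comm (a := toP z)]
  change toP ((linArc hp hpq).lift ((cupHomeo o).symm (cupHomeo o t))) = toP z ↔ _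
  rw [Homeomorph.symm_apply_apply]
  rfl

end

end TwoBridge

theorem theorem6p1 (p q : ℤ) (hp : 0 < p) (hodd : Odd p) (hpq : IsCoprime p q)
    (l : List (ℤ × ℤ)) (hl : IsExpansion l p q) (o : LinkOrientation (tangleWord l)) :
    -- the class `z` exists
    (∃ zt : C(PStar, Circle), LiftsZ zt) ∧
    -- the restriction map `L₁ : R(Y, T) → P`
    ∃ (L₁ : C(RTangle (tangleWord l), Pillowcase)) (A : ProperArc)
      (h : Icc (0 : ℝ) Real.pi ≃ₜ RTangle (tangleWord l)),
      (∀ ρ z, L₁ ρ = toP z ↔ psi o z = restrictToSphere (tangleWord l) ρ) ∧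
      -- is a linearly embedded, restricted immersed arc
      (∀ t : ℝ, A.lift t = t * ((q : ℂ) + ((q - p : ℤ) : ℂ) * Complex.I)) ∧
      (∀ t, L₁ (h t) = toP (A.lift t)) ∧
      Topology.IsEmbedding L₁ ∧
      A.IsRestricted ∧
      -- the intersection points with `L₀`, for small `ε`
      ∃ (ε₀ : ℝ) (_ : 0 < ε₀) (hε₀ : ε₀ ≤ 1)
        (r : ∀ ε : Ioo (0 : ℝ) ε₀, IntPt (L₀ hε₀ ε) A.curve)
        (xp xm : Fin ((p - 1) / 2).toNat → ∀ ε : Ioo (0 : ℝ) ε₀,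
          IntPt (L₀ hε₀ ε) A.curve),
        IsBranch hε₀ A r 0 ∧
        (∀ i, IsBranch hε₀ A (xp i) (2 * Real.pi * ((i : ℕ) + 1) / p)) ∧
        (∀ i, IsBranch hε₀ A (xm i) (2 * Real.pi * ((i : ℕ) + 1) / p)) ∧
        ∀ ε : Ioo (0 : ℝ) ε₀,
          -- the slope of `L₀` is less than one at `xp`, greater than one at `xm`
          (∀ i, 0 < (xp i ε).1.1.cos ∧ (xm i ε).1.1.cos < 0) ∧
          -- the complex
          Transverse (L₀ hε₀ ε) A.curve ∧
          Function.Bijective (fun c : Unit ⊕ Fin ((p - 1) / 2).toNat ⊕ Fin ((p - 1) / 2).toNat =>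
            Sum.elim (fun _ => r ε) (Sum.elim (fun i => xp i ε) (fun i => xm i ε)) c) ∧
          (Module.finrank (ZMod 2) (Cplx (L₀ hε₀ ε) A.curve) : ℤ) = p ∧
          (∀ x y, Finite (Moduli (L₀ hε₀ ε) A.curve x y)) ∧
          bdry (L₀ hε₀ ε) A.curve = 0 ∧
          ∀ zt : C(PStar, Circle), LiftsZ zt →
            -- the relative grading is well defined
            (∀ (x y : IntPt (L₀ hε₀ ε) A.curve)
              (γ₀ : Path y.1.1 x.1.1) (γ₁ : Path x.1.2 y.1.2),
              (mas (instField zt) x y γ₀ γ₁ : ZMod 4) = gr zt x y) ∧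
            -- the gradings
            absGr zt (r ε) (signature o) (r ε) = (signature o : ZMod 4) ∧
            (∀ i, gr zt (xp i ε) (xm i ε) = 1) ∧
            (|q| < |q - p| → ∀ i (α₀ : Path (r ε).1.1 (xp i ε).1.1)
              (α₁ : Path (xp i ε).1.2 (r ε).1.2),
              gr zt (r ε) (xp i ε) = zEval zt (loopThrough (r ε) (xp i ε) α₀ α₁)) ∧
            (|q - p| < |q| → ∀ i (α₀ : Path (r ε).1.1 (xm i ε).1.1)
              (α₁ : Path (xm i ε).1.2 (r ε).1.2),
              gr zt (r ε) (xm i ε) = zEval zt (loopThrough (r ε) (xm i ε) α₀ α₁)) ∧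
            -- the complex is isomorphic to its homology, as a graded vector space
            ∃ e : Cplx (L₀ hε₀ ε) A.curve ≃ₗ[ZMod 2]
                HF (L₀ hε₀ ε) A.curve,
              (∀ c : Cyc (L₀ hε₀ ε) A.curve,
                e c = homologyClass c) ∧
              ∀ i : ZMod 4, (degPart (absGr zt (r ε) (signature o)) i).map e.toLinearMap =
                degPartHF (absGr zt (r ε) (signature o)) i := by
  have hp' : (0 : ℝ) < p := by exact_mod_cast hp
  obtain ⟨ε₀, hε₀pos, hε₀, hsmall⟩ := exists_small_parameter hp hodd hpq
  have h0 : 2 * |(0 : ℤ)| ≤ p - 1 := by rw [abs_zero]; omega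
  have hcast : ∀ i : Fin ((p - 1) / 2).toNat, |(posIndex p q i : ℝ)| = (i : ℕ) + 1 := fun i => by
    exact_mod_cast congrArg (Int.cast : ℤ → ℝ) (abs_posIndex (p := p) (q := q) i)
  refine ⟨⟨stdZ, stdZ_liftsZ⟩, restrictionMap hp hpq o, linArc hp hpq, cupHomeo o,
    restrictionMap_eq_toP_iff hp hpq hl o, fun t => rfl, fun t => ?_,
    isEmbedding_restrictionMap hp hpq o, linArc_isRestricted hp hpq, ε₀, hε₀pos, hε₀,
    fun ε => point hp hpq ⟨ε.2.1, ε.2.2.trans_le hε₀⟩ h0,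
    fun i ε => point hp hpq ⟨ε.2.1, ε.2.2.trans_le hε₀⟩ (two_mul_abs_posIndex_le (q := q) i),
    fun i ε => point hp hpq ⟨ε.2.1, ε.2.2.trans_le hε₀⟩ (two_mul_abs_neg_posIndex_le (q := q) i),
    ?_, fun i => ?_, fun i => ?_, fun ε => ?_⟩
  · change toP ((linArc hp hpq).lift ((cupHomeo o).symm (cupHomeo o t))) = _
    rw [Homeomorph.symm_apply_apply]
  · simpa using isBranch_point hp hpq h0 hε₀ fun ε hε => (hsmall ε hε).1
  · have h := isBranch_point hp hpq (two_mul_abs_posIndex_le (q := q) i) hε₀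
      fun ε hε => (hsmall ε hε).1
    rwa [hcast] at h
  · have h := isBranch_point hp hpq (two_mul_abs_neg_posIndex_le (q := q) i) hε₀
      fun ε hε => (hsmall ε hε).1
    rwa [Int.cast_neg, abs_neg, hcast] at h
  · have hε : (ε : ℝ) ∈ Ioo (0 : ℝ) 1 := ⟨ε.2.1, ε.2.2.trans_le hε₀⟩
    obtain ⟨hN, hsin, hmas⟩ := hsmall ε ε.2
    obtain ⟨htrans, hmas⟩ := hmas hε
    have hbij := bijective_points hp hpq hε hsin hodd hN h0
    have hempty : ∀ x y, IsEmpty (Moduli (L₀ hε₀ ε) (linArc hp hpq).curve x y) :=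
      fun x y => isEmpty_moduli (hmas x y)
    have hbdry := bdry_eq_zero hempty
    refine ⟨fun i => ⟨cos_point_posIndex hp hpq hε hsin i, cos_point_neg_posIndex hp hpq hε hsin i⟩,
      htrans, hbij, ?_, fun x y => @Finite.of_subsingleton _ (hempty x y).instSubsingleton,
      hbdry, fun zt hz => ⟨mas_instField_eq_gr hz hmas, ?_, fun i => ?_,
        fun _ i => gr_eq_zEval hz hmas _ _, fun _ i => gr_eq_zEval hz hmas _ _, ?_⟩⟩
    · rw [finrank_cplx hbij]
      obtain ⟨m, rfl⟩ := hodd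
      omega
    · rw [absGr, gr_self hz hmas, add_zero]
    · exact gr_point_neg hp hpq hε hN hz hmas (posIndex_ne_zero i) _ _
        (cos_point_posIndex hp hpq hε hsin i) (cos_point_neg_posIndex hp hpq hε hsin i)
    · obtain ⟨e, he, hdeg⟩ := exists_equiv_homology hbdry
      exact ⟨e, he, hdeg _⟩
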